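/- **Setting.** For each $n\ge1$ observe $X_t=f_t+\varepsilon_t$, $1\le t\le n$, with $f_t=f_0+\sum_{j=1}^{q_n}d_j\mathbb I\{t\ge k_j+1\}$, change points $0=k_0<k_1<\dots<k_{q_n}<k_{q_n+1}=n$ and jumps $d_j\ne0$ ($f_0,q_n,k_j,d_j,\varepsilon_t$ may depend on $n$). Let $\delta_j=\min(k_j-k_{j-1},k_{j+1}-k_j)$ and $D_n=\min_{1\le j\le q_n}d_j^2\delta_j$ ($=\infty$ if $q_n=0$), and assume $\max_j|d_j|=O(1)$, $\min_j\delta_j\to\infty$. For a sequence $(a_n)$ and points $p_j$ let $\mathcal M_n^{(12)}(p,a)$ be the event that for all $1\le j\le q_n$ and all integers $\ell\ge d_j^{-2}a_n$ $$\tfrac{\sqrt{d_j^{-2}a_n}}{\ell}\Big|\sum_{t=p_j-\ell+1}^{p_j}\varepsilon_t\Big|\le\omega_n^{(1)}\ (\ell\le k_j-k_{j-1}),\qquad \tfrac{\sqrt{d_j^{-2}a_n}}{\ell}\Big|\sum_{t=p_j+1}^{p_j+\ell}\varepsilon_t\Big|\le\omega_n^{(1)}\ (\ell\le k_{j+1}-k_j),$$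 where only sums with all indices in $\{1,\dots,n\}$ are considered. **Assumption 1 (errors).** $\mathsf E\varepsilon_t=0$ and $0<c\le\mathrm{Var}(\varepsilon_t)\le C<\infty$; the errors are ergodic in the sense that the averages over $1\le t\le n$ of $\varepsilon_t-\mathsf E\varepsilon_t$ and of $\varepsilon_t^2-\mathsf E\varepsilon_t^2$ tend to $0$ in probability; $\sqrt{\log n}=O(\omega_n)$ and with probability tending to one $|\sum_{t=s+1}^e\varepsilon_t|\le\omega_n\sqrt{e-s}$ for all $0\le s<e\le n$; and for all sequences $1\le a_n,b_n\le D_n$, with probability tending to one, $\mathcal M_n^{(12)}((k_j),a)$ holds and $|\sum_{t=k_j-\ell+1}^{k_j}\varepsilon_t|$, $|\sum_{t=k_j+1}^{k_j+\ell}\varepsilon_t|$ are at most $\omega_n^{(2)}\sqrt{d_j^{-2}b_n}$ for all $j$ and $1\le\ell\le d_j^{-2}b_n$. The rates satisfy $\max(1,\omega_n^{(2)})=O(\omega_n^{(1)})$ and $\omega_n^{(1)}=O(\omega_n)$. **Assumption 2 (size of changes).** $\omega_n^2/D_n\to0$. **Assumption 3 (penalty).** $\xi_n>0$, $\xi_n/D_n\to0$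 and $\omega_n^2/\xi_n\to0$. **MOSUM candidates.** For $\mathbf G=(G_\ell,G_r)$ and $G_\ell\le b\le n-G_r$ let $T_b(\mathbf G;X)=\sqrt{\tfrac{G_\ell G_r}{G_\ell+G_r}}\,\big(\bar X_{(b-G_\ell+1):b}-\bar X_{(b+1):(b+G_r)}\big)$. Let $\tau>0$ and $\alpha,\eta\in(0,1)$, and let the thresholds $D_n(\mathbf G;\alpha)$ be such that, uniformly over $\mathbf G\in\mathcal H=\mathcal H_n$, $\mathsf P(\max_b|T_b(\mathbf G;\varepsilon)|\le\tau D_n(\mathbf G;\alpha))\to1-\alpha$. $\mathcal C(\mathbf G,\alpha)$ is the set of points $c$ with $|T_c(\mathbf G;X)|>\tau D_n(\mathbf G;\alpha)$ that maximise $|T_b(\mathbf G;X)|$ over $c-\lfloor\eta G_\ell\rfloor\le b\le c+\lfloor\eta G_r\rfloor$ (ties are resolved in favour of the leftmost maximiser), and $\mathcal C(\mathcal H,\alpha)=\bigcup_{\mathbf G\in\mathcal H}\mathcal C(\mathbf G,\alpha)$. Here $G_0=G_{0,n}\ge1$ is an integer, $\omega_n^2/G_0\to0$, and $\mathcal H$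 is a set of pairs of bandwidths of the form $F_mG_0<\lfloor n/\log n\rfloor$, $m\ge1$ ($F_0=F_1=1$, $F_m=F_{m-1}+F_{m-2}$), with $\max(G_\ell,G_r)/\min(G_\ell,G_r)\le C_{\rm asym}$ for a constant $C_{\rm asym}$. Assume that for each $j$ there is $G(j)$ with $(G(j),G(j))\in\mathcal H$, $2G(j)\le\delta_j$ and $d_j^2G(j)\ge c_MD_n$, where $c_M>0$ is a constant, and that for each sequence $1\le a_n\le D_n$ the event $\mathcal M_n^{(12)}((k_j),a)\cap\mathcal M_n^{(12)}((k_j+G(j)),a)\cap\mathcal M_n^{(12)}((k_j-G(j)),a)$ has probability tending to one. **Assumption 4 (detection intervals).** Each $c\in\mathcal C(\mathcal H,\alpha)$ is assigned a detection interval $\mathcal I(c)=(c-G_L(c),c+G_R(c)]$, where $(G_L(c),G_R(c))\in\mathcal H$ is a pair with which $c$ was detected. For every sequence $\nu_n\to\infty$ and every $\kappa>0$, with probability tending to one, for each $j$ there is $\check c_j\in\mathcal C(\mathcal H,\alpha)$ with $d_j^2|\check c_j-k_j|\le(\omega_n^{(1)})^2\nu_n$ and $\xi_n\le\kappa\,d_j^2\min\{G_L(\check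 c_j),G_R(\check c_j)\}$. **Algorithm LocAlg** (with an arbitrary sorting function $h$, which may depend on the data). Start with the active set $\mathcal C=\mathcal C(\mathcal H,\alpha)$ and the accepted set $\widehat{\mathcal K}=\emptyset$, and repeat until $\mathcal C=\emptyset$: 1. Pick $c_\circ\in\mathcal C$ maximising $h$ (ties are broken arbitrarily). 2. Let $c_L$ be the largest point $<c_\circ$ among $\widehat{\mathcal K}\cup\{0\}$ and those $c\in\mathcal C$ with $\mathcal I(c)\cap\mathcal I(c_\circ)=\emptyset$; let $c_R$ be the smallest point $>c_\circ$ among $\widehat{\mathcal K}\cup\{n\}$ and those $c\in\mathcal C$ with $\mathcal I(c)\cap\mathcal I(c_\circ)=\emptyset$; set $\mathcal D=\mathcal C\cap(c_L,c_R)$. 3. For $A\subset\mathcal D$ let $\mathrm{SC}(A)=\frac n2\log\{\mathrm{RSS}(A\cup\widehat{\mathcal K}\cup(\mathcal C\setminus\mathcal D))/n\}+(|A|+|\widehat{\mathcal K}|+|\mathcal C\setminus\mathcal D|)\xi_n$, where $\mathrm{RSS}(B)$ is the residual sum of squares of $X_1,\dots,X_n$ after fitting a constant on each segment delimited by $B\cup\{0,n\}$.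 Let $\mathcal F$ be the collection of all $A\subset\mathcal D$ with $\mathrm{SC}(B)\le\mathrm{SC}(B')$ whenever $A\subset B\subset B'\subset\mathcal D$, and $m^*=\min_{A\in\mathcal F}|A|$. Let $\widehat A$ minimise $\mathrm{SC}$ over all $A$ obtained from some $A'\in\mathcal F$ with $m^*\le|A'|\le m^*+2$ by removing none, one or both of the first and last elements of $A'$; among the minimisers choose one of smallest cardinality (further ties are broken arbitrarily). 4. Add $\widehat A$ to $\widehat{\mathcal K}$. Remove from $\mathcal C$: the point $c_\circ$ and, if $\widehat A\ne\emptyset$, all $c\in\mathcal D\cap[\min\widehat A,\max\widehat A]$; all $c\in\mathcal D$ with $c<\min\widehat A$ provided that $c_L$ was $0$ or already accepted before this iteration; all $c\in\mathcal D$ with $c>\max\widehat A$ provided that $c_R$ was $n$ or already accepted before this iteration. **Theorem.** Under these assumptions LocAlg terminates, and for every sequence $\nu_n\to\infty$ its output $\widehat{\mathcal K}=\{\hat k_1<\dots<\hat k_{\hat q_n}\}$, however the arbitrary choices are made, satisfies $$\mathsf P\Big\{\hat q_n=q_n;\ \max_{1\le j\le q_n}d_j^2\,\big|\hat k_j\,\mathbb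 I_{j\le\hat q_n}-k_j\big|\le\nu_n(\omega_n^{(1)})^2\Big\}\to1 .$$ -/

import Mathlib

open MeasureTheory ProbabilityTheory Filter Topology Asymptotics

noncomputable section

namespace MosumPruning

/-! ### Events holding with probability tending to one -/

/-- `E n` holds with probability tending to one: the (outer) probability of the complement tends
to zero.  For measurable events this is `P (E n) → 1`, see `whp_iff`. -/
def WHP {Ω : Type*} [MeasurableSpace Ω] (P : Measure Ω) (E : ℕ → Set Ω) : Prop :=
  Tendsto (fun n => P (E n)ᶜ) atTop (𝓝 0)

theorem whp_iff {Ω : Type*} [MeasurableSpace Ω] (P : Measure Ω) [IsProbabilityMeasure P]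
    (E : ℕ → Set Ω) (hE : ∀ n, MeasurableSet (E n)) :
    WHP P E ↔ Tendsto (fun n => P (E n)) atTop (𝓝 1) := by
  have key : ∀ F : ℕ → Set Ω, (∀ n, MeasurableSet (F n)) →
      Tendsto (fun n => P (F n)) atTop (𝓝 0) → Tendsto (fun n => P (F n)ᶜ) atTop (𝓝 1) := by
    intro F hF h
    have h1 : Tendsto (fun n => 1 - P (F n)) atTop (𝓝 (1 - 0)) :=
      ENNReal.Tendsto.sub tendsto_const_nhds h (Or.inl ENNReal.one_ne_top)
    simpa [prob_compl_eq_one_sub (hF _)] using h1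
  constructor
  · intro h
    simpa using key (fun n => (E n)ᶜ) (fun n => (hE n).compl) h
  · intro h
    have h1 : Tendsto (fun n => 1 - P (E n)) atTop (𝓝 (1 - 1)) :=
      ENNReal.Tendsto.sub tendsto_const_nhds h (Or.inl ENNReal.one_ne_top)
    simpa [WHP, prob_compl_eq_one_sub (hE _)] using h1

/-! ### The change point model -/

/-- `δ_j = min (k_j - k_{j-1}, k_{j+1} - k_j)`. -/
def spacing (k : ℕ → ℕ) (j : ℕ) : ℕ := min (k j - k (j - 1)) (k (j + 1) - k j)

/-- The signal for every sample size `n ≥ 1`: the change points are `k n 1 < ... < k n (q n)`,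
with the conventions `k n 0 = 0` and `k n (q n + 1) = n`, and the jump sizes are
`d n 1, ..., d n (q n)`. -/
structure ChangePointModel where
  q : ℕ → ℕ
  k : ℕ → ℕ → ℕ
  d : ℕ → ℕ → ℝ
  f₀ : ℕ → ℝ
  k_zero : ∀ n, 1 ≤ n → k n 0 = 0
  k_last : ∀ n, 1 ≤ n → k n (q n + 1) = n
  k_lt : ∀ n, 1 ≤ n → ∀ j, j ≤ q n → k n j < k n (j + 1)
  d_ne_zero : ∀ n j, 1 ≤ j → j ≤ q n → d n j ≠ 0
  d_bounded : ∃ C : ℝ, ∀ᶠ n in atTop, ∀ j, 1 ≤ j → j ≤ q n → |d n j| ≤ C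
  spacing_tendsto : ∀ K : ℕ, ∀ᶠ n in atTop, ∀ j, 1 ≤ j → j ≤ q n → K ≤ spacing (k n) j

namespace ChangePointModel

/-- The piecewise constant signal `f_t = f₀ + ∑_j d_j 1{t ≥ k_j + 1}`. -/
def signal (M : ChangePointModel) (n t : ℕ) : ℝ :=
  M.f₀ n + ∑ j ∈ Finset.Icc 1 (M.q n), if M.k n j + 1 ≤ t then M.d n j else 0

/-- The observations `X_t = f_t + ε_t`. -/
def obs {Ω : Type*} (M : ChangePointModel) (ε : ℕ → ℕ → Ω → ℝ) (n : ℕ) (x : Ω) (t : ℕ) : ℝ :=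
  M.signal n t + ε n t x

/-- `D_n = min_j d_j² δ_j` (equal to `∞` if there are no change points). -/
def D (M : ChangePointModel) (n : ℕ) : ENNReal :=
  ⨅ j ∈ Finset.Icc 1 (M.q n), ENNReal.ofReal (M.d n j ^ 2 * (spacing (M.k n) j : ℝ))

/-- The sequences `a_n` with `1 ≤ a_n ≤ D_n` (for all large `n`). -/
def Admissible (M : ChangePointModel) (a : ℕ → ℝ) : Prop :=
  ∀ᶠ n in atTop, 1 ≤ a n ∧ ENNReal.ofReal (a n) ≤ M.D n

end ChangePointModel

/-! ### Assumptions on the errors, the size of the changes and the penalty -/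

/-- The event bounding all normalised partial sums: for `0 ≤ s < e ≤ n`,
`(e - s)^{-1/2} |∑_{t=s+1}^e ε_t| ≤ w`. -/
def event11 {Ω : Type*} (ε : ℕ → ℕ → Ω → ℝ) (w : ℕ → ℝ) (n : ℕ) : Set Ω :=
  {x | ∀ s e : ℕ, s < e → e ≤ n →
    1 / √((e : ℝ) - s) * |∑ t ∈ Finset.Ioc s e, ε n t x| ≤ w n}

/-- The weighted partial sum bounds to the left and to the right of reference points `p n j`
(`p n j = k_j` or `p n j = k_j ± G(j)`):
for all `j` and `d_j⁻² a_n ≤ ℓ ≤ k_j - k_{j-1}`,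
`(d_j⁻² a_n)^{1/2} / ℓ * |∑_{t=p-ℓ+1}^{p} ε_t| ≤ w`, and analogously to the right for
`d_j⁻² a_n ≤ ℓ ≤ k_{j+1} - k_j`.  Only sums over observed errors (`1 ≤ t ≤ n`) are considered. -/
def event12 {Ω : Type*} (M : ChangePointModel) (ε : ℕ → ℕ → Ω → ℝ) (p : ℕ → ℕ → ℕ)
    (a w : ℕ → ℝ) (n : ℕ) : Set Ω :=
  {x | ∀ j, 1 ≤ j → j ≤ M.q n → ∀ ℓ : ℕ, a n / M.d n j ^ 2 ≤ ℓ →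
    (ℓ ≤ M.k n j - M.k n (j - 1) → ℓ ≤ p n j →
      √(a n / M.d n j ^ 2) / ℓ * |∑ t ∈ Finset.Ioc (p n j - ℓ) (p n j), ε n t x| ≤ w n) ∧
    (ℓ ≤ M.k n (j + 1) - M.k n j → p n j + ℓ ≤ n →
      √(a n / M.d n j ^ 2) / ℓ * |∑ t ∈ Finset.Ioc (p n j) (p n j + ℓ), ε n t x| ≤ w n)}

/-- The maximal partial sum bounds in the `d_j⁻² b_n`-neighbourhoods of the change points. -/
def event13 {Ω : Type*} (M : ChangePointModel) (ε : ℕ → ℕ → Ω → ℝ) (b w : ℕ → ℝ) (n : ℕ) :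
    Set Ω :=
  {x | ∀ j, 1 ≤ j → j ≤ M.q n → ∀ ℓ : ℕ, 1 ≤ ℓ → (ℓ : ℝ) ≤ b n / M.d n j ^ 2 →
    1 / √(b n / M.d n j ^ 2) * |∑ t ∈ Finset.Ioc (M.k n j - ℓ) (M.k n j), ε n t x| ≤ w n ∧
    1 / √(b n / M.d n j ^ 2) * |∑ t ∈ Finset.Ioc (M.k n j) (M.k n j + ℓ), ε n t x| ≤ w n}

/-- Ergodicity of a possibly non-stationary error array: the time averages of `ε_t` and of `ε_t²`
are asymptotically equal, in probability, to their ensemble averages.  (Stationary shift-ergodic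
sequences with finite variance have this property by Birkhoff's theorem.) -/
def IsErgodicArray {Ω : Type*} [MeasurableSpace Ω] (P : Measure Ω) (ε : ℕ → ℕ → Ω → ℝ) : Prop :=
  TendstoInMeasure P
    (fun (n : ℕ) x => (∑ t ∈ Finset.Icc 1 n, (ε n t x - ∫ y, ε n t y ∂P)) / n)
    atTop (fun _ => 0) ∧
  TendstoInMeasure P
    (fun (n : ℕ) x => (∑ t ∈ Finset.Icc 1 n, (ε n t x ^ 2 - ∫ y, ε n t y ^ 2 ∂P)) / n)
    atTop (fun _ => 0)

/-- The assumption on the error distribution, with rates `w = ω_n`, `w₁ = ω_n^{(1)}`,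
`w₂ = ω_n^{(2)}`. -/
structure ErrorAssumption {Ω : Type*} [MeasurableSpace Ω] (P : Measure Ω)
    (M : ChangePointModel) (ε : ℕ → ℕ → Ω → ℝ) (w w₁ w₂ : ℕ → ℝ) : Prop where
  measurable : ∀ n t, 1 ≤ t → t ≤ n → Measurable (ε n t)
  memLp : ∀ n t, 1 ≤ t → t ≤ n → MemLp (ε n t) 2 P
  mean_zero : ∀ n t, 1 ≤ t → t ≤ n → ∫ x, ε n t x ∂P = 0
  variance_bounds : ∃ c C : ℝ, 0 < c ∧ ∀ n t, 1 ≤ t → t ≤ n →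
    c ≤ Var[ε n t; P] ∧ Var[ε n t; P] ≤ C
  ergodic : IsErgodicArray P ε
  log_le : (fun n : ℕ => √(Real.log n)) =O[atTop] w
  whp11 : WHP P (event11 ε w)
  whp12_13 : ∀ a b : ℕ → ℝ, M.Admissible a → M.Admissible b →
    WHP P (fun n => event12 M ε M.k a w₁ n ∩ event13 M ε b w₂ n)

/-- The rate conditions `max(1, ω^{(2)}) = O(ω^{(1)})` and `ω^{(1)} = O(ω)`. -/
structure RateAssumption (w w₁ w₂ : ℕ → ℝ) : Prop where
  one_le : (fun _ : ℕ => (1 : ℝ)) =O[atTop] w₁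
  second_le_first : w₂ =O[atTop] w₁
  first_le : w₁ =O[atTop] w

/-- The multiscale lower bound on the size of changes, `ω_n² / D_n → 0`. -/
def SizeAssumption (M : ChangePointModel) (w : ℕ → ℝ) : Prop :=
  Tendsto (fun n => ENNReal.ofReal (w n ^ 2) / M.D n) atTop (𝓝 0)

/-- The penalty is (eventually) positive with `ξ_n / D_n → 0` and `ω_n² / ξ_n → 0`. -/
structure PenaltyAssumption (M : ChangePointModel) (w ξ : ℕ → ℝ) : Prop where
  pos : ∀ᶠ n in atTop, 0 < ξ n
  div_D : Tendsto (fun n => ENNReal.ofReal (ξ n) / M.D n) atTop (𝓝 0)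
  noise_div : Tendsto (fun n => w n ^ 2 / ξ n) atTop (𝓝 0)

/-! ### Schwarz criterion -/

/-- The average of `X` over `(a, b]`. -/
def avg (X : ℕ → ℝ) (a b : ℕ) : ℝ := (∑ t ∈ Finset.Ioc a b, X t) / ((b : ℝ) - a)

/-- The point of `A ∪ {n}` that follows `a`. -/
def nextPoint (n : ℕ) (A : Finset ℕ) (a : ℕ) : ℕ := sInf {b | b ∈ insert n A ∧ a < b}

/-- The residual sum of squares after fitting a constant on each of the segments which
`A ⊆ (0, n)` induces on `(0, n]`. -/
def rss (X : ℕ → ℝ) (n : ℕ) (A : Finset ℕ) : ℝ :=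
  ∑ a ∈ insert 0 A, ∑ t ∈ Finset.Ioc a (nextPoint n A a), (X t - avg X a (nextPoint n A a)) ^ 2

/-- The candidates of `C` lying strictly between `cL` and `cR`. -/
def between (C : Finset ℕ) (cL cR : ℕ) : Finset ℕ := C.filter (fun c => cL < c ∧ c < cR)

/-- `SC(A | C, K, cL, cR)`, where `C` is the active set and `K` the set of accepted candidates. -/
def localSC (X : ℕ → ℝ) (n : ℕ) (ξ : ℝ) (C K : Finset ℕ) (cL cR : ℕ) (A : Finset ℕ) : ℝ :=
  (n : ℝ) / 2 * Real.log (rss X n (A ∪ K ∪ (C \ between C cL cR)) / n) +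
    ((A.card : ℝ) + K.card + (C \ between C cL cR).card) * ξ

/-! ### The inner algorithm `PrunAlg` -/

/-- `A` belongs to the collection `F`: it is a subset of `E` such that adding further candidates
of `E` to `A` monotonically increases the criterion. -/
def InF (sc : Finset ℕ → ℝ) (E A : Finset ℕ) : Prop :=
  A ⊆ E ∧ ∀ B B' : Finset ℕ, A ⊆ B → B ⊆ B' → B' ⊆ E → sc B ≤ sc B'

/-- The smallest cardinality of a member of `F`. -/
def mStar (sc : Finset ℕ → ℝ) (E : Finset ℕ) : ℕ := sInf {m | ∃ A, InF sc E A ∧ A.card = m}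

/-- `A ⊂_R A'`: `A` is a subset of `A'` containing all elements of `A'` except possibly the first
and the last one. -/
def InnerSubset (A A' : Finset ℕ) : Prop :=
  A ⊆ A' ∧ ∀ c ∈ A', c ∉ A → (∀ b ∈ A', c ≤ b) ∨ (∀ b ∈ A', b ≤ c)

/-- The sets over which the criterion is minimised. -/
def Feasible (sc : Finset ℕ → ℝ) (E A : Finset ℕ) : Prop :=
  ∃ A', InF sc E A' ∧ mStar sc E ≤ A'.card ∧ A'.card ≤ mStar sc E + 2 ∧ InnerSubset A A'

/-- `A` is a possible output of `PrunAlg`: a feasible minimiser of the criterion which has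
minimal cardinality among the minimisers (remaining ties being broken arbitrarily). -/
def IsPrunOutput (sc : Finset ℕ → ℝ) (E A : Finset ℕ) : Prop :=
  Feasible sc E A ∧ ∀ B, Feasible sc E B → sc A ≤ sc B ∧ (sc B = sc A → A.card ≤ B.card)

/-! ### The outer algorithm `LocAlg` -/

/-- `cL` is the closest point to the left of `c₀` which is `0`, accepted, or active with a
detection interval `(c - dL c, c + dR c]` disjoint from that of `c₀`. -/
def IsLeftEnd (dL dR : ℕ → ℕ) (C K : Finset ℕ) (c₀ cL : ℕ) : Prop :=
  IsGreatest {c | c < c₀ ∧ (c ∈ insert 0 K ∨ (c ∈ C ∧ (c : ℤ) + dR c ≤ c₀ - (dL c₀ : ℤ)))} cL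

/-- `cR` is the closest point to the right of `c₀` which is `n`, accepted, or active with a
detection interval disjoint from that of `c₀`. -/
def IsRightEnd (n : ℕ) (dL dR : ℕ → ℕ) (C K : Finset ℕ) (c₀ cR : ℕ) : Prop :=
  IsLeast {c | c₀ < c ∧ (c ∈ insert n K ∨ (c ∈ C ∧ (c₀ : ℤ) + dR c₀ ≤ c - (dL c : ℤ)))} cR

/-- The set of candidates for which a decision has been reached: `c₀`, the candidates in
`E = C ∩ (cL, cR)` between two elements of `A`, and those to the left (right) of all elements
of a non-empty `A` if `cL` (`cR`) has been accepted or is `0` (`n`). -/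
def IsDecided (n : ℕ) (K E A : Finset ℕ) (c₀ cL cR c : ℕ) : Prop :=
  c = c₀ ∨ (c ∈ E ∧ A.Nonempty ∧
    (((∃ a ∈ A, a ≤ c) ∧ (∃ b ∈ A, c ≤ b)) ∨
      (cL ∈ insert 0 K ∧ ∀ a ∈ A, c < a) ∨
      (cR ∈ insert n K ∧ ∀ a ∈ A, a < c)))

/-- One iteration of `LocAlg`, from the active and accepted sets `(C, K)` to `(C', K')`, for the
sorting function `h` (ties in `h` being broken arbitrarily). -/
def LocStep (X : ℕ → ℝ) (n : ℕ) (ξ : ℝ) (dL dR : ℕ → ℕ) (h : ℕ → ℝ)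
    (C K C' K' : Finset ℕ) : Prop :=
  ∃ c₀ cL cR : ℕ, ∃ A : Finset ℕ,
    c₀ ∈ C ∧ (∀ c ∈ C, h c ≤ h c₀) ∧
    IsLeftEnd dL dR C K c₀ cL ∧ IsRightEnd n dL dR C K c₀ cR ∧
    IsPrunOutput (localSC X n ξ C K cL cR) (between C cL cR) A ∧
    K' = K ∪ A ∧
    ∀ c, c ∈ C' ↔ c ∈ C ∧ ¬ IsDecided n K (between C cL cR) A c₀ cL cR c

/-- `LocRun … C K R`: starting from the active set `C` and the accepted set `K`, a run of `LocAlg`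
ends with the accepted set `R`. -/
inductive LocRun (X : ℕ → ℝ) (n : ℕ) (ξ : ℝ) (dL dR : ℕ → ℕ) (h : ℕ → ℝ) :
    Finset ℕ → Finset ℕ → Finset ℕ → Prop
  | done (K : Finset ℕ) : LocRun X n ξ dL dR h ∅ K K
  | step (C K C' K' R : Finset ℕ) :
      LocStep X n ξ dL dR h C K C' K' → LocRun X n ξ dL dR h C' K' R →
      LocRun X n ξ dL dR h C K R

/-- `R` is an output of `LocAlg` applied to the candidate set `C`. -/
def IsLocAlgOutput (X : ℕ → ℝ) (n : ℕ) (ξ : ℝ) (dL dR : ℕ → ℕ) (h : ℕ → ℝ)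
    (C R : Finset ℕ) : Prop :=
  LocRun X n ξ dL dR h C ∅ R

/-- The `j`-th smallest element of `R` for `1 ≤ j ≤ |R|`, and `0` for `j > |R|`. -/
def estimator (R : Finset ℕ) (j : ℕ) : ℕ := (R.sort (· ≤ ·)).getD (j - 1) 0

/-! ### Multiscale MOSUM candidates -/

/-- The MOSUM statistic at `b` with bandwidths `G = (G_ℓ, G_r)`. -/
def mosum (X : ℕ → ℝ) (G : ℕ × ℕ) (b : ℕ) : ℝ :=
  √((G.1 : ℝ) * G.2 / ((G.1 : ℝ) + G.2)) * (avg X (b - G.1) b - avg X b (b + G.2))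

open Classical in
/-- The candidates from the `η`-criterion with threshold `θ`: points at which the MOSUM detector
exceeds `θ` and which are the (leftmost, in case of ties) maximisers of the detector over
`[c - ⌊η G_ℓ⌋, c + ⌊η G_r⌋]`. -/
def mosumCand (X : ℕ → ℝ) (n : ℕ) (η θ : ℝ) (G : ℕ × ℕ) : Finset ℕ :=
  (Finset.Icc G.1 (n - G.2)).filter fun c =>
    θ < |mosum X G c| ∧
    ∀ b ∈ Finset.Icc G.1 (n - G.2), c ≤ b + ⌊η * G.1⌋₊ → b ≤ c + ⌊η * G.2⌋₊ →
      |mosum X G b| ≤ |mosum X G c| ∧ (b < c → |mosum X G b| < |mosum X G c|)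

/-- The union of the candidate sets over all pairs of bandwidths in `H`, with thresholds
`θ G`. -/
def multiscaleCand (X : ℕ → ℝ) (n : ℕ) (η : ℝ) (θ : ℕ × ℕ → ℝ) (H : Finset (ℕ × ℕ)) :
    Finset ℕ :=
  H.biUnion fun G => mosumCand X n η (θ G) G

/-- The bandwidths `G_m = F_m G₀`, `m ≥ 1`, below `⌊n / log n⌋`, with the Fibonacci numbers
`F_0 = F_1 = 1`. -/
def bandwidths (G₀ n : ℕ) : Set ℕ :=
  {G | ∃ m, 1 ≤ m ∧ G = Nat.fib (m + 1) * G₀ ∧ G < ⌊(n : ℝ) / Real.log n⌋₊}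

/-- `H n` is a set of pairs of bandwidths generated from `G₀` which are not too unbalanced, and
`ω_n² / G₀ → 0`. -/
structure BandwidthAssumption (w : ℕ → ℝ) (G₀ : ℕ → ℕ) (Casym : ℝ)
    (H : ℕ → Finset (ℕ × ℕ)) : Prop where
  pos : ∀ᶠ n in atTop, 0 < G₀ n
  mem : ∀ n, ∀ G ∈ H n, G.1 ∈ bandwidths (G₀ n) n ∧ G.2 ∈ bandwidths (G₀ n) n
  balanced : ∀ n, ∀ G ∈ H n, (max G.1 G.2 : ℝ) / (min G.1 G.2 : ℝ) ≤ Casym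
  noise_div : Tendsto (fun n => w n ^ 2 / (G₀ n : ℝ)) atTop (𝓝 0)

/-- The thresholds `θ n G = τ D_n(G; α)` have asymptotic level `α`, uniformly over the pairs of
bandwidths in `H n`: in the absence of change points no false positive is reported with asymptotic
probability `1 - α`. -/
def HasAsymptoticLevel {Ω : Type*} [MeasurableSpace Ω] (P : Measure Ω) (ε : ℕ → ℕ → Ω → ℝ)
    (α : ℝ) (H : ℕ → Finset (ℕ × ℕ)) (θ : ℕ → ℕ × ℕ → ℝ) : Prop :=
  ∀ κ : ℝ, 0 < κ → ∀ᶠ n in atTop, ∀ G ∈ H n,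
    |P.real {x | ∀ b ∈ Finset.Icc G.1 (n - G.2), |mosum (fun t => ε n t x) G b| ≤ θ n G}
      - (1 - α)| ≤ κ

/-- For each change point there is a suitable bandwidth `g n j = G(j)`, with constant `cM`. -/
structure SuitableBandwidths (M : ChangePointModel) (H : ℕ → Finset (ℕ × ℕ))
    (g : ℕ → ℕ → ℕ) (cM : ℝ) : Prop where
  mem : ∀ᶠ n in atTop, ∀ j, 1 ≤ j → j ≤ M.q n → (g n j, g n j) ∈ H n
  two_mul_le : ∀ᶠ n in atTop, ∀ j, 1 ≤ j → j ≤ M.q n → 2 * g n j ≤ spacing (M.k n) j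
  lower : ∀ᶠ n in atTop, ∀ j, 1 ≤ j → j ≤ M.q n →
    ENNReal.ofReal cM * M.D n ≤ ENNReal.ofReal (M.d n j ^ 2 * (g n j : ℝ))

/-- The error bounds around `k_j`, `k_j + G(j)` and `k_j - G(j)`. -/
def ShiftedErrorAssumption {Ω : Type*} [MeasurableSpace Ω] (P : Measure Ω)
    (M : ChangePointModel) (ε : ℕ → ℕ → Ω → ℝ) (g : ℕ → ℕ → ℕ) (w₁ : ℕ → ℝ) : Prop :=
  ∀ a : ℕ → ℝ, M.Admissible a →
    WHP P (fun n => event12 M ε M.k a w₁ n ∩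
      event12 M ε (fun n j => M.k n j + g n j) a w₁ n ∩
      event12 M ε (fun n j => M.k n j - g n j) a w₁ n)

/-- The assumption on the detection intervals `(c - dL c, c + dR c]` of the candidates in the
(random) candidate set `C`: with probability tending to one, each change point `k_j` has an
acceptable candidate `c` (`d_j² |c - k_j| ≤ ρ_n ν_n`, with `ν_n → ∞` arbitrarily slowly) for
which `ξ_n / (d_j² min(dL c, dR c))` is arbitrarily small, uniformly in `j`. -/
def DetectionIntervalAssumption {Ω : Type*} [MeasurableSpace Ω] (P : Measure Ω)
    (M : ChangePointModel) (ρ ξ : ℕ → ℝ) (C : ℕ → Ω → Finset ℕ) (dL dR : ℕ → Ω → ℕ → ℕ) : Prop :=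
  ∀ ν : ℕ → ℝ, Tendsto ν atTop atTop → ∀ κ : ℝ, 0 < κ →
    WHP P (fun n => {x | ∀ j, 1 ≤ j → j ≤ M.q n → ∃ c ∈ C n x,
      M.d n j ^ 2 * |(c : ℝ) - M.k n j| ≤ ρ n * ν n ∧
      ξ n ≤ κ * (M.d n j ^ 2 * (min (dL n x c) (dR n x c) : ℝ))})

end MosumPruning

end

open MosumPruning

noncomputable section

namespace MosumPruning

/-! ### Segmentations of `(0, n]` -/

/-! The probabilistic assumptions enter only through an event of probability tending to one; on it
the argument is deterministic and treats one realisation, a `Sample`. Distances to a change point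
are measured as `d_j² |p - k_j|` (`Near`). The proof separates the orders of magnitude `r₀ ≪ r₁ ≪ ξ
≪ d_j² δ_j`, with three scales `a < m < R` that are constant multiples of `ξ`. Up to scale `R` the
neighbourhoods of distinct change points are disjoint, so a point approximates at most one of them.

Inserting a point `c` into a segment `(s, e]` lowers the residual sum of squares by exactly the
squared CUSUM statistic (`rss_insert`), which is a sum of contributions of the jumps inside the
segment and of the noise. This gives three facts. If every change point is approximated at scale
`a`, a further point gains at most `9a` (`rss_le_of_cov`). If one change point is missed at scale
`m` and the others are covered at scale `R`, inserting a point within `r₀` of it gains at least `m /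
16` (`le_rss_of_not_cov`). If a change point is missed at scale `a`, a point within `r₀` of it is
strictly better than a point within `R` but outside `r₁` (`cusum_sq_lt`). As the residual sums of
squares are of exact order `n` where needed, the logarithm is essentially linear: the first gain is
worth at most `ξ / 4` and the second at least `4 ξ` (`exists_tame`).

For the inner algorithm, one good representative per outstanding change point gives a member of the
collection `F`, while every member of `F` must approximate all change points that the fixed points
do not cover at scale `m`. At most two outstanding change points are covered by fixed points, and
these are extreme ones. This explains the window `m* + 2` and the removal of first and last
elements: the right reference sets are feasible (`Call.feasible_of_reps`). Comparing the minimiser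
with such a set leaves neither missing, nor superfluous, nor badly located points (`Call.output`).

The outer algorithm preserves an invariant: accepted points are good and unique for their change
point, and a change point without an accepted estimate still has its very good candidate active
(`State.step`). Such a candidate could be lost only if an active, not yet accepted point shadows its
change point at scale `m`; the detection interval of the candidate is too long for that. When no
candidate is left, the invariant is the conclusion (`State.final`).

It remains to choose `r₁ = ω₁² ν₁` and `r₀ = ω₁² √ν₁` for a slowly diverging `ν₁ ≤ ν`. The number of
candidates is `O(n / G₀)` (`exists_card_multiscaleCand_le`), so with `ω² / G₀ → 0` fitting the noise
on all segments can explain only a small fraction of the total noise energy. -/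

/-- `(s, e]` is one of the segments which the points of `P` induce on `(0, n]`. -/
def IsGap (n : ℕ) (P : Finset ℕ) (s e : ℕ) : Prop :=
  s ∈ insert 0 P ∧ e ∈ insert n P ∧ s < e ∧ ∀ p ∈ P, p ≤ s ∨ e ≤ p

/-- All points of `P` lie in `(0, n)`. -/
def Inside (n : ℕ) (P : Finset ℕ) : Prop := ∀ p ∈ P, 0 < p ∧ p < n

theorem Inside.subset {n : ℕ} {P Q : Finset ℕ} (h : Inside n Q) (hs : P ⊆ Q) : Inside n P :=
  fun p hp => h p (hs hp)

theorem Inside.union {n : ℕ} {P Q : Finset ℕ} (h : Inside n P) (h' : Inside n Q) :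
    Inside n (P ∪ Q) := by
  intro p hp
  rcases Finset.mem_union.1 hp with hp | hp
  · exact h p hp
  · exact h' p hp

theorem Inside.insert {n c : ℕ} {P : Finset ℕ} (h : Inside n P) (h0 : 0 < c) (hn : c < n) :
    Inside n (insert c P) := by
  intro p hp
  rcases Finset.mem_insert.1 hp with rfl | hp
  · exact ⟨h0, hn⟩
  · exact h p hp

theorem IsGap.le {n : ℕ} {P : Finset ℕ} {s e : ℕ} (hP : Inside n P) (h : IsGap n P s e) :
    e ≤ n := by
  rcases Finset.mem_insert.1 h.2.1 with h1 | h1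
  · exact h1.le
  · exact (hP e h1).2.le

theorem exists_isGap {n : ℕ} {P : Finset ℕ} {c : ℕ} (h0 : 0 < c) (hn : c < n) (hc : c ∉ P) :
    ∃ s e, IsGap n P s e ∧ s < c ∧ c < e := by
  have h1 : ((insert 0 P).filter (· < c)).Nonempty :=
    ⟨0, by simp [h0]⟩
  have h2 : ((insert n P).filter (c < ·)).Nonempty :=
    ⟨n, by simp [hn]⟩
  have m1 := Finset.mem_filter.1 (Finset.max'_mem _ h1)
  have m2 := Finset.mem_filter.1 (Finset.min'_mem _ h2)
  refine ⟨_, _, ⟨m1.1, m2.1, m1.2.trans m2.2, ?_⟩, m1.2, m2.2⟩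
  intro p hp
  rcases lt_trichotomy p c with h | h | h
  · exact Or.inl (Finset.le_max' _ _ (by simp [hp, h]))
  · exact absurd (h ▸ hp) hc
  · exact Or.inr (Finset.min'_le _ _ (by simp [hp, h]))

theorem nextPoint_eq {n a b : ℕ} {P : Finset ℕ} (hb : b ∈ insert n P) (hab : a < b)
    (h : ∀ p ∈ insert n P, a < p → b ≤ p) : nextPoint n P a = b :=
  le_antisymm (Nat.sInf_le ⟨hb, hab⟩) (le_csInf ⟨b, hb, hab⟩ fun p hp => h p hp.1 hp.2)

theorem IsGap.nextPoint_eq {n : ℕ} {P : Finset ℕ} {s e : ℕ} (hP : Inside n P)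
    (h : IsGap n P s e) : nextPoint n P s = e := by
  refine MosumPruning.nextPoint_eq h.2.1 h.2.2.1 fun p hp hsp => ?_
  rcases Finset.mem_insert.1 hp with rfl | hp
  · exact h.le hP
  · rcases h.2.2.2 p hp with h1 | h1
    · omega
    · exact h1

theorem isGap_nextPoint {n a : ℕ} {P : Finset ℕ} (ha : a ∈ insert 0 P) (han : a < n) :
    IsGap n P a (nextPoint n P a) := by
  have hne : {b | b ∈ insert n P ∧ a < b}.Nonempty := ⟨n, by simp, han⟩
  have hm := Nat.sInf_mem hne
  refine ⟨ha, hm.1, hm.2, fun p hp => ?_⟩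
  by_cases hpa : p ≤ a
  · exact Or.inl hpa
  · exact Or.inr (Nat.sInf_le ⟨by simp [hp], by omega⟩)

/-- The sum of `F a b` over the segments `(a, b]` induced by `P` on `(0, n]`. -/
def segSum (F : ℕ → ℕ → ℝ) (n : ℕ) (P : Finset ℕ) : ℝ :=
  ∑ a ∈ insert 0 P, F a (nextPoint n P a)

/-- Only the segment containing `c` is cut; all others keep their end points. Both sides are sums,
so no property of `F` is needed. -/
theorem segSum_insert (F : ℕ → ℕ → ℝ) {n s c e : ℕ} {P : Finset ℕ} (hP : Inside n P)
    (hg : IsGap n P s e) (hsc : s < c) (hce : c < e) :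
    segSum F n (insert c P) + F s e = segSum F n P + F s c + F c e := by
  have hen := hg.le hP
  have hcP : c ∉ P := fun h => by rcases hg.2.2.2 c h with h | h <;> omega
  have hc0 : c ∉ insert 0 P := by simp [hcP]; omega
  have hP' : Inside n (insert c P) := hP.insert (by omega) (by omega)
  have g1 : IsGap n (insert c P) s c := by
    refine ⟨by have := hg.1; simp at this ⊢; tauto, by simp, hsc, fun p hp => ?_⟩
    rcases Finset.mem_insert.1 hp with rfl | hp
    · exact Or.inr le_rfl
    · rcases hg.2.2.2 p hp with h | h <;> omega
  have g2 : IsGap n (insert c P) c e := by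
    refine ⟨by simp, by have := hg.2.1; simp at this ⊢; tauto, hce, fun p hp => ?_⟩
    rcases Finset.mem_insert.1 hp with rfl | hp
    · exact Or.inl le_rfl
    · rcases hg.2.2.2 p hp with h | h <;> omega
  -- A start `a ≠ s` could get the new successor `c` only if `a < s < c`, but then `s` itself lies
  -- in `P` and comes earlier.
  have key : ∀ a ∈ (insert 0 P).erase s, nextPoint n (insert c P) a = nextPoint n P a := by
    intro a ha
    obtain ⟨has, ha⟩ := Finset.mem_erase.1 ha
    have han : a < n := by
      rcases Finset.mem_insert.1 ha with rfl | h
      · omega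
      · exact (hP a h).2
    have gb := isGap_nextPoint ha han
    refine MosumPruning.nextPoint_eq (by have := gb.2.1; simp at this ⊢; tauto) gb.2.2.1 ?_
    intro p hp hap
    have hp2 : p = n ∨ p = c ∨ p ∈ P := by simpa using hp
    rcases hp2 with rfl | rfl | hp2
    · exact gb.le hP
    · have hs : a ≤ s := by
        rcases Finset.mem_insert.1 ha with rfl | h
        · exact Nat.zero_le _
        · rcases hg.2.2.2 a h with h | h <;> omega
      have hsP : s ∈ P := by
        rcases Finset.mem_insert.1 hg.1 with h | h
        · omega
        · exact h
      rcases gb.2.2.2 s hsP with h | h <;> omega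
    · rcases gb.2.2.2 p hp2 with h | h <;> omega
  unfold segSum
  rw [Finset.insert_comm, Finset.sum_insert hc0, g2.nextPoint_eq hP',
    ← Finset.add_sum_erase _ _ hg.1, ← Finset.add_sum_erase _ _ hg.1, g1.nextPoint_eq hP',
    hg.nextPoint_eq hP, Finset.sum_congr rfl fun a ha => by rw [key a ha]]
  ring

theorem segSum_empty (F : ℕ → ℕ → ℝ) {n : ℕ} (hn : 0 < n) : segSum F n ∅ = F 0 n := by
  have : nextPoint n ∅ 0 = n := MosumPruning.nextPoint_eq (by simp) hn (by simp)
  simp [segSum, this]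

/-- An additive `F` does not notice the cut made by `segSum_insert`, so points can be inserted one
at a time starting from the trivial segmentation. -/
theorem segSum_of_additive (F : ℕ → ℕ → ℝ) {n : ℕ} (hn : 0 < n) {P : Finset ℕ} (hP : Inside n P)
    (hF : ∀ s c e, s < c → c < e → F s c + F c e = F s e) : segSum F n P = F 0 n := by
  induction P using Finset.induction_on with
  | empty => exact segSum_empty F hn
  | insert c P hc ih =>
    have hP' := hP.subset (Finset.subset_insert c P)
    have hcm := hP c (by simp)
    obtain ⟨s, e, hg, h1, h2⟩ := exists_isGap hcm.1 hcm.2 hc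
    have := segSum_insert F hP' hg h1 h2
    have h3 := hF s c e h1 h2
    have := ih hP'
    linarith

/-! ### Residual sums of squares -/

/-- The partial sum of `X` over `(a, b]`. -/
def psum (X : ℕ → ℝ) (a b : ℕ) : ℝ := ∑ t ∈ Finset.Ioc a b, X t

/-- The residual sum of squares of a constant fit on `(a, b]`. -/
def cost (X : ℕ → ℝ) (a b : ℕ) : ℝ := ∑ t ∈ Finset.Ioc a b, (X t - avg X a b) ^ 2

/-- The CUSUM statistic of the split of `(s, e]` at `c`. -/
def cusum (X : ℕ → ℝ) (s c e : ℕ) : ℝ :=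
  √(((c : ℝ) - s) * ((e : ℝ) - c) / ((e : ℝ) - s)) * (avg X s c - avg X c e)

theorem avg_eq (X : ℕ → ℝ) (a b : ℕ) : avg X a b = psum X a b / ((b : ℝ) - a) := rfl

theorem psum_add_psum (X : ℕ → ℝ) {a b c : ℕ} (hab : a ≤ b) (hbc : b ≤ c) :
    psum X a b + psum X b c = psum X a c := by
  unfold psum
  rw [← Finset.Ioc_union_Ioc_eq_Ioc hab hbc, Finset.sum_union]
  exact Finset.Ioc_disjoint_Ioc_of_le le_rfl

theorem cost_eq (X : ℕ → ℝ) {a b : ℕ} (hab : a < b) :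
    cost X a b = psum (fun t => X t ^ 2) a b - psum X a b ^ 2 / ((b : ℝ) - a) := by
  have h : (0 : ℝ) < (b : ℝ) - a := by have : (a : ℝ) < b := by exact_mod_cast hab
                                       linarith
  have h1 : cost X a b = psum (fun t => X t ^ 2) a b - 2 * avg X a b * psum X a b
      + ((b : ℝ) - a) * avg X a b ^ 2 := by
    unfold cost psum
    rw [Finset.mul_sum, ← Finset.sum_sub_distrib]
    have : ((b : ℝ) - a) * avg X a b ^ 2 = ∑ t ∈ Finset.Ioc a b, avg X a b ^ 2 := by
      rw [Finset.sum_const, Nat.card_Ioc, nsmul_eq_mul, Nat.cast_sub hab.le]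
    rw [this, ← Finset.sum_add_distrib]
    exact Finset.sum_congr rfl fun t _ => by ring
  rw [h1, avg_eq]
  field_simp
  ring

/-- The total length is left as a sum of two lengths so that the right side is literally a
`splitGain`. -/
theorem cusum_sq (X : ℕ → ℝ) {s c e : ℕ} (hsc : s < c) (hce : c < e) :
    cusum X s c e ^ 2 = psum X s c ^ 2 / ((c : ℝ) - s) + psum X c e ^ 2 / ((e : ℝ) - c)
      - (psum X s c + psum X c e) ^ 2 / (((c : ℝ) - s) + ((e : ℝ) - c)) := by
  have h1 : (0 : ℝ) < (c : ℝ) - s := by have : (s : ℝ) < c := by exact_mod_cast hsc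
                                        linarith
  have h2 : (0 : ℝ) < (e : ℝ) - c := by have : (c : ℝ) < e := by exact_mod_cast hce
                                        linarith
  have h3 : (0 : ℝ) < (e : ℝ) - s := by linarith
  have h4 : ((c : ℝ) - s) + ((e : ℝ) - c) = (e : ℝ) - s := by ring
  unfold cusum
  rw [mul_pow, Real.sq_sqrt (by positivity), avg_eq, avg_eq, h4]
  field_simp
  generalize hα : (c : ℝ) - s = α at *
  generalize hβ : (e : ℝ) - c = β at *
  rw [← h4]
  ring

/-- Decomposition of the variance on `(s, e]` into the parts within and between the two pieces. -/
theorem cost_split (X : ℕ → ℝ) {s c e : ℕ} (hsc : s < c) (hce : c < e) :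
    cost X s e = cost X s c + cost X c e + cusum X s c e ^ 2 := by
  rw [cost_eq X hsc, cost_eq X hce, cost_eq X (hsc.trans hce), cusum_sq X hsc hce,
    ← psum_add_psum X hsc.le hce.le, ← psum_add_psum (fun t => X t ^ 2) hsc.le hce.le,
    show ((c : ℝ) - s) + ((e : ℝ) - c) = (e : ℝ) - s by ring]
  ring

theorem rss_eq_segSum (X : ℕ → ℝ) (n : ℕ) (P : Finset ℕ) : rss X n P = segSum (cost X) n P := rfl

/-- `segSum_insert` localises the change to one segment, and `cost_split` evaluates it there. From
here on, comparisons of residual sums of squares become statements about CUSUM statistics. -/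
theorem rss_insert (X : ℕ → ℝ) {n s c e : ℕ} {P : Finset ℕ} (hP : Inside n P)
    (hg : IsGap n P s e) (hsc : s < c) (hce : c < e) :
    rss X n P = rss X n (insert c P) + cusum X s c e ^ 2 := by
  have h1 := segSum_insert (cost X) hP hg hsc hce
  have h2 := cost_split X hsc hce
  rw [rss_eq_segSum, rss_eq_segSum]
  linarith

theorem rss_insert_le (X : ℕ → ℝ) {n c : ℕ} {P : Finset ℕ} (hP : Inside n P)
    (h0 : 0 < c) (hn : c < n) : rss X n (insert c P) ≤ rss X n P := by
  by_cases hc : c ∈ P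
  · rw [Finset.insert_eq_of_mem hc]
  · obtain ⟨s, e, hg, h1, h2⟩ := exists_isGap h0 hn hc
    rw [rss_insert X hP hg h1 h2]
    nlinarith [sq_nonneg (cusum X s c e)]

theorem rss_anti (X : ℕ → ℝ) {n : ℕ} {P Q : Finset ℕ} (hQ : Inside n Q) (h : P ⊆ Q) :
    rss X n Q ≤ rss X n P := by
  have : ∀ T : Finset ℕ, T ⊆ Q → rss X n (P ∪ T) ≤ rss X n P := by
    intro T
    induction T using Finset.induction_on with
    | empty => intro _; simp
    | insert c T hc ih =>
      intro hT
      have hT' : T ⊆ Q := (Finset.subset_insert c T).trans hT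
      have hc := hQ c (hT (by simp))
      rw [Finset.union_insert]
      exact (rss_insert_le X (hQ.subset (Finset.union_subset h hT')) hc.1 hc.2).trans (ih hT')
  have h1 := this Q subset_rfl
  rwa [Finset.union_eq_right.2 h] at h1

/-- If `X - ε` is constant on each segment, the residual sum of squares of `X` is that of `ε`. -/
theorem rss_of_signal_const (X ε : ℕ → ℝ) {n : ℕ} (hn : 0 < n) {P : Finset ℕ} (hP : Inside n P)
    (h : ∀ s e, IsGap n P s e → ∃ μ : ℝ, ∀ t ∈ Finset.Ioc s e, X t = μ + ε t) :
    rss X n P = ∑ t ∈ Finset.Ioc 0 n, ε t ^ 2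
      - segSum (fun a b => psum ε a b ^ 2 / ((b : ℝ) - a)) n P := by
  have h1 := segSum_of_additive (psum fun t => ε t ^ 2) hn hP
    (fun s c e h1 h2 => psum_add_psum _ h1.le h2.le)
  have : ∑ t ∈ Finset.Ioc 0 n, ε t ^ 2 = psum (fun t => ε t ^ 2) 0 n := rfl
  rw [this, ← h1, rss_eq_segSum]
  unfold segSum
  rw [← Finset.sum_sub_distrib]
  refine Finset.sum_congr rfl fun a ha => ?_
  have han : a < n := by
    rcases Finset.mem_insert.1 ha with rfl | h
    · omega
    · exact (hP a h).2
  have gb := isGap_nextPoint ha han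
  obtain ⟨μ, hμ⟩ := h _ _ gb
  have hlt := gb.2.2.1
  generalize nextPoint n P a = b at *
  have hpos : (0 : ℝ) < (b : ℝ) - a := by
    have : (a : ℝ) < b := by exact_mod_cast hlt
    linarith
  rw [← cost_eq ε hlt]
  have havg : avg X a b = μ + avg ε a b := by
    unfold avg
    rw [Finset.sum_congr rfl hμ, Finset.sum_add_distrib, Finset.sum_const, Nat.card_Ioc,
      nsmul_eq_mul, Nat.cast_sub hlt.le]
    field_simp
  unfold cost
  exact Finset.sum_congr rfl fun t ht => by rw [hμ t ht, havg]; ring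

/-! ### CUSUM statistics of step functions -/

theorem psum_add (X Y : ℕ → ℝ) (a b : ℕ) :
    psum (fun t => X t + Y t) a b = psum X a b + psum Y a b := Finset.sum_add_distrib

theorem psum_const (μ : ℝ) {a b : ℕ} (hab : a ≤ b) :
    psum (fun _ => μ) a b = ((b : ℝ) - a) * μ := by
  unfold psum
  rw [Finset.sum_const, Nat.card_Ioc, nsmul_eq_mul, Nat.cast_sub hab]

theorem psum_congr {X Y : ℕ → ℝ} {a b : ℕ} (h : ∀ t, a < t → t ≤ b → X t = Y t) :
    psum X a b = psum Y a b :=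
  Finset.sum_congr rfl fun t ht => h t (Finset.mem_Ioc.1 ht).1 (Finset.mem_Ioc.1 ht).2

theorem cusum_add (X Y : ℕ → ℝ) (s c e : ℕ) :
    cusum (fun t => X t + Y t) s c e = cusum X s c e + cusum Y s c e := by
  simp only [cusum, avg_eq, psum_add]
  ring

theorem cusum_sum {ι : Type*} (I : Finset ι) (X : ι → ℕ → ℝ) (a : ι → ℝ) (s c e : ℕ) :
    cusum (fun t => ∑ i ∈ I, a i * X i t) s c e = ∑ i ∈ I, a i * cusum (X i) s c e := by
  have h : ∀ u v : ℕ, psum (fun t => ∑ i ∈ I, a i * X i t) u v = ∑ i ∈ I, a i * psum (X i) u v := by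
    intro u v
    unfold psum
    rw [Finset.sum_comm]
    exact Finset.sum_congr rfl fun i _ => by rw [Finset.mul_sum]
  simp only [cusum, avg_eq, h]
  rw [Finset.sum_div, Finset.sum_div, ← Finset.sum_sub_distrib, Finset.mul_sum]
  exact Finset.sum_congr rfl fun i _ => by ring

theorem cusum_of_const {X : ℕ → ℝ} {μ : ℝ} {s c e : ℕ} (hsc : s < c) (hce : c < e)
    (h : ∀ t, s < t → t ≤ e → X t = μ) : cusum X s c e = 0 := by
  have h1 : (0 : ℝ) < (c : ℝ) - s := by
    have : (s : ℝ) < c := by exact_mod_cast hsc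
    linarith
  have h2 : (0 : ℝ) < (e : ℝ) - c := by
    have : (c : ℝ) < e := by exact_mod_cast hce
    linarith
  unfold cusum
  rw [avg_eq, avg_eq, psum_congr (Y := fun _ => μ) fun t ht ht' => h t ht (by omega),
    psum_congr (a := c) (Y := fun _ => μ) fun t ht ht' => h t (by omega) ht',
    psum_const μ hsc.le, psum_const μ hce.le]
  field_simp
  simp

/-- The indicator of `t ≥ k + 1`. -/
def step (k t : ℕ) : ℝ := if k + 1 ≤ t then 1 else 0

theorem psum_step_of_le {k a b : ℕ} (h : k ≤ a) (hab : a ≤ b) :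
    psum (step k) a b = (b : ℝ) - a := by
  rw [psum_congr (X := step k) (Y := fun _ => 1) fun t ht _ => if_pos (by omega), psum_const 1 hab, mul_one]

theorem psum_step_of_ge {k a b : ℕ} (h : b ≤ k) (hab : a ≤ b) :
    psum (step k) a b = 0 := by
  rw [psum_congr (X := step k) (Y := fun _ => 0) fun t _ ht => if_neg (by omega), psum_const 0 hab, mul_zero]

theorem psum_step {k a b : ℕ} (h : a ≤ k) (h' : k ≤ b) :
    psum (step k) a b = (b : ℝ) - k := by
  rw [← psum_add_psum _ h h', psum_step_of_ge le_rfl h, psum_step_of_le le_rfl h', zero_add]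

/-- The mean of the step is `(c - k) / (c - s)` on `(s, c]` and `1` on `(c, e]`, so the means differ
by `(k - s) / (c - s)`. -/
theorem cusum_step_sq_left {s k c e : ℕ} (hsk : s < k) (hkc : k ≤ c) (hce : c < e) :
    cusum (step k) s c e ^ 2 =
      ((k : ℝ) - s) ^ 2 * ((e : ℝ) - c) / (((c : ℝ) - s) * ((e : ℝ) - s)) := by
  have h0 : (s : ℝ) < k := by exact_mod_cast hsk
  have h1 : (k : ℝ) ≤ c := by exact_mod_cast hkc
  have h2 : (c : ℝ) < e := by exact_mod_cast hce
  have h3 : (0 : ℝ) < (c : ℝ) - s := by linarith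
  have h4 : (0 : ℝ) < (e : ℝ) - c := by linarith
  have h5 : (0 : ℝ) < (e : ℝ) - s := by linarith
  unfold cusum
  rw [mul_pow, Real.sq_sqrt (by positivity), avg_eq, avg_eq, psum_step hsk.le hkc,
    psum_step_of_le hkc hce.le]
  field_simp
  ring

theorem cusum_step_sq_right {s k c e : ℕ} (hsc : s < c) (hck : c ≤ k) (hke : k < e) :
    cusum (step k) s c e ^ 2 =
      ((e : ℝ) - k) ^ 2 * ((c : ℝ) - s) / (((e : ℝ) - c) * ((e : ℝ) - s)) := by
  have h0 : (s : ℝ) < c := by exact_mod_cast hsc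
  have h1 : (c : ℝ) ≤ k := by exact_mod_cast hck
  have h2 : (k : ℝ) < e := by exact_mod_cast hke
  have h3 : (0 : ℝ) < (c : ℝ) - s := by linarith
  have h4 : (0 : ℝ) < (e : ℝ) - c := by linarith
  have h5 : (0 : ℝ) < (e : ℝ) - s := by linarith
  unfold cusum
  rw [mul_pow, Real.sq_sqrt (by positivity), avg_eq, avg_eq, psum_step_of_ge hck hsc.le,
    psum_step hck hke.le]
  field_simp
  ring

/-- Bounds on the CUSUM statistic of a unit step. -/
theorem cusum_step_sq_le {s k c e : ℕ} (hsk : s < k) (hke : k < e) (hsc : s < c) (hce : c < e) :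
    cusum (step k) s c e ^ 2 ≤ (k : ℝ) - s ∧ cusum (step k) s c e ^ 2 ≤ (e : ℝ) - k ∧
    (k ≤ c → cusum (step k) s c e ^ 2 * ((c : ℝ) - s) ≤ ((k : ℝ) - s) ^ 2) ∧
    (c ≤ k → cusum (step k) s c e ^ 2 * ((e : ℝ) - c) ≤ ((e : ℝ) - k) ^ 2) := by
  have h0 : (s : ℝ) < k := by exact_mod_cast hsk
  have h1 : (k : ℝ) < e := by exact_mod_cast hke
  have h2 : (s : ℝ) < c := by exact_mod_cast hsc
  have h2' : (c : ℝ) < e := by exact_mod_cast hce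
  have h3 : (0 : ℝ) < (c : ℝ) - s := by linarith
  have h4 : (0 : ℝ) < (e : ℝ) - c := by linarith
  have h5 : (0 : ℝ) < (e : ℝ) - s := by linarith
  have h6 : (0 : ℝ) < (k : ℝ) - s := by linarith
  have h7 : (0 : ℝ) < (e : ℝ) - k := by linarith
  rcases le_total k c with h | h
  · have hk : (k : ℝ) ≤ c := by exact_mod_cast h
    have hq := cusum_step_sq_left hsk h hce
    have b1 : cusum (step k) s c e ^ 2 * ((c : ℝ) - s) ≤ ((k : ℝ) - s) ^ 2 := by
      rw [hq, div_mul_eq_mul_div, div_le_iff₀ (by positivity)]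
      have : ((e : ℝ) - c) ≤ (e : ℝ) - s := by linarith
      have h9 : 0 ≤ ((k : ℝ) - s) ^ 2 * ((c : ℝ) - s) := by positivity
      nlinarith
    refine ⟨?_, ?_, fun _ => b1, fun h' => ?_⟩
    · rw [hq, div_le_iff₀ (by positivity)]
      have a1 : ((k : ℝ) - s) * ((e : ℝ) - c) ≤ ((c : ℝ) - s) * ((e : ℝ) - s) := by gcongr
      nlinarith
    · rw [hq, div_le_iff₀ (by positivity)]
      have a1 : ((k : ℝ) - s) * ((k : ℝ) - s) ≤ ((c : ℝ) - s) * ((e : ℝ) - s) := by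
        gcongr
      have a2 : ((e : ℝ) - c) ≤ (e : ℝ) - k := by linarith
      have a3 : 0 ≤ ((c : ℝ) - s) * ((e : ℝ) - s) := by positivity
      nlinarith [mul_le_mul a1 a2 h4.le a3]
    · have : k = c := by omega
      subst this
      rw [hq, div_mul_eq_mul_div, div_le_iff₀ (by positivity)]
      have : ((k : ℝ) - s) ≤ (e : ℝ) - s := by linarith
      have h9 : 0 ≤ ((k : ℝ) - s) * ((e : ℝ) - k) ^ 2 := by positivity
      nlinarith
  · have hk : (c : ℝ) ≤ k := by exact_mod_cast h
    have hq := cusum_step_sq_right hsc h hke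
    have b1 : cusum (step k) s c e ^ 2 * ((e : ℝ) - c) ≤ ((e : ℝ) - k) ^ 2 := by
      rw [hq, div_mul_eq_mul_div, div_le_iff₀ (by positivity)]
      have : ((c : ℝ) - s) ≤ (e : ℝ) - s := by linarith
      have h9 : 0 ≤ ((e : ℝ) - k) ^ 2 * ((e : ℝ) - c) := by positivity
      nlinarith
    refine ⟨?_, ?_, fun h' => ?_, fun _ => b1⟩
    · rw [hq, div_le_iff₀ (by positivity)]
      have a1 : ((e : ℝ) - k) * ((e : ℝ) - k) ≤ ((e : ℝ) - c) * ((e : ℝ) - s) := by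
        gcongr
      have a2 : ((c : ℝ) - s) ≤ (k : ℝ) - s := by linarith
      have a3 : 0 ≤ ((e : ℝ) - c) * ((e : ℝ) - s) := by positivity
      nlinarith [mul_le_mul a1 a2 h3.le a3]
    · rw [hq, div_le_iff₀ (by positivity)]
      have a1 : ((e : ℝ) - k) * ((c : ℝ) - s) ≤ ((e : ℝ) - c) * ((e : ℝ) - s) := by gcongr
      nlinarith
    · have : k = c := by omega
      subst this
      rw [hq, div_mul_eq_mul_div, div_le_iff₀ (by positivity)]
      have : ((e : ℝ) - k) ≤ (e : ℝ) - s := by linarith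
      have h9 : 0 ≤ ((e : ℝ) - k) * ((k : ℝ) - s) ^ 2 := by positivity
      nlinarith

/-- A lower bound on the CUSUM statistic of a unit step for a split close to the step. -/
theorem le_cusum_step_sq {s k c e : ℕ} (hsk : s < k) (hke : k < e) (hsc : s < c) (hce : c < e)
    {m : ℝ} (h1 : m ≤ (k : ℝ) - s) (h2 : m ≤ (e : ℝ) - k)
    (h3 : 4 * |(c : ℝ) - k| ≤ m) : m / 4 ≤ cusum (step k) s c e ^ 2 := by
  have h0 : (s : ℝ) < k := by exact_mod_cast hsk
  have h0' : (k : ℝ) < e := by exact_mod_cast hke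
  have hm : 0 ≤ m := by linarith [abs_nonneg ((c : ℝ) - k)]
  -- Here `x`, `y` are the distances from the step to the two ends and `t` is the offset of the
  -- split. As `t ≤ x / 4` and `t ≤ y / 4`, the quotient is at least `(3/5) x y / (x + y)`, and `x y
  -- / (x + y) ≥ m / 2`.
  have key : ∀ x y t : ℝ, 0 < x → 0 < y → 0 ≤ t → m ≤ x → m ≤ y → 4 * t ≤ m →
      m / 4 ≤ x ^ 2 * (y - t) / ((x + t) * (x + y)) := by
    intro x y t hx hy ht hx' hy' ht'
    rw [le_div_iff₀ (by positivity)]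
    have e1 : (x + t) * (x + y) ≤ 5 / 4 * x * (x + y) := by
      have : x + t ≤ 5 / 4 * x := by linarith
      gcongr
    have e2 : x ^ 2 * (3 / 4 * y) ≤ x ^ 2 * (y - t) := by
      have : 3 / 4 * y ≤ y - t := by linarith
      gcongr
    have e3 : m * (x + y) ≤ 2 * (x * y) := by nlinarith
    have e4 : m / 4 * ((x + t) * (x + y)) ≤ m / 4 * (5 / 4 * x * (x + y)) := by gcongr
    nlinarith [mul_nonneg hx.le hy.le]
  rcases le_total k c with h | h
  · have hk : (k : ℝ) ≤ c := by exact_mod_cast h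
    rw [abs_of_nonneg (by linarith)] at h3
    rw [cusum_step_sq_left hsk h hce]
    have := key ((k : ℝ) - s) ((e : ℝ) - k) ((c : ℝ) - k) (by linarith) (by linarith)
      (by linarith) h1 h2 h3
    convert this using 2 <;> ring
  · have hk : (c : ℝ) ≤ k := by exact_mod_cast h
    rw [abs_of_nonpos (by linarith)] at h3
    rw [cusum_step_sq_right hsc h hke]
    have := key ((e : ℝ) - k) ((k : ℝ) - s) ((k : ℝ) - c) (by linarith) (by linarith)
      (by linarith) h2 h1 (by linarith)
    convert this using 2 <;> ring

/-! ### A single realisation of the change point model -/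

/-- The change points, the jumps and one realisation of the errors for one sample size. -/
structure Sample where
  n : ℕ
  q : ℕ
  k : ℕ → ℕ
  d : ℕ → ℝ
  f₀ : ℝ
  ε : ℕ → ℝ

namespace Sample

/-- The observations. -/
def obs (Z : Sample) (t : ℕ) : ℝ :=
  Z.f₀ + (∑ j ∈ Finset.Icc 1 Z.q, if Z.k j + 1 ≤ t then Z.d j else 0) + Z.ε t

/-- `j` is the index of a change point. -/
def Idx (Z : Sample) (j : ℕ) : Prop := 1 ≤ j ∧ j ≤ Z.q

/-- `p` is within distance `d_j⁻² r` of the change point `k_j`. -/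
def Near (Z : Sample) (r : ℝ) (j p : ℕ) : Prop := Z.d j ^ 2 * |(p : ℝ) - Z.k j| ≤ r

/-- The change points are separated at the scale `r`. -/
def Sep (Z : Sample) (r : ℝ) : Prop := ∀ j, Z.Idx j → 8 * r ≤ Z.d j ^ 2 * (spacing Z.k j : ℝ)

/-- `P ∪ {0, n}` contains a point within distance `d_j⁻² r` of the change point `k_j`. -/
def Cov (Z : Sample) (r : ℝ) (P : Finset ℕ) (j : ℕ) : Prop :=
  ∃ p ∈ insert 0 (insert Z.n P), Z.Near r j p

structure Regular (Z : Sample) : Prop where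
  n_pos : 0 < Z.n
  k_zero : Z.k 0 = 0
  k_last : Z.k (Z.q + 1) = Z.n
  k_lt : ∀ j, j ≤ Z.q → Z.k j < Z.k (j + 1)
  d_ne_zero : ∀ j, Z.Idx j → Z.d j ≠ 0

variable {Z : Sample}

theorem Near.mono {r r' : ℝ} {j p : ℕ} (h : Z.Near r j p) (hr : r ≤ r') : Z.Near r' j p :=
  le_trans h hr

theorem Cov.mono {r r' : ℝ} {P Q : Finset ℕ} {j : ℕ} (h : Z.Cov r P j) (hr : r ≤ r')
    (hPQ : P ⊆ Q) : Z.Cov r' Q j := by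
  obtain ⟨p, hp, h⟩ := h
  refine ⟨p, ?_, h.mono hr⟩
  simp only [Finset.mem_insert] at hp ⊢
  rcases hp with h | h | h
  · exact Or.inl h
  · exact Or.inr (Or.inl h)
  · exact Or.inr (Or.inr (hPQ h))

theorem Cov.of_mem {r : ℝ} {P : Finset ℕ} {j p : ℕ} (hp : p ∈ P) (h : Z.Near r j p) :
    Z.Cov r P j := ⟨p, by simp [hp], h⟩

/-- A neighbourhood of `k_j` is an interval: `t` is no farther from `k_j` than `p` if it lies to the
left of `k_j`, and no farther than `p'` otherwise. -/
theorem Near.convex {r : ℝ} {j p t p' : ℕ} (h : Z.Near r j p) (h' : Z.Near r j p')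
    (h1 : p ≤ t) (h2 : t ≤ p') : Z.Near r j t := by
  have h1 : (p : ℝ) ≤ t := by exact_mod_cast h1
  have h2 : (t : ℝ) ≤ p' := by exact_mod_cast h2
  unfold Near at *
  rcases le_total (t : ℝ) (Z.k j) with hk | hk
  · refine le_trans ?_ h
    gcongr 1
    rw [abs_of_nonpos (by linarith), abs_of_nonpos (by linarith)]
    linarith
  · refine le_trans ?_ h'
    gcongr 1
    rw [abs_of_nonneg (by linarith), abs_of_nonneg (by linarith)]
    linarith

theorem near_self {r : ℝ} (hr : 0 ≤ r) (j : ℕ) : Z.Near r j (Z.k j) := by simp [Near, hr]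

theorem Regular.k_lt_of_lt (hZ : Z.Regular) {i j : ℕ} (hij : i < j) (hj : j ≤ Z.q + 1) :
    Z.k i < Z.k j := by
  induction j, hij using Nat.le_induction with
  | base => exact hZ.k_lt i (by omega)
  | succ m hm ih => exact (ih (by omega)).trans (hZ.k_lt m (by omega))

theorem Regular.k_le_of_le (hZ : Z.Regular) {i j : ℕ} (hij : i ≤ j) (hj : j ≤ Z.q + 1) :
    Z.k i ≤ Z.k j := by
  rcases hij.eq_or_lt with rfl | h
  · exact le_rfl
  · exact (hZ.k_lt_of_lt h hj).le

theorem Regular.k_inside (hZ : Z.Regular) {j : ℕ} (hj : Z.Idx j) : 0 < Z.k j ∧ Z.k j < Z.n := by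
  have h1 := hZ.k_lt_of_lt (i := 0) (j := j) hj.1 (by have := hj.2; omega)
  have h2 := hZ.k_lt_of_lt (i := j) (j := Z.q + 1) (by have := hj.2; omega) le_rfl
  rw [hZ.k_zero] at h1
  rw [hZ.k_last] at h2
  exact ⟨h1, h2⟩

theorem Regular.spacing_le (hZ : Z.Regular) {i j : ℕ} (hij : i < j) (hi : Z.Idx i) (hj : Z.Idx j) :
    Z.k i + spacing Z.k i ≤ Z.k j ∧ Z.k i + spacing Z.k j ≤ Z.k j := by
  have h1 := hZ.k_le_of_le (i := i + 1) (j := j) hij (by have := hj.2; omega)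
  have h2 := hZ.k_le_of_le (i := i) (j := j - 1) (by omega) (by have := hj.2; omega)
  have h3 := hZ.k_lt i hi.2
  have h4 := hZ.k_lt (j - 1) (by have := hj.2; omega)
  rw [Nat.sub_add_cancel hj.1] at h4
  have h5 : spacing Z.k i ≤ Z.k (i + 1) - Z.k i := min_le_right _ _
  have h6 : spacing Z.k j ≤ Z.k j - Z.k (j - 1) := min_le_left _ _
  omega

theorem Regular.spacing_le_ends (hZ : Z.Regular) {j : ℕ} (hj : Z.Idx j) :
    spacing Z.k j ≤ Z.k j ∧ Z.k j + spacing Z.k j ≤ Z.n := by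
  have h1 := hZ.k_le_of_le (i := j + 1) (j := Z.q + 1) (by have := hj.2; omega) le_rfl
  have h3 := hZ.k_lt j hj.2
  have h5 : spacing Z.k j ≤ Z.k (j + 1) - Z.k j := min_le_right _ _
  have h6 : spacing Z.k j ≤ Z.k j - Z.k (j - 1) := min_le_left _ _
  rw [hZ.k_last] at h1
  omega

/-- The factor `d_j²` cancels against `Sep`: in plain distance the neighbourhood has radius at most
an eighth of the spacing, which keeps neighbourhoods disjoint and in order. -/
theorem Near.abs_le (hZ : Z.Regular) {r : ℝ} (hs : Z.Sep r) {j p : ℕ} (hj : Z.Idx j)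
    (h : Z.Near r j p) : 8 * |(p : ℝ) - Z.k j| ≤ spacing Z.k j := by
  have hd : 0 < Z.d j ^ 2 := by have := hZ.d_ne_zero j hj; positivity
  have h1 := hs j hj
  unfold Near at h
  have : Z.d j ^ 2 * (8 * |(p : ℝ) - Z.k j|) ≤ Z.d j ^ 2 * (spacing Z.k j : ℝ) := by linarith
  exact le_of_mul_le_mul_left this hd

theorem Near.lt (hZ : Z.Regular) {r : ℝ} (hs : Z.Sep r) {i j p p' : ℕ} (hi : Z.Idx i)
    (hj : Z.Idx j) (hij : i < j) (h : Z.Near r i p) (h' : Z.Near r j p') : p < p' := by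
  have h1 := h.abs_le hZ hs hi
  have h2 := h'.abs_le hZ hs hj
  obtain ⟨h3, h4⟩ := hZ.spacing_le hij hi hj
  have h5 := hZ.k_lt_of_lt hij (by have := hj.2; omega)
  have h3 : (Z.k i : ℝ) + spacing Z.k i ≤ Z.k j := by exact_mod_cast h3
  have h4 : (Z.k i : ℝ) + spacing Z.k j ≤ Z.k j := by exact_mod_cast h4
  have h5 : (Z.k i : ℝ) < Z.k j := by exact_mod_cast h5
  have h6 := le_abs_self ((p : ℝ) - Z.k i)
  have h7 := neg_abs_le ((p' : ℝ) - Z.k j)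
  have : (p : ℝ) < p' := by linarith
  exact_mod_cast this

/-- Every counting argument below rests on this assignment of points to change points. -/
theorem Near.unique (hZ : Z.Regular) {r : ℝ} (hs : Z.Sep r) {i j p : ℕ} (hi : Z.Idx i)
    (hj : Z.Idx j) (h : Z.Near r i p) (h' : Z.Near r j p) : i = j := by
  rcases lt_trichotomy i j with h1 | h1 | h1
  · exact absurd (h.lt hZ hs hi hj h1 h') (lt_irrefl _)
  · exact h1
  · exact absurd (h'.lt hZ hs hj hi h1 h) (lt_irrefl _)

/-- A point near `k_i` is far from `k_j`. -/
theorem Near.far (hZ : Z.Regular) {r : ℝ} (hs : Z.Sep r) {i j p : ℕ} (hi : Z.Idx i)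
    (hj : Z.Idx j) (hij : i ≠ j) (h : Z.Near r j p) :
    (spacing Z.k i : ℝ) / 2 ≤ |(p : ℝ) - Z.k i| ∧
      (spacing Z.k j : ℝ) / 2 ≤ |(p : ℝ) - Z.k i| := by
  have h2 := h.abs_le hZ hs hj
  have h6 := le_abs_self ((p : ℝ) - Z.k j)
  have h7 := neg_abs_le ((p : ℝ) - Z.k j)
  rcases lt_or_gt_of_ne hij with h1 | h1
  · obtain ⟨h3, h4⟩ := hZ.spacing_le h1 hi hj
    have h3 : (Z.k i : ℝ) + spacing Z.k i ≤ Z.k j := by exact_mod_cast h3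
    have h4 : (Z.k i : ℝ) + spacing Z.k j ≤ Z.k j := by exact_mod_cast h4
    have h8 := le_abs_self ((p : ℝ) - Z.k i)
    constructor <;> linarith
  · obtain ⟨h3, h4⟩ := hZ.spacing_le h1 hj hi
    have h3 : (Z.k j : ℝ) + spacing Z.k j ≤ Z.k i := by exact_mod_cast h3
    have h4 : (Z.k j : ℝ) + spacing Z.k i ≤ Z.k i := by exact_mod_cast h4
    have h8 := neg_abs_le ((p : ℝ) - Z.k i)
    constructor <;> linarith

/-- A covering point of `k_i` can be taken to be an end point of the segment containing `k_i`. -/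
theorem Cov.gap {P : Finset ℕ} {r : ℝ} {i s e : ℕ} (hP : Inside Z.n P) (hg : IsGap Z.n P s e)
    (hs : s < Z.k i) (he : Z.k i < e) (h : Z.Cov r P i) : Z.Near r i s ∨ Z.Near r i e := by
  obtain ⟨p, hp, h⟩ := h
  have hr : 0 ≤ r := le_trans (by positivity) h
  have hen := hg.le hP
  have : p ≤ s ∨ e ≤ p := by
    simp only [Finset.mem_insert] at hp
    rcases hp with rfl | rfl | hp
    · exact Or.inl (Nat.zero_le _)
    · exact Or.inr hen
    · exact hg.2.2.2 p hp
  rcases this with h1 | h1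
  · exact Or.inl (h.convex (near_self hr i) h1 hs.le)
  · exact Or.inr ((near_self hr i).convex h he.le h1)

/-- The indices of the change points inside `(s, e)`. -/
def inGap (Z : Sample) (s e : ℕ) : Finset ℕ :=
  (Finset.Icc 1 Z.q).filter fun i => s < Z.k i ∧ Z.k i < e

theorem mem_inGap {s e i : ℕ} : i ∈ Z.inGap s e ↔ Z.Idx i ∧ s < Z.k i ∧ Z.k i < e := by
  simp [inGap, Idx]

/-- Each of the two end points is near at most one change point. -/
theorem card_inGap_le (hZ : Z.Regular) {r : ℝ} (hs : Z.Sep r) {s e : ℕ} {I : Finset ℕ}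
    (hI : ∀ i ∈ I, Z.Idx i) (h : ∀ i ∈ I, Z.Near r i s ∨ Z.Near r i e) : I.card ≤ 2 := by
  classical
  have h1 : I ⊆ (I.filter fun i => Z.Near r i s) ∪ (I.filter fun i => Z.Near r i e) := by
    intro i hi
    rcases h i hi with h | h <;> simp [hi, h]
  have h2 : ∀ p, (I.filter fun i => Z.Near r i p).card ≤ 1 := by
    intro p
    refine Finset.card_le_one.2 fun i hi j hj => ?_
    obtain ⟨hi, hi'⟩ := Finset.mem_filter.1 hi
    obtain ⟨hj, hj'⟩ := Finset.mem_filter.1 hj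
    exact hi'.unique hZ hs (hI i hi) (hI j hj) hj'
  have := Finset.card_le_card h1
  have := Finset.card_union_le (I.filter fun i => Z.Near r i s) (I.filter fun i => Z.Near r i e)
  have := h2 s
  have := h2 e
  omega

theorem obs_eq (Z : Sample) (t : ℕ) :
    Z.obs t = Z.f₀ + (∑ j ∈ Finset.Icc 1 Z.q, Z.d j * step (Z.k j) t) + Z.ε t := by
  simp [obs, step]

/-- The baseline and the jumps outside `(s, e)` are constant on `(s, e]`, and CUSUM statistics
ignore constants. -/
theorem cusum_obs (Z : Sample) {s c e : ℕ} (hsc : s < c) (hce : c < e) :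
    cusum Z.obs s c e =
      ∑ i ∈ Z.inGap s e, Z.d i * cusum (step (Z.k i)) s c e + cusum Z.ε s c e := by
  have h : Z.obs = fun t => (Z.f₀ + (∑ j ∈ Finset.Icc 1 Z.q, Z.d j * step (Z.k j) t)) + Z.ε t :=
    funext Z.obs_eq
  rw [h, cusum_add, cusum_add, cusum_sum, cusum_of_const hsc hce (fun _ _ _ => rfl), zero_add]
  congr 1
  symm
  refine Finset.sum_subset (Finset.filter_subset _ _) fun i hi hi' => ?_
  have : Z.k i ≤ s ∨ e ≤ Z.k i := by
    by_contra! hcon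
    exact hi' (Finset.mem_filter.2 ⟨hi, hcon.1, hcon.2⟩)
  rcases this with h | h
  · rw [cusum_of_const (X := step (Z.k i)) (μ := 1) hsc hce fun t ht _ => if_pos (by omega), mul_zero]
  · rw [cusum_of_const (X := step (Z.k i)) (μ := 0) hsc hce fun t _ ht => if_neg (by omega), mul_zero]

/-- All normalised partial sums of the errors are bounded by `ω`. -/
def SumBound (Z : Sample) (ω : ℝ) : Prop :=
  ∀ s e : ℕ, s < e → e ≤ Z.n → psum Z.ε s e ^ 2 ≤ ω ^ 2 * ((e : ℝ) - s)

/-- In `cusum_sq` the pooled term has a favourable sign, and each of the other two is at most `ω²`.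
-/
theorem SumBound.cusum_sq_le {ω : ℝ} (h : Z.SumBound ω) {s c e : ℕ} (hsc : s < c) (hce : c < e)
    (hen : e ≤ Z.n) : cusum Z.ε s c e ^ 2 ≤ 2 * ω ^ 2 := by
  have h1 : (0 : ℝ) < (c : ℝ) - s := by
    have : (s : ℝ) < c := by exact_mod_cast hsc
    linarith
  have h2 : (0 : ℝ) < (e : ℝ) - c := by
    have : (c : ℝ) < e := by exact_mod_cast hce
    linarith
  rw [cusum_sq _ hsc hce]
  have e1 : psum Z.ε s c ^ 2 / ((c : ℝ) - s) ≤ ω ^ 2 :=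
    (div_le_iff₀ h1).2 (h s c hsc (by omega))
  have e2 : psum Z.ε c e ^ 2 / ((e : ℝ) - c) ≤ ω ^ 2 :=
    (div_le_iff₀ h2).2 (h c e hce hen)
  have e3 : 0 ≤ (psum Z.ε s c + psum Z.ε c e) ^ 2 / (((c : ℝ) - s) + ((e : ℝ) - c)) := by
    positivity
  linarith

/-- Two jumps and the noise contribute at most `√r` each; squared, this is the `9 r` of
`rss_le_of_cov`. -/
theorem abs_sum_le {ω r : ℝ} (hω : Z.SumBound ω) (hωr : 2 * ω ^ 2 ≤ r)
    {s c e : ℕ} (hsc : s < c) (hce : c < e) (hen : e ≤ Z.n) {I : Finset ℕ} (hI : I.card ≤ 2)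
    (h : ∀ i ∈ I, Z.d i ^ 2 * cusum (step (Z.k i)) s c e ^ 2 ≤ r) :
    |∑ i ∈ I, Z.d i * cusum (step (Z.k i)) s c e + cusum Z.ε s c e| ≤ 3 * √r := by
  have h1 : |∑ i ∈ I, Z.d i * cusum (step (Z.k i)) s c e| ≤ 2 * √r := by
    refine (Finset.abs_sum_le_sum_abs _ _).trans ?_
    refine (Finset.sum_le_card_nsmul _ _ (√r) fun i hi => ?_).trans ?_
    · exact Real.abs_le_sqrt (by rw [mul_pow]; exact h i hi)
    · rw [nsmul_eq_mul]
      have : (I.card : ℝ) ≤ 2 := by exact_mod_cast hI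
      gcongr
  have h2 : |cusum Z.ε s c e| ≤ √r :=
    Real.abs_le_sqrt ((hω.cusum_sq_le hsc hce hen).trans hωr)
  exact (abs_add_le _ _).trans (by linarith)

/-- The contribution of a step close to an end point of the segment to a CUSUM statistic. -/
theorem step_bound_near {r : ℝ} {i s c e : ℕ} (hsk : s < Z.k i) (hke : Z.k i < e) (hsc : s < c)
    (hce : c < e) (h : Z.Near r i s ∨ Z.Near r i e) :
    Z.d i ^ 2 * cusum (step (Z.k i)) s c e ^ 2 ≤ r := by
  obtain ⟨h1, h2, -, -⟩ := cusum_step_sq_le hsk hke hsc hce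
  have h3 : (s : ℝ) < Z.k i := by exact_mod_cast hsk
  have h4 : (Z.k i : ℝ) < e := by exact_mod_cast hke
  unfold Near at h
  rcases h with h | h
  · refine le_trans ?_ h
    rw [abs_of_nonpos (by linarith)]
    gcongr
    linarith
  · refine le_trans ?_ h
    rw [abs_of_nonneg (by linarith)]
    gcongr

/-- With `x` the distance of `k_i` to the end point near it and `y` the distance of `c` to the same
end point, the squared CUSUM is at most `x² / y`. After scaling by `d_i²` this is at most `r'² / R`.
A moderate approximation therefore suffices when the new point is far away. -/
theorem step_bound_far {r r' R : ℝ} {i s c e : ℕ} (hsk : s < Z.k i) (hke : Z.k i < e)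
    (hsc : s < c) (hce : c < e) (h : Z.Near r' i s ∨ Z.Near r' i e) (hR0 : 0 < R)
    (hR : r' ≤ R) (hc : R ≤ Z.d i ^ 2 * |(c : ℝ) - Z.k i|) (hr : r' ^ 2 ≤ r * R) :
    Z.d i ^ 2 * cusum (step (Z.k i)) s c e ^ 2 ≤ r := by
  obtain ⟨-, -, h1, h2⟩ := cusum_step_sq_le hsk hke hsc hce
  have h3 : (s : ℝ) < Z.k i := by exact_mod_cast hsk
  have h4 : (Z.k i : ℝ) < e := by exact_mod_cast hke
  have h5 : (s : ℝ) < c := by exact_mod_cast hsc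
  have h6 : (c : ℝ) < e := by exact_mod_cast hce
  have hD := sq_nonneg (Z.d i)
  have hd : 0 < Z.d i ^ 2 := by
    rcases hD.eq_or_lt with h | h
    · rw [← h, zero_mul] at hc; linarith
    · exact h
  set D := Z.d i ^ 2
  set V := cusum (step (Z.k i)) s c e ^ 2 with hV
  have hV0 : 0 ≤ V := sq_nonneg _
  unfold Near at h
  have fin : ∀ x y : ℝ, 0 ≤ x → D * x ≤ r' → R ≤ D * y → V * y ≤ x ^ 2 → D * V ≤ r := by
    intro x y hx hx' hy hxy
    have e1 : (D * V) * R ≤ (D * V) * (D * y) := by gcongr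
    have e2 : (D * V) * (D * y) ≤ (D * x) ^ 2 := by
      have : D ^ 2 * (V * y) ≤ D ^ 2 * x ^ 2 := by gcongr
      linarith [this]
    have e3 : (D * x) ^ 2 ≤ r' ^ 2 := by gcongr
    exact le_of_mul_le_mul_right (by linarith) hR0
  rcases h with h | h
  · rw [abs_of_nonpos (by linarith)] at h
    -- A point `c` strictly between `s` and `k_i` would be closer to `k_i` than `s` is, against
    -- `hc`. Thus `c` lies beyond `k_i` as seen from `s`.
    have hkc : (Z.k i : ℝ) ≤ c := by
      by_contra! hcon
      rw [abs_of_nonpos (by linarith)] at hc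
      have : D * ((Z.k i : ℝ) - c) < D * ((Z.k i : ℝ) - s) := by gcongr
      linarith
    rw [abs_of_nonneg (by linarith)] at hc
    refine fin ((Z.k i : ℝ) - s) ((c : ℝ) - s) (by linarith) (by linarith) ?_
      (h1 (by exact_mod_cast hkc))
    have : D * ((c : ℝ) - Z.k i) ≤ D * ((c : ℝ) - s) := by gcongr
    linarith
  · rw [abs_of_nonneg (by linarith)] at h
    have hkc : (c : ℝ) ≤ Z.k i := by
      by_contra! hcon
      rw [abs_of_nonneg (by linarith)] at hc
      have : D * ((c : ℝ) - Z.k i) < D * ((e : ℝ) - Z.k i) := by gcongr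
      linarith
    rw [abs_of_nonpos (by linarith)] at hc
    refine fin ((e : ℝ) - Z.k i) ((e : ℝ) - c) (by linarith) (by linarith) ?_
      (h2 (by exact_mod_cast hkc))
    have : D * ((Z.k i : ℝ) - c) ≤ D * ((e : ℝ) - c) := by gcongr
    linarith

/-- Inserting a point reduces the residual sum of squares only slightly if every change point is
well approximated, or is moderately well approximated and far from the new point. -/
theorem rss_le_of_cov (hZ : Z.Regular) {ω r r' R : ℝ} (hω : Z.SumBound ω) (hωr : 2 * ω ^ 2 ≤ r)
    (hrR : r ≤ R) (hr'R : r' ≤ R) (hR : Z.Sep R) (hR0 : 0 < R) (hr' : r' ^ 2 ≤ r * R)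
    {P : Finset ℕ} (hP : Inside Z.n P) {c : ℕ} (hc0 : 0 < c) (hcn : c < Z.n)
    (h : ∀ i, Z.Idx i → Z.Cov r P i ∨ (Z.Cov r' P i ∧ ¬ Z.Near R i c)) :
    rss Z.obs Z.n P ≤ rss Z.obs Z.n (insert c P) + 9 * r := by
  by_cases hc : c ∈ P
  · rw [Finset.insert_eq_of_mem hc]
    nlinarith [sq_nonneg ω]
  obtain ⟨s, e, hg, hsc, hce⟩ := exists_isGap hc0 hcn hc
  rw [rss_insert _ hP hg hsc hce]
  have hcov : ∀ i ∈ Z.inGap s e, Z.d i ^ 2 * cusum (step (Z.k i)) s c e ^ 2 ≤ r ∧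
      (Z.Near R i s ∨ Z.Near R i e) := by
    intro i hi
    obtain ⟨hi, h1, h2⟩ := mem_inGap.1 hi
    rcases h i hi with h | ⟨h, h'⟩
    · have := h.gap hP hg h1 h2
      exact ⟨step_bound_near h1 h2 hsc hce this,
        this.imp (fun h => h.mono hrR) (fun h => h.mono hrR)⟩
    · have := h.gap hP hg h1 h2
      exact ⟨step_bound_far h1 h2 hsc hce this hR0 hr'R (not_le.1 h').le hr',
        this.imp (fun h => h.mono hr'R) (fun h => h.mono hr'R)⟩
  have hcard := card_inGap_le hZ hR (fun i hi => (mem_inGap.1 hi).1) fun i hi => (hcov i hi).2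
  have h1 := abs_sum_le hω hωr hsc hce (hg.le hP) hcard fun i hi => (hcov i hi).1
  rw [← cusum_obs Z hsc hce] at h1
  have h2 : cusum Z.obs s c e ^ 2 ≤ (3 * √r) ^ 2 := by
    rw [← sq_abs]
    gcongr
  rw [mul_pow, Real.sq_sqrt (by nlinarith [sq_nonneg ω])] at h2
  linarith

/-- Inserting a point close to a change point which has not been approximated reduces the residual
sum of squares substantially. -/
theorem le_rss_of_not_cov (hZ : Z.Regular) {ω r m r₀ R : ℝ} (hω : Z.SumBound ω)
    (hωr : 2 * ω ^ 2 ≤ r) (hm : 144 * r ≤ m) (hr₀ : 4 * r₀ ≤ m) (hmR : r₀ ≤ R)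
    (hR : Z.Sep R) (hR0 : 0 < R)
    (hr : ∀ i, Z.Idx i → 2 * R ^ 2 ≤ r * (Z.d i ^ 2 * (spacing Z.k i : ℝ)))
    {P : Finset ℕ} (hP : Inside Z.n P) {j c : ℕ} (hj : Z.Idx j) (hc0 : 0 < c) (hcn : c < Z.n)
    (hcj : Z.Near r₀ j c) (hcov : ¬ Z.Cov m P j) (h : ∀ i, Z.Idx i → i ≠ j → Z.Cov R P i) :
    rss Z.obs Z.n (insert c P) + m / 16 ≤ rss Z.obs Z.n P := by
  have hr0 : 0 ≤ r := by nlinarith [sq_nonneg ω]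
  have hr₀m : r₀ ≤ m := by linarith
  have hr₀0 : 0 ≤ r₀ := le_trans (by positivity) hcj
  have hc : c ∉ P := fun hc => hcov (Cov.of_mem hc (hcj.mono hr₀m))
  obtain ⟨s, e, hg, hsc, hce⟩ := exists_isGap hc0 hcn hc
  rw [rss_insert _ hP hg hsc hce]
  have hse : ¬ Z.Near m j s ∧ ¬ Z.Near m j e := by
    refine ⟨fun hs => hcov ⟨s, ?_, hs⟩, fun hs => hcov ⟨e, ?_, hs⟩⟩
    · have := hg.1
      simp only [Finset.mem_insert] at this ⊢
      tauto
    · have := hg.2.1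
      simp only [Finset.mem_insert] at this ⊢
      tauto
  -- If `s` were at or beyond `k_j`, it would lie between `k_j` and `c` and so be within `r₀`,
  -- although no point of the segmentation is within `m`. The same holds for `e`.
  have hsk : s < Z.k j := by
    by_contra! hcon
    exact hse.1 (((near_self hr₀0 j).convex hcj hcon hsc.le).mono hr₀m)
  have hke : Z.k j < e := by
    by_contra! hcon
    exact hse.2 ((hcj.convex (near_self hr₀0 j) hce.le hcon).mono hr₀m)
  have hsk' : (s : ℝ) < Z.k j := by exact_mod_cast hsk
  have hke' : (Z.k j : ℝ) < e := by exact_mod_cast hke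
  have hd : 0 < Z.d j ^ 2 := by have := hZ.d_ne_zero j hj; positivity
  have hmain : m / 4 ≤ Z.d j ^ 2 * cusum (step (Z.k j)) s c e ^ 2 := by
    have := le_cusum_step_sq hsk hke hsc hce (m := m / Z.d j ^ 2) ?_ ?_ ?_
    · rw [div_div, div_le_iff₀ (by positivity)] at this
      linarith
    · have h1 := not_le.1 hse.1
      rw [abs_of_nonpos (by linarith)] at h1
      rw [div_le_iff₀ hd]
      linarith
    · have h1 := not_le.1 hse.2
      rw [abs_of_nonneg (by linarith)] at h1
      rw [div_le_iff₀ hd]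
      linarith
    · rw [le_div_iff₀ hd]
      unfold Near at hcj
      linarith
  have hothers : ∀ i ∈ (Z.inGap s e).erase j, Z.d i ^ 2 * cusum (step (Z.k i)) s c e ^ 2 ≤ r ∧
      (Z.Near R i s ∨ Z.Near R i e) := by
    intro i hi
    obtain ⟨hij, hi⟩ := Finset.mem_erase.1 hi
    obtain ⟨hi, h1, h2⟩ := mem_inGap.1 hi
    have hn := (h i hi hij).gap hP hg h1 h2
    have hdi : 0 < Z.d i ^ 2 := by have := hZ.d_ne_zero i hi; positivity
    have hsep := hR i hi
    have hfar := ((hcj.mono hmR).far hZ hR hi hj hij).1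
    -- Being near `k_j`, the point `c` is at least half a spacing away from `k_i`. With this as the
    -- far scale, the coarse approximation at scale `R` is good enough by `hr`.
    refine ⟨step_bound_far (R := Z.d i ^ 2 * (spacing Z.k i : ℝ) / 2) h1 h2 hsc hce hn
      (by linarith) (by linarith) ?_ (by linarith [hr i hi]), hn⟩
    rw [mul_div_assoc]
    gcongr
  have hcard := card_inGap_le hZ hR (I := (Z.inGap s e).erase j)
    (fun i hi => (mem_inGap.1 (Finset.mem_of_mem_erase hi)).1) fun i hi => (hothers i hi).2
  have h1 := abs_sum_le hω hωr hsc hce (hg.le hP) hcard fun i hi => (hothers i hi).1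
  have h2 := cusum_obs Z hsc hce
  rw [← Finset.add_sum_erase _ _ (mem_inGap.2 ⟨hj, hsk, hke⟩), add_assoc] at h2
  have h3 : √m / 2 ≤ |Z.d j * cusum (step (Z.k j)) s c e| := by
    have : √m / 2 = √(m / 4) := by
      rw [Real.sqrt_div' _ (by norm_num), show (4 : ℝ) = 2 ^ 2 by norm_num,
        Real.sqrt_sq (by norm_num)]
    rw [this]
    exact Real.sqrt_le_iff.2 ⟨abs_nonneg _, by rw [sq_abs, mul_pow]; exact hmain⟩
  have h4 : 12 * √r ≤ √m := by
    have : 12 * √r = √(144 * r) := by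
      rw [Real.sqrt_mul (by norm_num), show (144 : ℝ) = 12 ^ 2 by norm_num,
        Real.sqrt_sq (by norm_num)]
    rw [this]
    exact Real.sqrt_le_sqrt hm
  -- The missed jump contributes at least `√m / 2`, everything else at most `3 √r ≤ √m / 4`.
  have h5 : √m / 4 ≤ |cusum Z.obs s c e| := by
    rw [h2]
    have h6 := abs_sub_abs_le_abs_sub (Z.d j * cusum (step (Z.k j)) s c e)
      (-(∑ x ∈ (Z.inGap s e).erase j, Z.d x * cusum (step (Z.k x)) s c e + cusum Z.ε s c e))
    rw [abs_neg, sub_neg_eq_add] at h6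
    linarith
  have h7 : (√m / 4) ^ 2 ≤ cusum Z.obs s c e ^ 2 := by
    rw [← sq_abs (cusum _ _ _ _)]
    gcongr
  rw [div_pow, Real.sq_sqrt (by linarith)] at h7
  linarith

end Sample

/-! ### Moving a point towards a change point -/

/-- The reduction of the residual sum of squares by splitting a segment into two segments of lengths
`α`, `β` with partial sums `A`, `B`. -/
def splitGain (A α B β : ℝ) : ℝ := A ^ 2 / α + B ^ 2 / β - (A + B) ^ 2 / (α + β)

theorem splitGain_comm (A α B β : ℝ) : splitGain A α B β = splitGain B β A α := by
  unfold splitGain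
  rw [add_comm A B, add_comm α β]
  ring

/-- Adding a constant `μ` to the data does not change the gain of a split, so the common level of
the two pieces may be removed. -/
theorem splitGain_shift (A B μ : ℝ) {α β : ℝ} (hα : 0 < α) (hβ : 0 < β) :
    splitGain (A + μ * α) α (B + μ * β) β = splitGain A α B β := by
  unfold splitGain
  field_simp
  ring

/-- Moving the split of a segment away from a jump of size `d` by the distance `ℓ`. -/
theorem splitGain_sub_ge {θ β p u v d x ℓ y : ℝ} (hx : 0 < x) (hℓ : 0 < ℓ) (hy : 0 < y)
    (hθ : 0 ≤ θ) (hθβ : 24 * θ ≤ β) (hβ1 : β ≤ 1) (hβ : β * (ℓ + y) ≤ y)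
    (hp : p ^ 2 ≤ θ ^ 2 * (d ^ 2 * ((x + ℓ) * x))) (hu : |u| ≤ θ * |d| * ℓ)
    (hv : |v| ≤ θ * |d| * y) :
    β / 2 * (d ^ 2 * ℓ) ≤
      splitGain (p + u) (x + ℓ) (v + d * y) y - splitGain p x (u + (v + d * y)) (ℓ + y) := by
  -- The pooled terms of the two splits coincide and cancel. The leading part of the remainder is
  -- `d² ℓ y / (ℓ + y) ≥ β d² ℓ`; the terms with `p`, `u` and `v` are perturbations controlled by
  -- `θ`.
  have hid : splitGain (p + u) (x + ℓ) (v + d * y) y - splitGain p x (u + (v + d * y)) (ℓ + y)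
      = ((v + d * y) ^ 2 * ℓ - 2 * u * (v + d * y) * y - u ^ 2 * y) / (y * (ℓ + y))
        + ((2 * p * u + u ^ 2) * x - p ^ 2 * ℓ) / ((x + ℓ) * x) := by
    unfold splitGain
    field_simp
    ring
  rw [hid]
  have hθ1 : θ ≤ 1 / 24 := by linarith
  have hD : 0 ≤ |d| := abs_nonneg d
  have hd2 : d ^ 2 = |d| ^ 2 := (sq_abs d).symm
  rw [hd2] at hp ⊢
  have hpabs : |p| ≤ θ * |d| * (x + ℓ) := by
    apply abs_le_of_sq_le_sq _ (by positivity)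
    refine hp.trans ?_
    have : (x + ℓ) * x ≤ (x + ℓ) * (x + ℓ) := by gcongr; linarith
    have : θ ^ 2 * (|d| ^ 2 * ((x + ℓ) * x)) ≤ θ ^ 2 * (|d| ^ 2 * ((x + ℓ) * (x + ℓ))) := by gcongr
    linarith
  have hV1 : (1 - θ) * |d| * y ≤ |v + d * y| := by
    have h1 := abs_sub_abs_le_abs_sub (d * y) (-v)
    rw [abs_neg, sub_neg_eq_add, abs_mul, abs_of_pos hy, add_comm (d * y)] at h1
    linarith
  have hV2 : |v + d * y| ≤ 2 * |d| * y := by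
    have h1 := abs_add_le v (d * y)
    rw [abs_mul, abs_of_pos hy] at h1
    have : θ * |d| * y ≤ 1 * |d| * y := by gcongr; linarith
    linarith
  have hV1' : (1 - 2 * θ) * (|d| ^ 2 * y ^ 2) ≤ (v + d * y) ^ 2 := by
    rw [← sq_abs (v + d * y)]
    have h0 : 0 ≤ (1 - θ) * |d| * y := by
      have : 0 ≤ 1 - θ := by linarith
      positivity
    have := pow_le_pow_left₀ h0 hV1 2
    linarith [mul_nonneg (sq_nonneg θ) (mul_nonneg (sq_nonneg |d|) (sq_nonneg y))]
  have hu2 : u ^ 2 ≤ θ ^ 2 * (|d| ^ 2 * ℓ ^ 2) := by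
    rw [← sq_abs u]
    have := pow_le_pow_left₀ (abs_nonneg u) hu 2
    linarith
  have huV : u * (v + d * y) ≤ 2 * θ * (|d| ^ 2 * (ℓ * y)) := by
    refine (le_abs_self _).trans ?_
    rw [abs_mul]
    have := mul_le_mul hu hV2 (abs_nonneg _) (by positivity)
    linarith
  have hpu : -(θ ^ 2 * (|d| ^ 2 * ((x + ℓ) * ℓ))) ≤ p * u := by
    have h1 := neg_abs_le (p * u)
    rw [abs_mul] at h1
    have := mul_le_mul hpabs hu (abs_nonneg _) (by positivity)
    linarith
  have e1 : (3 / 4 * β - θ ^ 2) * (|d| ^ 2 * ℓ) ≤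
      ((v + d * y) ^ 2 * ℓ - 2 * u * (v + d * y) * y - u ^ 2 * y) / (y * (ℓ + y)) := by
    rw [le_div_iff₀ (by positivity)]
    have a1 : (1 - 2 * θ) * (|d| ^ 2 * y ^ 2) * ℓ ≤ (v + d * y) ^ 2 * ℓ := by gcongr
    have a2 : u * (v + d * y) * y ≤ 2 * θ * (|d| ^ 2 * (ℓ * y)) * y := by gcongr
    have a3 : u ^ 2 * y ≤ θ ^ 2 * (|d| ^ 2 * ℓ ^ 2) * y := by gcongr
    -- The quarter lost here pays for the terms linear in `θ`, since `6 θ ≤ 1 / 4`.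
    have a4 : 3 / 4 * (β * (ℓ + y)) ≤ (1 - 6 * θ) * y := by
      have : 3 / 4 * y ≤ (1 - 6 * θ) * y := by gcongr; linarith
      linarith
    have a5 : 3 / 4 * (β * (ℓ + y)) * (|d| ^ 2 * (ℓ * y)) ≤
        (1 - 6 * θ) * y * (|d| ^ 2 * (ℓ * y)) := by gcongr
    have a6 : 0 ≤ θ ^ 2 * (|d| ^ 2 * ℓ * y ^ 2) := by positivity
    linarith
  have e2 : -(3 * θ ^ 2) * (|d| ^ 2 * ℓ) ≤
      ((2 * p * u + u ^ 2) * x - p ^ 2 * ℓ) / ((x + ℓ) * x) := by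
    rw [le_div_iff₀ (by positivity)]
    have a1 := mul_le_mul_of_nonneg_right hpu hx.le
    have a2 := mul_le_mul_of_nonneg_right hp hℓ.le
    have a3 : 0 ≤ u ^ 2 * x := by positivity
    linarith
  have e3 : 4 * θ ^ 2 ≤ β / 4 := by nlinarith [mul_nonneg hθ (sub_nonneg.2 hθ1)]
  have e4 : 0 ≤ |d| ^ 2 * ℓ := by positivity
  linarith [mul_le_mul_of_nonneg_right e3 e4]

/-- Moving the split of a segment away from a jump of size `d` by a negligible distance `ℓ`. -/
theorem splitGain_sub_le {p u v d x ℓ y r : ℝ} (hx : 0 < x) (hℓ : 0 < ℓ) (hy : 0 < y)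
    (hℓr : d ^ 2 * ℓ ≤ r) (hℓx : ℓ ≤ x) (hp : |p + u| ≤ |d| * (x + ℓ)) (hu : |d| * |u| ≤ r)
    (hv : |v| ≤ |d| * y) :
    splitGain (p + u) (x + ℓ) (v + d * y) y - splitGain p x (u + (v + d * y)) (ℓ + y)
      ≤ 12 * r := by
  -- The same difference as in `splitGain_sub_ge`, written in terms of `p + u`, which is the
  -- quantity bounded here. The squares in the second numerator then appear with a negative sign and
  -- can be dropped.
  have hid : splitGain (p + u) (x + ℓ) (v + d * y) y - splitGain p x (u + (v + d * y)) (ℓ + y)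
      = ((v + d * y) ^ 2 * ℓ - 2 * u * (v + d * y) * y - u ^ 2 * y) / (y * (ℓ + y))
        + (2 * (p + u) * u * (x + ℓ) - u ^ 2 * (x + ℓ) - (p + u) ^ 2 * ℓ) / ((x + ℓ) * x) := by
    unfold splitGain
    field_simp
    ring
  rw [hid]
  have hD : 0 ≤ |d| := abs_nonneg d
  have hr : 0 ≤ r := le_trans (by positivity) hℓr
  have hV2 : |v + d * y| ≤ 2 * |d| * y := by
    have h1 := abs_add_le v (d * y)
    rw [abs_mul, abs_of_pos hy] at h1
    linarith
  have hVs : (v + d * y) ^ 2 ≤ 4 * d ^ 2 * y ^ 2 := by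
    have := pow_le_pow_left₀ (abs_nonneg _) hV2 2
    rw [sq_abs, mul_pow, mul_pow, sq_abs] at this
    linarith
  have huV : -(u * (v + d * y)) ≤ 2 * r * y := by
    have h1 := neg_abs_le (u * (v + d * y))
    rw [abs_mul] at h1
    have h2 : |u| * |v + d * y| ≤ |u| * (2 * |d| * y) := by gcongr
    have h3 : (|d| * |u|) * y ≤ r * y := by gcongr
    linarith
  have hqu : (p + u) * u ≤ r * (x + ℓ) := by
    refine (le_abs_self _).trans ?_
    rw [abs_mul]
    have h2 : |p + u| * |u| ≤ |d| * (x + ℓ) * |u| := by gcongr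
    have h3 : (|d| * |u|) * (x + ℓ) ≤ r * (x + ℓ) := by gcongr
    linarith
  have e1 : ((v + d * y) ^ 2 * ℓ - 2 * u * (v + d * y) * y - u ^ 2 * y) / (y * (ℓ + y))
      ≤ 8 * r := by
    rw [div_le_iff₀ (by positivity)]
    have a1 : (v + d * y) ^ 2 * ℓ ≤ 4 * d ^ 2 * y ^ 2 * ℓ := by gcongr
    have a2 : d ^ 2 * ℓ * y ^ 2 ≤ r * y ^ 2 := by gcongr
    have a3 := mul_le_mul_of_nonneg_right huV hy.le
    have a4 : 0 ≤ u ^ 2 * y := by positivity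
    have a5 : 0 ≤ r * y * ℓ := by positivity
    linarith
  have e2 : (2 * (p + u) * u * (x + ℓ) - u ^ 2 * (x + ℓ) - (p + u) ^ 2 * ℓ) / ((x + ℓ) * x)
      ≤ 4 * r := by
    rw [div_le_iff₀ (by positivity)]
    have a1 := mul_le_mul_of_nonneg_right hqu (by positivity : 0 ≤ x + ℓ)
    have a2 : 0 ≤ u ^ 2 * (x + ℓ) := by positivity
    have a3 : 0 ≤ (p + u) ^ 2 * ℓ := by positivity
    have a4 : r * (x + ℓ) * (x + ℓ) ≤ r * (x + ℓ) * (2 * x) := by gcongr; linarith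
    linarith
  linarith

namespace Sample

variable {Z : Sample}

/-- The error bounds around the change points. -/
structure LocalBound (Z : Sample) (r₀ r₁ θ : ℝ) : Prop where
  left : ∀ j, Z.Idx j → ∀ s, s ≤ Z.k j → Z.k (j - 1) ≤ s → r₁ ≤ Z.d j ^ 2 * ((Z.k j : ℝ) - s) →
    |psum Z.ε s (Z.k j)| ≤ θ * |Z.d j| * ((Z.k j : ℝ) - s)
  right : ∀ j, Z.Idx j → ∀ e, Z.k j ≤ e → e ≤ Z.k (j + 1) → r₁ ≤ Z.d j ^ 2 * ((e : ℝ) - Z.k j) →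
    |psum Z.ε (Z.k j) e| ≤ θ * |Z.d j| * ((e : ℝ) - Z.k j)
  left_near : ∀ j, Z.Idx j → ∀ s, s < Z.k j → Z.d j ^ 2 * ((Z.k j : ℝ) - s) ≤ r₀ →
    |Z.d j| * |psum Z.ε s (Z.k j)| ≤ r₀
  right_near : ∀ j, Z.Idx j → ∀ e, Z.k j < e → Z.d j ^ 2 * ((e : ℝ) - Z.k j) ≤ r₀ →
    |Z.d j| * |psum Z.ε (Z.k j) e| ≤ r₀

/-- The indices of the change points in `(s, e)` to the left of `k_j`. -/
def leftOf (Z : Sample) (s e j : ℕ) : Finset ℕ := (Z.inGap s e).filter (· < j)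

/-- The indices of the change points in `(s, e)` to the right of `k_j`. -/
def rightOf (Z : Sample) (s e j : ℕ) : Finset ℕ := (Z.inGap s e).filter (j < ·)

/-- The deviation of the observations on `(s, e]` from a single jump at `k_j`. -/
def deviation (Z : Sample) (s e j t : ℕ) : ℝ :=
  Z.ε t + (∑ i ∈ Z.leftOf s e j, Z.d i * (step (Z.k i) t - 1) +
    ∑ i ∈ Z.rightOf s e j, Z.d i * step (Z.k i) t)

/-- The level `μ` absorbs the jumps up to `s` and those of `leftOf` at full height. Hence
`deviation` differs from the noise only before the last jump to the left of `k_j` and after the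
first jump to its right. -/
theorem exists_obs_eq_deviation {s e j : ℕ} (hj : j ∈ Z.inGap s e) :
    ∃ μ : ℝ, ∀ t, s < t → t ≤ e →
      Z.obs t = μ + Z.d j * step (Z.k j) t + Z.deviation s e j t := by
  refine ⟨Z.f₀ + ∑ i ∈ (Finset.Icc 1 Z.q).filter (fun i => Z.k i ≤ s), Z.d i +
    ∑ i ∈ Z.leftOf s e j, Z.d i, fun t hst hte => ?_⟩
  have h1 : ∑ i ∈ Finset.Icc 1 Z.q, Z.d i * step (Z.k i) t =
      ∑ i ∈ (Finset.Icc 1 Z.q).filter (fun i => Z.k i ≤ s), Z.d i +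
        ∑ i ∈ Z.inGap s e, Z.d i * step (Z.k i) t := by
    have e1 := Finset.sum_filter_add_sum_filter_not (Finset.Icc 1 Z.q) (fun i => Z.k i ≤ s)
      (fun i => Z.d i * step (Z.k i) t)
    rw [← e1]
    congr 1
    · refine Finset.sum_congr rfl fun i hi => ?_
      have := (Finset.mem_filter.1 hi).2
      rw [step, if_pos (by omega), mul_one]
    · symm
      refine Finset.sum_subset ?_ ?_
      · intro i hi
        obtain ⟨h1, h2, h3⟩ := Finset.mem_filter.1 hi
        exact Finset.mem_filter.2 ⟨h1, by omega⟩
      · intro i hi hi'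
        obtain ⟨h1, h2⟩ := Finset.mem_filter.1 hi
        have : e ≤ Z.k i := by
          by_contra! hcon
          exact hi' (Finset.mem_filter.2 ⟨h1, by omega, hcon⟩)
        rw [step, if_neg (by omega), mul_zero]
  have h2 : ∑ i ∈ Z.inGap s e, Z.d i * step (Z.k i) t = Z.d j * step (Z.k j) t +
      (∑ i ∈ Z.leftOf s e j, Z.d i * step (Z.k i) t +
        ∑ i ∈ Z.rightOf s e j, Z.d i * step (Z.k i) t) := by
    rw [← Finset.add_sum_erase _ _ hj, ← Finset.sum_filter_add_sum_filter_not _ (· < j)]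
    congr 3
    · ext i
      simp only [leftOf, Finset.mem_filter, Finset.mem_erase]
      constructor
      · rintro ⟨⟨_, h⟩, h'⟩; exact ⟨h, h'⟩
      · rintro ⟨h, h'⟩; exact ⟨⟨by omega, h⟩, h'⟩
    · ext i
      simp only [rightOf, Finset.mem_filter, Finset.mem_erase]
      constructor
      · rintro ⟨⟨_, h⟩, h'⟩; exact ⟨h, by omega⟩
      · rintro ⟨h, h'⟩; exact ⟨⟨by omega, h⟩, by omega⟩
  have h3 : ∑ i ∈ Z.leftOf s e j, Z.d i * (step (Z.k i) t - 1) =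
      ∑ i ∈ Z.leftOf s e j, Z.d i * step (Z.k i) t - ∑ i ∈ Z.leftOf s e j, Z.d i := by
    rw [← Finset.sum_sub_distrib]
    exact Finset.sum_congr rfl fun i _ => by ring
  rw [obs_eq, h1, h2, deviation, h3]
  ring

theorem psum_deviation (Z : Sample) (s e j : ℕ) {a b : ℕ} (hab : a ≤ b) :
    psum (Z.deviation s e j) a b = psum Z.ε a b +
      (∑ i ∈ Z.leftOf s e j, Z.d i * (psum (step (Z.k i)) a b - ((b : ℝ) - a)) +
        ∑ i ∈ Z.rightOf s e j, Z.d i * psum (step (Z.k i)) a b) := by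
  have h1 : psum (Z.deviation s e j) a b = psum Z.ε a b +
      (psum (fun t => ∑ i ∈ Z.leftOf s e j, Z.d i * (step (Z.k i) t - 1)) a b +
        psum (fun t => ∑ i ∈ Z.rightOf s e j, Z.d i * step (Z.k i) t) a b) := by
    rw [← psum_add, ← psum_add]
    rfl
  rw [h1]
  congr 2
  · unfold psum
    rw [Finset.sum_comm]
    refine Finset.sum_congr rfl fun i _ => ?_
    rw [← Finset.mul_sum, Finset.sum_sub_distrib, Finset.sum_const, Nat.card_Ioc, nsmul_eq_mul,
      Nat.cast_sub hab, mul_one]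
  · unfold psum
    rw [Finset.sum_comm]
    exact Finset.sum_congr rfl fun i _ => by rw [← Finset.mul_sum]

/-- After removing `μ` with `splitGain_shift`, the three pieces `(s, b]`, `(b, k_j]`, `(k_j, e]`
play the roles of `x`, `ℓ`, `y` in `splitGain_sub_ge` and `splitGain_sub_le`. -/
theorem cusum_sq_of_le {s e j b : ℕ} (hj : j ∈ Z.inGap s e) (hsb : s < b) (hbk : b ≤ Z.k j) :
    cusum Z.obs s b e ^ 2 = splitGain (psum (Z.deviation s e j) s b) ((b : ℝ) - s)
      (psum (Z.deviation s e j) b (Z.k j) +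
        (psum (Z.deviation s e j) (Z.k j) e + Z.d j * ((e : ℝ) - Z.k j)))
      (((Z.k j : ℝ) - b) + ((e : ℝ) - Z.k j)) := by
  obtain ⟨μ, hμ⟩ := exists_obs_eq_deviation hj
  obtain ⟨hj, hsk, hke⟩ := mem_inGap.1 hj
  have h1 : (s : ℝ) < b := by exact_mod_cast hsb
  have h2 : (b : ℝ) ≤ Z.k j := by exact_mod_cast hbk
  have h3 : (Z.k j : ℝ) < e := by exact_mod_cast hke
  have hdec : ∀ a c : ℕ, s ≤ a → c ≤ e → a ≤ c → psum Z.obs a c =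
      ((c : ℝ) - a) * μ + Z.d j * psum (step (Z.k j)) a c + psum (Z.deviation s e j) a c := by
    intro a c ha hc hac
    rw [psum_congr (Y := fun t => (μ + Z.d j * step (Z.k j) t) + Z.deviation s e j t)
      fun t h1 h2 => hμ t (by omega) (by omega), psum_add, psum_add, psum_const _ hac]
    congr 2
    unfold psum
    rw [Finset.mul_sum]
  rw [cusum_sq _ hsb (by omega), ← splitGain, hdec s b le_rfl (by omega) hsb.le,
    hdec b e hsb.le le_rfl (by omega), psum_step_of_ge hbk hsb.le, psum_step hbk hke.le,
    ← psum_add_psum _ hbk hke.le,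
    ← splitGain_shift (psum (Z.deviation s e j) s b) _ μ (by linarith) (by linarith)]
  congr 1 <;> ring

/-- Mirror image of `cusum_sq_of_le`: read from right to left, the level is `μ + d_j` and the jump
is `-d_j`. -/
theorem cusum_sq_of_ge {s e j b : ℕ} (hj : j ∈ Z.inGap s e) (hkb : Z.k j ≤ b) (hbe : b < e) :
    cusum Z.obs s b e ^ 2 = splitGain (psum (Z.deviation s e j) b e) ((e : ℝ) - b)
      (psum (Z.deviation s e j) (Z.k j) b +
        (psum (Z.deviation s e j) s (Z.k j) + -Z.d j * ((Z.k j : ℝ) - s)))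
      (((b : ℝ) - Z.k j) + ((Z.k j : ℝ) - s)) := by
  obtain ⟨μ, hμ⟩ := exists_obs_eq_deviation hj
  obtain ⟨hj, hsk, hke⟩ := mem_inGap.1 hj
  have h1 : (s : ℝ) < Z.k j := by exact_mod_cast hsk
  have h2 : (Z.k j : ℝ) ≤ b := by exact_mod_cast hkb
  have h3 : (b : ℝ) < e := by exact_mod_cast hbe
  have hdec : ∀ a c : ℕ, s ≤ a → c ≤ e → a ≤ c → psum Z.obs a c =
      ((c : ℝ) - a) * μ + Z.d j * psum (step (Z.k j)) a c + psum (Z.deviation s e j) a c := by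
    intro a c ha hc hac
    rw [psum_congr (Y := fun t => (μ + Z.d j * step (Z.k j) t) + Z.deviation s e j t)
      fun t h1 h2 => hμ t (by omega) (by omega), psum_add, psum_add, psum_const _ hac]
    congr 2
    unfold psum
    rw [Finset.mul_sum]
  rw [cusum_sq _ (by omega) hbe, ← splitGain, hdec s b le_rfl (by omega) (by omega),
    hdec b e (by omega) le_rfl (by omega), psum_step hsk.le hkb, psum_step_of_le hkb hbe.le,
    ← psum_add_psum _ hsk.le hkb, splitGain_comm,
    ← splitGain_shift (psum (Z.deviation s e j) b e) _ (μ + Z.d j) (by linarith) (by linarith)]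
  congr 1 <;> ring

/-- Every change point inside `(s, e)` other than `k_j` is close to an end point. -/
def OnlyJump (Z : Sample) (R : ℝ) (s e j : ℕ) : Prop :=
  ∀ i ∈ Z.inGap s e, i ≠ j → Z.Near R i s ∨ Z.Near R i e

theorem lt_of_mem_leftOf (hZ : Z.Regular) {R : ℝ} (hR0 : 0 ≤ R) (hR : Z.Sep R) {s e j i b : ℕ}
    (hj : Z.Idx j) (hi : i ∈ Z.leftOf s e j) (hb : Z.Near R j b) : Z.k i < b := by
  obtain ⟨hi, hij⟩ := Finset.mem_filter.1 hi
  exact (near_self hR0 i).lt hZ hR (mem_inGap.1 hi).1 hj hij hb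

theorem lt_of_mem_rightOf (hZ : Z.Regular) {R : ℝ} (hR0 : 0 ≤ R) (hR : Z.Sep R) {s e j i b : ℕ}
    (hj : Z.Idx j) (hi : i ∈ Z.rightOf s e j) (hb : Z.Near R j b) : b < Z.k i := by
  obtain ⟨hi, hij⟩ := Finset.mem_filter.1 hi
  exact hb.lt hZ hR hj (mem_inGap.1 hi).1 hij (near_self hR0 i)

/-- Between two points near `k_j`, all jumps further left are complete and none further right has
started. -/
theorem psum_deviation_of_near (hZ : Z.Regular) {R : ℝ} (hR0 : 0 ≤ R) (hR : Z.Sep R)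
    {s e j a b : ℕ} (hj : Z.Idx j) (ha : Z.Near R j a) (hb : Z.Near R j b) (hab : a ≤ b) :
    psum (Z.deviation s e j) a b = psum Z.ε a b := by
  rw [psum_deviation Z s e j hab, Finset.sum_eq_zero, Finset.sum_eq_zero]
  · ring
  · intro i hi
    rw [psum_step_of_ge (lt_of_mem_rightOf hZ hR0 hR hj hi hb).le hab, mul_zero]
  · intro i hi
    rw [psum_step_of_le (lt_of_mem_leftOf hZ hR0 hR hj hi ha).le hab]
    ring

/-- The jumps `d_i` and `d_j` may be of different orders, so `hRθ` is used at both indices and the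
two inequalities are multiplied. Together with `(d_i² t)² ≤ R²`, one factor `d_i²` cancels. -/
theorem sq_mul_le_of_near (hZ : Z.Regular) {R θ : ℝ} (hθ : 0 ≤ θ) {i j : ℕ} (hi : Z.Idx i)
    (hR0 : 0 ≤ R)
    (hRθ : ∀ i, Z.Idx i → 2 * R ≤ θ * (Z.d i ^ 2 * (spacing Z.k i : ℝ))) (hj : Z.Idx j)
    {t u v : ℝ} (ht0 : 0 ≤ t) (ht : Z.d i ^ 2 * t ≤ R) (hu : (spacing Z.k j : ℝ) ≤ u)
    (hv : (spacing Z.k i : ℝ) / 2 ≤ v) :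
    (Z.d i * t) ^ 2 ≤ θ ^ 2 * (Z.d j ^ 2 * (u * v)) := by
  have hdi : 0 < Z.d i ^ 2 := by have := hZ.d_ne_zero i hi; positivity
  have h1 := mul_le_mul (hRθ i hi) (hRθ j hj) (by linarith) (by positivity)
  have h2 : (Z.d i ^ 2 * t) ^ 2 ≤ R ^ 2 := by gcongr
  have h3 : (spacing Z.k j : ℝ) * ((spacing Z.k i : ℝ) / 2) ≤ u * v := by
    gcongr
    exact le_trans (by positivity) hu
  have h4 : θ ^ 2 * (Z.d i ^ 2 * Z.d j ^ 2) * ((spacing Z.k j : ℝ) * ((spacing Z.k i : ℝ) / 2)) ≤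
      θ ^ 2 * (Z.d i ^ 2 * Z.d j ^ 2) * (u * v) := by gcongr
  have h5 : Z.d i ^ 2 * (Z.d i * t) ^ 2 ≤ Z.d i ^ 2 * (θ ^ 2 * (Z.d j ^ 2 * (u * v))) := by
    nlinarith [sq_nonneg R]
  exact le_of_mul_le_mul_left h5 hdi

/-- As `b` may be very close to `s`, a bound proportional to `b - s` would be too much to ask. The
uniform noise bound `ω² (b - s)` and the single possible jump near `s` both fit the product form
that `splitGain_sub_ge` accepts. -/
theorem psum_deviation_left (hZ : Z.Regular) {ω R θ : ℝ} (hω : Z.SumBound ω) (hR0 : 0 ≤ R)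
    (hR : Z.Sep R) (hθ : 0 ≤ θ)
    (hRθ : ∀ i, Z.Idx i → 2 * R ≤ θ * (Z.d i ^ 2 * (spacing Z.k i : ℝ)))
    {s e j b : ℕ} (he : e ≤ Z.n) (hj : j ∈ Z.inGap s e) (ho : Z.OnlyJump R s e j)
    (hωs : ω ^ 2 ≤ θ ^ 2 * (Z.d j ^ 2 * ((Z.k j : ℝ) - s))) (hsb : s < b) (hbk : b ≤ Z.k j)
    (hb : Z.Near R j b) :
    psum (Z.deviation s e j) s b ^ 2 ≤
      (2 * θ) ^ 2 * (Z.d j ^ 2 * (((Z.k j : ℝ) - s) * ((b : ℝ) - s))) := by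
  obtain ⟨hj, hsk, hke⟩ := mem_inGap.1 hj
  have h1 : (s : ℝ) < b := by exact_mod_cast hsb
  have h2 : (b : ℝ) ≤ Z.k j := by exact_mod_cast hbk
  have hdec : psum (Z.deviation s e j) s b =
      psum Z.ε s b - ∑ i ∈ Z.leftOf s e j, Z.d i * ((Z.k i : ℝ) - s) := by
    rw [psum_deviation Z s e j hsb.le, Finset.sum_eq_zero (s := Z.rightOf s e j), add_zero,
      sub_eq_add_neg (psum Z.ε s b), ← Finset.sum_neg_distrib]
    · congr 1
      refine Finset.sum_congr rfl fun i hi => ?_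
      rw [psum_step (mem_inGap.1 (Finset.mem_filter.1 hi).1).2.1.le
        (lt_of_mem_leftOf hZ hR0 hR hj hi hb).le]
      ring
    · intro i hi
      rw [psum_step_of_ge (lt_of_mem_rightOf hZ hR0 hR hj hi hb).le hsb.le, mul_zero]
  have hε : psum Z.ε s b ^ 2 ≤ θ ^ 2 * (Z.d j ^ 2 * (((Z.k j : ℝ) - s) * ((b : ℝ) - s))) := by
    refine (hω s b hsb (by omega)).trans ?_
    have : ω ^ 2 * ((b : ℝ) - s) ≤ θ ^ 2 * (Z.d j ^ 2 * ((Z.k j : ℝ) - s)) * ((b : ℝ) - s) := by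
      gcongr
    linarith
  -- A change point to the left of `k_j` which is near `e` would force `e < k_j`. So all of them are
  -- near `s`, and there is at most one.
  have hns : ∀ i ∈ Z.leftOf s e j, Z.Near R i s := by
    intro i hi
    obtain ⟨hi, hij⟩ := Finset.mem_filter.1 hi
    rcases ho i hi (by omega) with h | h
    · exact h
    · have := h.lt hZ hR (mem_inGap.1 hi).1 hj hij (near_self hR0 j)
      omega
  have hW : (∑ i ∈ Z.leftOf s e j, Z.d i * ((Z.k i : ℝ) - s)) ^ 2 ≤
      θ ^ 2 * (Z.d j ^ 2 * (((Z.k j : ℝ) - s) * ((b : ℝ) - s))) := by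
    rcases (Z.leftOf s e j).eq_empty_or_nonempty with h0 | ⟨i, hi⟩
    · rw [h0, Finset.sum_empty, zero_pow two_ne_zero]
      have : 0 ≤ ((Z.k j : ℝ) - s) * ((b : ℝ) - s) :=
        mul_nonneg (by linarith) (by linarith)
      positivity
    · have hi' := mem_inGap.1 (Finset.mem_filter.1 hi).1
      have hij := (Finset.mem_filter.1 hi).2
      have hs : Z.leftOf s e j = {i} := by
        refine Finset.eq_singleton_iff_unique_mem.2 ⟨hi, fun i' hi₂ => ?_⟩
        exact (hns i' hi₂).unique hZ hR (mem_inGap.1 (Finset.mem_filter.1 hi₂).1).1 hi'.1 (hns i hi)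
      have hn := hns i hi
      have hsi : (s : ℝ) < Z.k i := by exact_mod_cast hi'.2.1
      have hib : (Z.k i : ℝ) < b := by exact_mod_cast lt_of_mem_leftOf hZ hR0 hR hj hi hb
      unfold Near at hn
      rw [abs_of_nonpos (by linarith)] at hn
      rw [hs, Finset.sum_singleton]
      refine sq_mul_le_of_near hZ hθ hi'.1 hR0 hRθ hj (by linarith) (by linarith) ?_ ?_
      · have := (hZ.spacing_le hij hi'.1 hj).2
        have : (Z.k i : ℝ) + spacing Z.k j ≤ Z.k j := by exact_mod_cast this
        linarith
      · have := (hb.far hZ hR hi'.1 hj hij.ne).1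
        rw [abs_of_pos (by linarith)] at this
        linarith
  rw [hdec]
  -- The square of a difference is at most twice the sum of the squares, whence the factor `(2 θ)² =
  -- 4 θ²`.
  nlinarith [sq_nonneg (psum Z.ε s b + ∑ i ∈ Z.leftOf s e j, Z.d i * ((Z.k i : ℝ) - s))]

theorem psum_deviation_right (hZ : Z.Regular) {ω R θ : ℝ} (hω : Z.SumBound ω) (hR0 : 0 ≤ R)
    (hR : Z.Sep R) (hθ : 0 ≤ θ)
    (hRθ : ∀ i, Z.Idx i → 2 * R ≤ θ * (Z.d i ^ 2 * (spacing Z.k i : ℝ)))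
    {s e j b : ℕ} (he : e ≤ Z.n) (hj : j ∈ Z.inGap s e) (ho : Z.OnlyJump R s e j)
    (hωs : ω ^ 2 ≤ θ ^ 2 * (Z.d j ^ 2 * ((e : ℝ) - Z.k j))) (hkb : Z.k j ≤ b) (hbe : b < e)
    (hb : Z.Near R j b) :
    psum (Z.deviation s e j) b e ^ 2 ≤
      (2 * θ) ^ 2 * (Z.d j ^ 2 * (((e : ℝ) - Z.k j) * ((e : ℝ) - b))) := by
  obtain ⟨hj, hsk, hke⟩ := mem_inGap.1 hj
  have h1 : (b : ℝ) < e := by exact_mod_cast hbe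
  have h2 : (Z.k j : ℝ) ≤ b := by exact_mod_cast hkb
  have hdec : psum (Z.deviation s e j) b e =
      psum Z.ε b e + ∑ i ∈ Z.rightOf s e j, Z.d i * ((e : ℝ) - Z.k i) := by
    rw [psum_deviation Z s e j hbe.le, Finset.sum_eq_zero (s := Z.leftOf s e j), zero_add]
    · congr 1
      refine Finset.sum_congr rfl fun i hi => ?_
      rw [psum_step (lt_of_mem_rightOf hZ hR0 hR hj hi hb).le
        (mem_inGap.1 (Finset.mem_filter.1 hi).1).2.2.le]
    · intro i hi
      rw [psum_step_of_le (lt_of_mem_leftOf hZ hR0 hR hj hi hb).le hbe.le]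
      ring
  have hε : psum Z.ε b e ^ 2 ≤ θ ^ 2 * (Z.d j ^ 2 * (((e : ℝ) - Z.k j) * ((e : ℝ) - b))) := by
    refine (hω b e hbe he).trans ?_
    have : ω ^ 2 * ((e : ℝ) - b) ≤ θ ^ 2 * (Z.d j ^ 2 * ((e : ℝ) - Z.k j)) * ((e : ℝ) - b) := by
      gcongr
    linarith
  have hns : ∀ i ∈ Z.rightOf s e j, Z.Near R i e := by
    intro i hi
    obtain ⟨hi, hij⟩ := Finset.mem_filter.1 hi
    rcases ho i hi (by omega) with h | h
    · have := (near_self hR0 j).lt hZ hR hj (mem_inGap.1 hi).1 hij h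
      omega
    · exact h
  have hW : (∑ i ∈ Z.rightOf s e j, Z.d i * ((e : ℝ) - Z.k i)) ^ 2 ≤
      θ ^ 2 * (Z.d j ^ 2 * (((e : ℝ) - Z.k j) * ((e : ℝ) - b))) := by
    rcases (Z.rightOf s e j).eq_empty_or_nonempty with h0 | ⟨i, hi⟩
    · rw [h0, Finset.sum_empty, zero_pow two_ne_zero]
      have : 0 ≤ ((e : ℝ) - Z.k j) * ((e : ℝ) - b) :=
        mul_nonneg (by linarith) (by linarith)
      positivity
    · have hi' := mem_inGap.1 (Finset.mem_filter.1 hi).1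
      have hij := (Finset.mem_filter.1 hi).2
      have hs : Z.rightOf s e j = {i} := by
        refine Finset.eq_singleton_iff_unique_mem.2 ⟨hi, fun i' hi₂ => ?_⟩
        exact (hns i' hi₂).unique hZ hR (mem_inGap.1 (Finset.mem_filter.1 hi₂).1).1 hi'.1 (hns i hi)
      have hn := hns i hi
      have hsi : (Z.k i : ℝ) < e := by exact_mod_cast hi'.2.2
      have hib : (b : ℝ) < Z.k i := by exact_mod_cast lt_of_mem_rightOf hZ hR0 hR hj hi hb
      unfold Near at hn
      rw [abs_of_nonneg (by linarith)] at hn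
      rw [hs, Finset.sum_singleton]
      refine sq_mul_le_of_near hZ hθ hi'.1 hR0 hRθ hj (by linarith) (by linarith) ?_ ?_
      · have := (hZ.spacing_le hij hj hi'.1).1
        have : (Z.k j : ℝ) + spacing Z.k j ≤ Z.k i := by exact_mod_cast this
        linarith
      · have := (hb.far hZ hR hi'.1 hj hij.ne').1
        rw [abs_of_neg (by linarith)] at this
        linarith
  rw [hdec]
  nlinarith [sq_nonneg (psum Z.ε b e - ∑ i ∈ Z.rightOf s e j, Z.d i * ((e : ℝ) - Z.k i))]

set_option maxHeartbeats 1000000 in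
/-- Splitting at a point very close to `k_j` is better than at a point which is less close. -/
theorem cusum_sq_lt (hZ : Z.Regular) {ω R θ m r₀ r₁ : ℝ} (hω : Z.SumBound ω)
    (hR : Z.Sep R) (hθ : 0 ≤ θ)
    (hRθ : ∀ i, Z.Idx i → 2 * R ≤ θ * (Z.d i ^ 2 * (spacing Z.k i : ℝ)))
    (hL : Z.LocalBound r₀ r₁ θ) (hm : 0 < m) (hmR : m ≤ R) (hωm : ω ^ 2 ≤ θ ^ 2 * m)
    (hθm : 48 * θ ≤ m / (m + R)) (hr₀ : 24 * r₀ ≤ m / (m + R) * r₁) (hr₀m : 2 * r₀ ≤ m)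
    {s e j a c : ℕ} (he : e ≤ Z.n) (hj : j ∈ Z.inGap s e) (ho : Z.OnlyJump R s e j)
    (hs : ¬ Z.Near m j s) (he' : ¬ Z.Near m j e)
    (hsa : s < a) (hae : a < e) (hsc : s < c) (hce : c < e)
    (ha : Z.Near R j a) (ha' : ¬ Z.Near r₁ j a) (hc : Z.Near r₀ j c) :
    cusum Z.obs s a e ^ 2 < cusum Z.obs s c e ^ 2 := by
  obtain ⟨hji, hsk, hke⟩ := mem_inGap.1 hj
  have hR0 : 0 < R := by linarith
  have hsk' : (s : ℝ) < Z.k j := by exact_mod_cast hsk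
  have hke' : (Z.k j : ℝ) < e := by exact_mod_cast hke
  have hd : 0 < Z.d j ^ 2 := by have := hZ.d_ne_zero j hji; positivity
  have hr₀0 : 0 ≤ r₀ := le_trans (by positivity) hc
  have hβ0 : 0 < m / (m + R) := by positivity
  have hβ1 : m / (m + R) ≤ 1 := (div_le_one (by positivity)).2 (by linarith)
  have hθ1 : 2 * θ ≤ 1 := by linarith
  have hm1 : m < Z.d j ^ 2 * ((Z.k j : ℝ) - s) := by
    have := not_le.1 hs
    rw [abs_of_neg (by linarith)] at this
    linarith
  have hm2 : m < Z.d j ^ 2 * ((e : ℝ) - Z.k j) := by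
    have := not_le.1 he'
    rwa [abs_of_pos (by linarith)] at this
  have hω1 : ω ^ 2 ≤ θ ^ 2 * (Z.d j ^ 2 * ((Z.k j : ℝ) - s)) := hωm.trans (by gcongr)
  have hω2 : ω ^ 2 ≤ θ ^ 2 * (Z.d j ^ 2 * ((e : ℝ) - Z.k j)) := hωm.trans (by gcongr)
  have hself := near_self (Z := Z) hR0.le j
  have bl {b : ℕ} := psum_deviation_left (b := b) hZ hω hR0.le hR hθ hRθ he hj ho hω1
  have br {b : ℕ} := psum_deviation_right (b := b) hZ hω hR0.le hR hθ hRθ he hj ho hω2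
  have hleft : |psum (Z.deviation s e j) s (Z.k j)| ≤ 2 * θ * |Z.d j| * ((Z.k j : ℝ) - s) := by
    apply abs_le_of_sq_le_sq _ (mul_nonneg (by positivity) (by linarith))
    refine (bl hsk le_rfl hself).trans (le_of_eq ?_)
    rw [mul_pow (2 * θ * |Z.d j|), mul_pow (2 * θ) |Z.d j|, sq_abs]
    ring
  have hright : |psum (Z.deviation s e j) (Z.k j) e| ≤ 2 * θ * |Z.d j| * ((e : ℝ) - Z.k j) := by
    apply abs_le_of_sq_le_sq _ (mul_nonneg (by positivity) (by linarith))
    refine (br le_rfl hke hself).trans (le_of_eq ?_)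
    rw [mul_pow (2 * θ * |Z.d j|), mul_pow (2 * θ) |Z.d j|, sq_abs]
    ring
  have hleft1 : |psum (Z.deviation s e j) s (Z.k j)| ≤ |Z.d j| * ((Z.k j : ℝ) - s) := by
    refine hleft.trans ?_
    have h0 : 0 ≤ |Z.d j| * ((Z.k j : ℝ) - s) := mul_nonneg (abs_nonneg _) (by linarith)
    nlinarith
  have hright1 : |psum (Z.deviation s e j) (Z.k j) e| ≤ |Z.d j| * ((e : ℝ) - Z.k j) := by
    refine hright.trans ?_
    have h0 : 0 ≤ |Z.d j| * ((e : ℝ) - Z.k j) := mul_nonneg (abs_nonneg _) (by linarith)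
    nlinarith
  -- The split is moved by at most `R / d_j²`, while the far side is longer than `m / d_j²`, so `y /
  -- (ℓ + y) ≥ m / (m + R)`. This is the constant `β` of `splitGain_sub_ge`: moving from `a` to
  -- `k_j` gains more than `β r₁ / 2 ≥ 12 r₀`, and moving on to `c` loses at most `12 r₀`.
  have hβ : ∀ ℓ y : ℝ, Z.d j ^ 2 * ℓ ≤ R → m < Z.d j ^ 2 * y → m / (m + R) * (ℓ + y) ≤ y := by
    intro ℓ y h1 h2
    rw [div_mul_eq_mul_div, div_le_iff₀ (by positivity)]
    have h3 : Z.d j ^ 2 * (m * ℓ) ≤ Z.d j ^ 2 * (R * y) := by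
      have a1 : m * (Z.d j ^ 2 * ℓ) ≤ m * R := by gcongr
      have a2 : R * m ≤ R * (Z.d j ^ 2 * y) := by gcongr
      linarith
    have := le_of_mul_le_mul_left h3 hd
    linarith
  have hspa := ha.abs_le hZ hR hji
  have hmono1 := hZ.k_lt (j - 1) (by have := hji.2; omega)
  rw [Nat.sub_add_cancel hji.1] at hmono1
  have hmono2 := hZ.k_lt j hji.2
  have hsp1 : spacing Z.k j ≤ Z.k j - Z.k (j - 1) := min_le_left _ _
  have hsp2 : spacing Z.k j ≤ Z.k (j + 1) - Z.k j := min_le_right _ _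
  have hsp1' : (Z.k (j - 1) : ℝ) + spacing Z.k j ≤ Z.k j := by
    have : Z.k (j - 1) + spacing Z.k j ≤ Z.k j := by omega
    exact_mod_cast this
  have hsp2' : (Z.k j : ℝ) + spacing Z.k j ≤ Z.k (j + 1) := by
    have : Z.k j + spacing Z.k j ≤ Z.k (j + 1) := by omega
    exact_mod_cast this
  have hsp0 : (0 : ℝ) ≤ spacing Z.k j := Nat.cast_nonneg _
  -- the point `a` is worse than `k_j`
  have hka : cusum Z.obs s a e ^ 2 + 12 * r₀ < cusum Z.obs s (Z.k j) e ^ 2 := by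
    have ha2 := not_le.1 ha'
    have ha3 : Z.d j ^ 2 * |(a : ℝ) - Z.k j| ≤ R := ha
    rcases lt_trichotomy a (Z.k j) with h | h | h
    · have hlt : (a : ℝ) < Z.k j := by exact_mod_cast h
      have hsa' : (s : ℝ) < a := by exact_mod_cast hsa
      rw [abs_of_neg (by linarith)] at ha2 ha3 hspa
      have hu := hL.left j hji a h.le (by
        have : (Z.k (j - 1) : ℝ) ≤ a := by linarith
        exact_mod_cast this) (by linarith)
      have key := splitGain_sub_ge (θ := 2 * θ) (β := m / (m + R))
        (p := psum (Z.deviation s e j) s a)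
        (u := psum (Z.deviation s e j) a (Z.k j)) (v := psum (Z.deviation s e j) (Z.k j) e)
        (d := Z.d j) (x := (a : ℝ) - s) (ℓ := (Z.k j : ℝ) - a) (y := (e : ℝ) - Z.k j)
        (by linarith) (by linarith) (by linarith) (by linarith) (by linarith) hβ1
        (hβ _ _ (by linarith) hm2) ?_ ?_ hright
      · rw [cusum_sq_of_le hj hsa h.le, cusum_sq_of_le hj hsk le_rfl]
        have e1 : psum (Z.deviation s e j) (Z.k j) (Z.k j) = 0 := by simp [psum]
        rw [e1, zero_add, sub_self, zero_add, ← psum_add_psum _ hsa.le h.le,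
          show (Z.k j : ℝ) - s = ((a : ℝ) - s) + ((Z.k j : ℝ) - a) by ring]
        have : m / (m + R) * r₁ < m / (m + R) * (Z.d j ^ 2 * ((Z.k j : ℝ) - a)) := by
          gcongr
          linarith
        linarith
      · have := bl hsa h.le ha
        rwa [show (Z.k j : ℝ) - s = ((a : ℝ) - s) + ((Z.k j : ℝ) - a) by ring] at this
      · rw [psum_deviation_of_near hZ hR0.le hR hji ha hself h.le]
        refine hu.trans ?_
        have : 0 ≤ θ * |Z.d j| * ((Z.k j : ℝ) - a) :=
          mul_nonneg (by positivity) (by linarith)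
        linarith
    -- For `a = k_j` the assumption `ha'` says `r₁ < 0`, which `0 ≤ 24 r₀ ≤ β r₁` excludes.
    · rw [h, sub_self, abs_zero, mul_zero] at ha2
      have := mul_pos hβ0 (neg_pos.2 ha2)
      linarith
    · have hlt : (Z.k j : ℝ) < a := by exact_mod_cast h
      have hae' : (a : ℝ) < e := by exact_mod_cast hae
      rw [abs_of_pos (by linarith)] at ha2 ha3 hspa
      have hu := hL.right j hji a h.le (by
        have : (a : ℝ) ≤ Z.k (j + 1) := by linarith
        exact_mod_cast this) (by linarith)
      have key := splitGain_sub_ge (θ := 2 * θ) (β := m / (m + R))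
        (p := psum (Z.deviation s e j) a e)
        (u := psum (Z.deviation s e j) (Z.k j) a) (v := psum (Z.deviation s e j) s (Z.k j))
        (d := -Z.d j) (x := (e : ℝ) - a) (ℓ := (a : ℝ) - Z.k j) (y := (Z.k j : ℝ) - s)
        (by linarith) (by linarith) (by linarith) (by linarith) (by linarith) hβ1
        (hβ _ _ (by linarith) hm1) ?_ ?_ (by rwa [abs_neg])
      · rw [cusum_sq_of_ge hj h.le hae, cusum_sq_of_ge hj le_rfl hke]
        have e1 : psum (Z.deviation s e j) (Z.k j) (Z.k j) = 0 := by simp [psum]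
        rw [e1, zero_add, sub_self, zero_add, ← psum_add_psum _ h.le hae.le,
          show (e : ℝ) - Z.k j = ((e : ℝ) - a) + ((a : ℝ) - Z.k j) by ring,
          add_comm (psum _ (Z.k j) a) (psum _ a e)]
        rw [neg_sq] at key
        have : m / (m + R) * r₁ < m / (m + R) * (Z.d j ^ 2 * ((a : ℝ) - Z.k j)) := by
          gcongr
        linarith
      · have := br h.le hae ha
        rw [neg_sq]
        rwa [show (e : ℝ) - Z.k j = ((e : ℝ) - a) + ((a : ℝ) - Z.k j) by ring] at this
      · rw [psum_deviation_of_near hZ hR0.le hR hji hself ha h.le, abs_neg]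
        refine hu.trans ?_
        have : 0 ≤ θ * |Z.d j| * ((a : ℝ) - Z.k j) :=
          mul_nonneg (by positivity) (by linarith)
        linarith
  -- the point `c` is almost as good as `k_j`
  have hkc : cusum Z.obs s (Z.k j) e ^ 2 ≤ cusum Z.obs s c e ^ 2 + 12 * r₀ := by
    have hcR : Z.Near R j c := hc.mono (by linarith)
    have hc3 : Z.d j ^ 2 * |(c : ℝ) - Z.k j| ≤ r₀ := hc
    rcases lt_trichotomy c (Z.k j) with h | h | h
    · have hlt : (c : ℝ) < Z.k j := by exact_mod_cast h
      have hsc' : (s : ℝ) < c := by exact_mod_cast hsc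
      rw [abs_of_neg (by linarith)] at hc3
      have hu := hL.left_near j hji c h (by linarith)
      have key := splitGain_sub_le (p := psum (Z.deviation s e j) s c)
        (u := psum (Z.deviation s e j) c (Z.k j)) (v := psum (Z.deviation s e j) (Z.k j) e)
        (d := Z.d j) (x := (c : ℝ) - s) (ℓ := (Z.k j : ℝ) - c) (y := (e : ℝ) - Z.k j) (r := r₀)
        (by linarith) (by linarith) (by linarith) (by linarith) ?_ ?_ ?_ hright1
      · rw [cusum_sq_of_le hj hsc h.le, cusum_sq_of_le hj hsk le_rfl]
        have e1 : psum (Z.deviation s e j) (Z.k j) (Z.k j) = 0 := by simp [psum]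
        rw [e1, zero_add, sub_self, zero_add, ← psum_add_psum _ hsc.le h.le,
          show (Z.k j : ℝ) - s = ((c : ℝ) - s) + ((Z.k j : ℝ) - c) by ring]
        linarith
      · have : Z.d j ^ 2 * ((Z.k j : ℝ) - c) ≤ Z.d j ^ 2 * ((c : ℝ) - s) := by linarith
        exact le_of_mul_le_mul_left this hd
      · rw [psum_add_psum _ hsc.le h.le]
        convert hleft1 using 2
        ring
      · rwa [psum_deviation_of_near hZ hR0.le hR hji hcR hself h.le]
    · rw [h]
      linarith
    · have hlt : (Z.k j : ℝ) < c := by exact_mod_cast h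
      have hce' : (c : ℝ) < e := by exact_mod_cast hce
      rw [abs_of_pos (by linarith)] at hc3
      have hu := hL.right_near j hji c h (by linarith)
      have key := splitGain_sub_le (p := psum (Z.deviation s e j) c e)
        (u := psum (Z.deviation s e j) (Z.k j) c) (v := psum (Z.deviation s e j) s (Z.k j))
        (d := -Z.d j) (x := (e : ℝ) - c) (ℓ := (c : ℝ) - Z.k j) (y := (Z.k j : ℝ) - s) (r := r₀)
        (by linarith) (by linarith) (by linarith) (by rw [neg_sq]; linarith) ?_ ?_ ?_
        (by rwa [abs_neg])
      · rw [cusum_sq_of_ge hj h.le hce, cusum_sq_of_ge hj le_rfl hke]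
        have e1 : psum (Z.deviation s e j) (Z.k j) (Z.k j) = 0 := by simp [psum]
        rw [e1, zero_add, sub_self, zero_add, ← psum_add_psum _ h.le hce.le,
          show (e : ℝ) - Z.k j = ((e : ℝ) - c) + ((c : ℝ) - Z.k j) by ring,
          add_comm (psum _ (Z.k j) c) (psum _ c e)]
        linarith
      · have : Z.d j ^ 2 * ((c : ℝ) - Z.k j) ≤ Z.d j ^ 2 * ((e : ℝ) - c) := by linarith
        exact le_of_mul_le_mul_left this hd
      · rw [add_comm, psum_add_psum _ h.le hce.le, abs_neg]
        convert hright1 using 2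
        ring
      · rwa [psum_deviation_of_near hZ hR0.le hR hji hself hcR h.le, abs_neg]
  linarith

end Sample

/-! ### Deterministic analysis of the inner algorithm -/

/-- The scales of the analysis: the noise level `ω`, the penalty `ξ`, the localisation rates
`r₀ < r₁` of the best candidates and of the estimators, three scales `a < m < R` comparable to the
penalty, and a small constant `θ`. -/
structure Scales where
  ω : ℝ
  ξ : ℝ
  r₀ : ℝ
  r₁ : ℝ
  a : ℝ
  m : ℝ
  R : ℝ
  θ : ℝ

namespace Sample

/-- The goodness-of-fit term of the criterion. -/
def fit (Z : Sample) (P : Finset ℕ) : ℝ :=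
  (Z.n : ℝ) / 2 * Real.log (rss Z.obs Z.n P / Z.n)

/-- The properties of a realisation on which the analysis of the algorithms is based, for a set
`C₀` of candidates. -/
structure Tame (Z : Sample) (S : Scales) (C₀ : Finset ℕ) : Prop where
  reg : Z.Regular
  sumBound : Z.SumBound S.ω
  localBound : Z.LocalBound S.r₀ S.r₁ S.θ
  sep : Z.Sep S.R
  inside : Inside Z.n C₀
  ξ_pos : 0 < S.ξ
  θ_nonneg : 0 ≤ S.θ
  a_pos : 0 < S.a
  a_le : 144 * S.a ≤ S.m
  m_le : S.m ≤ S.R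
  m_sq_le : S.m ^ 2 ≤ S.a * S.R
  r₀_le : S.r₀ ≤ S.r₁
  r₁_le : 4 * S.r₁ ≤ S.a
  r₀_mul_le : 24 * S.r₀ ≤ S.a / (S.a + S.R) * S.r₁
  ω_le : 2 * S.ω ^ 2 ≤ S.a
  ω_le' : S.ω ^ 2 ≤ S.θ ^ 2 * S.a
  θ_le : 48 * S.θ ≤ S.a / (S.a + S.R)
  R_le : ∀ i, Z.Idx i → 2 * S.R ≤ S.θ * (Z.d i ^ 2 * (spacing Z.k i : ℝ))
  R_sq_le : ∀ i, Z.Idx i → 2 * S.R ^ 2 ≤ S.a * (Z.d i ^ 2 * (spacing Z.k i : ℝ))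
  rss_pos : ∀ P ⊆ C₀, 0 < rss Z.obs Z.n P
  fit_le : ∀ P ⊆ C₀, ∀ Q ⊆ C₀, rss Z.obs Z.n P ≤ rss Z.obs Z.n Q + 9 * S.a →
    Z.fit P ≤ Z.fit Q + S.ξ / 4
  le_fit : ∀ P ⊆ C₀, ∀ Q ⊆ C₀, (∃ j, Z.Idx j) → (∀ i, Z.Idx i → Z.Cov S.R Q i) →
    rss Z.obs Z.n Q + S.m / 16 ≤ rss Z.obs Z.n P → Z.fit Q + 4 * S.ξ ≤ Z.fit P

variable {Z : Sample} {S : Scales} {C₀ : Finset ℕ}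

namespace Tame

theorem a_le_m (h : Z.Tame S C₀) : S.a ≤ S.m := by linarith [h.a_le, h.a_pos]
theorem a_le_R (h : Z.Tame S C₀) : S.a ≤ S.R := h.a_le_m.trans h.m_le
theorem R_pos (h : Z.Tame S C₀) : 0 < S.R := h.a_pos.trans_le h.a_le_R

theorem r₁_le_a (h : Z.Tame S C₀) : S.r₁ ≤ S.a := by
  rcases le_total 0 S.r₁ with h0 | h0
  · linarith [h.r₁_le]
  · exact h0.trans h.a_pos.le

theorem r₁_le_R (h : Z.Tame S C₀) : S.r₁ ≤ S.R := h.r₁_le_a.trans h.a_le_R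

theorem fit_mono (h : Z.Tame S C₀) {P Q : Finset ℕ} (hP : P ⊆ C₀)
    (hPQ : rss Z.obs Z.n P ≤ rss Z.obs Z.n Q) : Z.fit P ≤ Z.fit Q := by
  have hn : (0 : ℝ) < Z.n := by exact_mod_cast h.reg.n_pos
  have := h.rss_pos P hP
  unfold fit
  gcongr

theorem fit_strictMono (h : Z.Tame S C₀) {P Q : Finset ℕ} (hP : P ⊆ C₀)
    (hPQ : rss Z.obs Z.n P < rss Z.obs Z.n Q) : Z.fit P < Z.fit Q := by
  have hn : (0 : ℝ) < Z.n := by exact_mod_cast h.reg.n_pos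
  have := h.rss_pos P hP
  unfold fit
  gcongr

theorem fit_anti (h : Z.Tame S C₀) {P Q : Finset ℕ} (hQ : Q ⊆ C₀) (hPQ : P ⊆ Q) :
    Z.fit Q ≤ Z.fit P :=
  h.fit_mono hQ (rss_anti _ (h.inside.subset hQ) hPQ)

theorem unique (h : Z.Tame S C₀) {i j p : ℕ} (hi : Z.Idx i) (hj : Z.Idx j) (hp : Z.Near S.R i p)
    (hp' : Z.Near S.R j p) : i = j := hp.unique h.reg h.sep hi hj hp'

/-- A superfluous point saves at most a quarter of its price `ξ`. -/
theorem fit_le_insert (h : Z.Tame S C₀) {P : Finset ℕ} {c : ℕ} (hP : P ⊆ C₀) (hc : c ∈ C₀)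
    (hcov : ∀ i, Z.Idx i → Z.Cov S.a P i ∨ (Z.Cov S.m P i ∧ ¬ Z.Near S.R i c)) :
    Z.fit P ≤ Z.fit (insert c P) + S.ξ / 4 :=
  h.fit_le P hP _ (Finset.insert_subset hc hP)
    (rss_le_of_cov h.reg h.sumBound h.ω_le h.a_le_R h.m_le h.sep h.R_pos h.m_sq_le
      (h.inside.subset hP) (h.inside c hc).1 (h.inside c hc).2 hcov)

/-- A missing point repays its price four times. The surplus is needed in `Call.output`, where up to
two points may be missing at once. -/
theorem fit_insert_le (h : Z.Tame S C₀) {P : Finset ℕ} {j c : ℕ} (hP : P ⊆ C₀) (hc : c ∈ C₀)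
    (hj : Z.Idx j) (hcj : Z.Near S.r₀ j c) (hcov : ¬ Z.Cov S.m P j)
    (ho : ∀ i, Z.Idx i → i ≠ j → Z.Cov S.R P i) :
    Z.fit (insert c P) + 4 * S.ξ ≤ Z.fit P := by
  have hr1 : S.r₀ ≤ S.R := h.r₀_le.trans h.r₁_le_R
  refine h.le_fit P hP _ (Finset.insert_subset hc hP) ⟨j, hj⟩ (fun i hi => ?_)
    (le_rss_of_not_cov h.reg h.sumBound h.ω_le h.a_le ?_ hr1 h.sep h.R_pos h.R_sq_le
      (h.inside.subset hP) hj (h.inside c hc).1 (h.inside c hc).2 hcj hcov ho)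
  · by_cases hij : i = j
    · subst hij
      exact Cov.of_mem (Finset.mem_insert_self _ _) (hcj.mono hr1)
    · exact (ho i hi hij).mono le_rfl (Finset.subset_insert _ _)
  · linarith [h.r₀_le, h.r₁_le, h.a_le_m]

/-- By `hbc` both points fall into the same segment of `P`, so the comparison reduces to their CUSUM
statistics there. -/
theorem rss_insert_lt (h : Z.Tame S C₀) {P : Finset ℕ} {j b c : ℕ} (hP : P ⊆ C₀) (hb : b ∈ C₀)
    (hc : c ∈ C₀) (hj : Z.Idx j) (hbj : Z.Near S.R j b) (hbj' : ¬ Z.Near S.r₁ j b)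
    (hcj : Z.Near S.r₀ j c) (hcov : ¬ Z.Cov S.a P j)
    (ho : ∀ i, Z.Idx i → i ≠ j → Z.Cov S.R P i)
    (hbc : ∀ p ∈ P, (p < b ∧ p < c) ∨ (b < p ∧ c < p)) :
    rss Z.obs Z.n (insert c P) < rss Z.obs Z.n (insert b P) := by
  have hPi := h.inside.subset hP
  have hr₀0 : 0 ≤ S.r₀ := le_trans (by positivity) hcj
  have hr₀a : S.r₀ ≤ S.a := h.r₀_le.trans h.r₁_le_a
  have hbP : b ∉ P := fun hb => by rcases hbc b hb with h | h <;> omega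
  obtain ⟨s, e, hg, hsb, hbe⟩ := exists_isGap (h.inside b hb).1 (h.inside b hb).2 hbP
  have hsc : s < c := by
    rcases Finset.mem_insert.1 hg.1 with h1 | h1
    · have := (h.inside c hc).1; omega
    · rcases hbc s h1 with h | h <;> omega
  have hce : c < e := by
    rcases Finset.mem_insert.1 hg.2.1 with h1 | h1
    · have := (h.inside c hc).2; omega
    · rcases hbc e h1 with h | h <;> omega
  have hse : ¬ Z.Near S.a j s ∧ ¬ Z.Near S.a j e := by
    refine ⟨fun hs => hcov ⟨s, ?_, hs⟩, fun hs => hcov ⟨e, ?_, hs⟩⟩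
    · have := hg.1
      simp only [Finset.mem_insert] at this ⊢
      tauto
    · have := hg.2.1
      simp only [Finset.mem_insert] at this ⊢
      tauto
  have hsk : s < Z.k j := by
    by_contra! hcon
    exact hse.1 (((near_self hr₀0 j).convex hcj hcon hsc.le).mono hr₀a)
  have hke : Z.k j < e := by
    by_contra! hcon
    exact hse.2 ((hcj.convex (near_self hr₀0 j) hce.le hcon).mono hr₀a)
  have e1 := rss_insert Z.obs hPi hg hsb hbe
  have e2 := rss_insert Z.obs hPi hg hsc hce
  have := cusum_sq_lt h.reg h.sumBound h.sep h.θ_nonneg h.R_le h.localBound h.a_pos h.a_le_R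
    h.ω_le' h.θ_le h.r₀_mul_le (by linarith [h.r₀_le, h.r₁_le]) (hg.le hPi)
    (mem_inGap.2 ⟨hj, hsk, hke⟩)
    (fun i hi hij => (ho i (mem_inGap.1 hi).1 hij).gap hPi hg (mem_inGap.1 hi).2.1
      (mem_inGap.1 hi).2.2) hse.1 hse.2 hsb hbe hsc hce hbj hbj' hcj
  linarith

end Tame

/-! #### One call of the inner algorithm -/

/-- The situation in a call of the inner algorithm: the set `F` of fixed points, the set `D` of
candidates and, for each change point, a very good candidate `chk j`, which is available unless
`F` contains a good approximation of the change point. -/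
structure Call (Z : Sample) (S : Scales) (C₀ F D : Finset ℕ) (chk : ℕ → ℕ) : Prop where
  tame : Z.Tame S C₀
  fixed_sub : F ⊆ C₀
  cand_sub : D ⊆ C₀
  sepD : ∀ p ∈ insert 0 (insert Z.n F), (∀ c ∈ D, p < c) ∨ (∀ c ∈ D, c < p)
  chk_near : ∀ j, Z.Idx j → Z.Near S.r₀ j (chk j)
  avail : ∀ j, Z.Idx j → (∃ p ∈ F, Z.Near S.r₁ j p) ∨ chk j ∈ D

open Classical in
/-- The indices of the change points which have no good approximation in `F`. -/
def todo (Z : Sample) (S : Scales) (F : Finset ℕ) : Finset ℕ :=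
  (Finset.Icc 1 Z.q).filter fun j => ¬ ∃ p ∈ F, Z.Near S.r₁ j p

theorem mem_todo {F : Finset ℕ} {j : ℕ} :
    j ∈ Z.todo S F ↔ Z.Idx j ∧ ¬ ∃ p ∈ F, Z.Near S.r₁ j p := by
  simp [todo, Idx]

/-- The criterion minimised by the inner algorithm. -/
def crit (Z : Sample) (ξ : ℝ) (F : Finset ℕ) (b : ℝ) (A : Finset ℕ) : ℝ :=
  Z.fit (A ∪ F) + ((A.card : ℝ) + b) * ξ

namespace Call

variable {F D : Finset ℕ} {chk : ℕ → ℕ} {b : ℝ}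

theorem union_sub (h : Z.Call S C₀ F D chk) {A : Finset ℕ} (hA : A ⊆ D) : A ∪ F ⊆ C₀ :=
  Finset.union_subset (hA.trans h.cand_sub) h.fixed_sub

theorem chk_mem (h : Z.Call S C₀ F D chk) {j : ℕ} (hj : j ∈ Z.todo S F) : chk j ∈ D := by
  obtain ⟨h1, h2⟩ := mem_todo.1 hj
  exact (h.avail j h1).resolve_left h2

theorem cov_of_not_mem (h : Z.Call S C₀ F D chk) {j : ℕ} (hj : Z.Idx j) (hj' : j ∉ Z.todo S F) :
    Z.Cov S.a F j := by
  have : ∃ p ∈ F, Z.Near S.r₁ j p := by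
    by_contra hcon
    exact hj' (mem_todo.2 ⟨hj, hcon⟩)
  obtain ⟨p, hp, hn⟩ := this
  exact Cov.of_mem hp (hn.mono h.tame.r₁_le_a)

theorem chk_nearR (h : Z.Call S C₀ F D chk) {j : ℕ} (hj : Z.Idx j) : Z.Near S.r₁ j (chk j) :=
  (h.chk_near j hj).mono h.tame.r₀_le

/-- A system of good approximations of the change points in `Z.todo S F`. -/
def Reps (Z : Sample) (S : Scales) (F D : Finset ℕ) (rep : ℕ → ℕ) : Prop :=
  ∀ j ∈ Z.todo S F, rep j ∈ D ∧ Z.Near S.r₁ j (rep j)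

theorem reps_injOn (h : Z.Call S C₀ F D chk) {rep : ℕ → ℕ} (hrep : Reps Z S F D rep) :
    Set.InjOn rep (Z.todo S F) := by
  intro i hi j hj hij
  have h1 := (hrep i hi).2.mono h.tame.r₁_le_R
  have h2 := (hrep j hj).2.mono h.tame.r₁_le_R
  rw [← hij] at h2
  exact h.tame.unique (mem_todo.1 hi).1 (mem_todo.1 hj).1 h1 h2

/-- With all change points approximated at scale `a`, each further candidate costs `ξ` and saves at
most `ξ / 4`. Hence the criterion grows along every chain of supersets. -/
theorem inF_of_reps (h : Z.Call S C₀ F D chk) {rep : ℕ → ℕ} (hrep : Reps Z S F D rep) :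
    InF (Z.crit S.ξ F b) D ((Z.todo S F).image rep) := by
  refine ⟨fun c hc => ?_, fun B B' hB hBB' hB' => ?_⟩
  · obtain ⟨j, hj, rfl⟩ := Finset.mem_image.1 hc
    exact (hrep j hj).1
  have key : ∀ T : Finset ℕ, T ⊆ B' → Z.crit S.ξ F b B ≤ Z.crit S.ξ F b (B ∪ T) := by
    intro T
    induction T using Finset.induction_on with
    | empty => intro _; simp
    | insert c T hc ih =>
      intro hT
      have hT' : T ⊆ B' := (Finset.subset_insert c T).trans hT
      refine (ih hT').trans ?_
      rw [Finset.union_insert]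
      by_cases hcB : c ∈ B ∪ T
      · rw [Finset.insert_eq_of_mem hcB]
      have hBT : B ∪ T ⊆ D := (Finset.union_subset hBB' hT').trans hB'
      have hcD : c ∈ D := hB' (hT (by simp))
      have h1 := h.tame.fit_le_insert (h.union_sub hBT) (h.cand_sub hcD) fun i hi => Or.inl (by
        by_cases hi' : i ∈ Z.todo S F
        · refine Cov.of_mem ?_ ((hrep i hi').2.mono h.tame.r₁_le_a)
          have := hB (Finset.mem_image_of_mem rep hi')
          simp [this]
        · exact (h.cov_of_not_mem hi hi').mono le_rfl Finset.subset_union_right)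
      unfold crit
      rw [Finset.card_insert_of_notMem hcB, Finset.insert_union]
      push_cast
      nlinarith [h.tame.ξ_pos]
  have := key B' subset_rfl
  rwa [Finset.union_eq_right.2 hBB'] at this

/-- Otherwise let `B` consist of all candidates that are not near `k_j` at scale `m`. It contains
`A` and still covers the other change points, so adding `chk j` to it lowers the criterion,
contradicting membership in `F`. Taking `B` as large as possible is what secures the covering. -/
theorem near_of_inF (h : Z.Call S C₀ F D chk) {A : Finset ℕ} (hA : InF (Z.crit S.ξ F b) D A)
    {j : ℕ} (hj : j ∈ Z.todo S F) (hcov : ¬ Z.Cov S.m F j) : ∃ c ∈ A, Z.Near S.m j c := by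
  classical
  by_contra! hcon
  have hji := (mem_todo.1 hj).1
  set B := D.filter fun c => ¬ Z.Near S.m j c with hBdef
  have hBD : B ⊆ D := Finset.filter_subset _ _
  have hcD := h.chk_mem hj
  have hAB : A ⊆ B := fun c hc => Finset.mem_filter.2 ⟨hA.1 hc, hcon c hc⟩
  have h1 := hA.2 B (insert (chk j) B) hAB (Finset.subset_insert _ _)
    (Finset.insert_subset hcD hBD)
  have h2 := h.tame.fit_insert_le (h.union_sub hBD) (h.cand_sub hcD) hji (h.chk_near j hji)
    (fun ⟨p, hp, hn⟩ => by
      by_cases hpB : p ∈ B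
      · exact (Finset.mem_filter.1 hpB).2 hn
      · refine hcov ⟨p, ?_, hn⟩
        simp only [Finset.mem_insert, Finset.mem_union] at hp ⊢
        tauto)
    (fun i hi hij => by
      by_cases hi' : i ∈ Z.todo S F
      · refine Cov.of_mem (p := chk i) ?_ ((h.chk_nearR hi).mono h.tame.r₁_le_R)
        refine Finset.mem_union_left _ (Finset.mem_filter.2 ⟨h.chk_mem hi', fun hn => hij ?_⟩)
        exact h.tame.unique hi hji ((h.chk_nearR hi).mono h.tame.r₁_le_R) (hn.mono h.tame.m_le)
      · exact (h.cov_of_not_mem hi hi').mono h.tame.a_le_R Finset.subset_union_right)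
  rw [← Finset.insert_union] at h2
  have h3 : ((insert (chk j) B).card : ℝ) ≤ B.card + 1 := by
    exact_mod_cast Finset.card_insert_le _ _
  unfold crit at h1
  nlinarith [h.tame.ξ_pos]

/-- Change points close to a fixed point are at the boundary of the considered change points. -/
theorem rep_extreme (h : Z.Call S C₀ F D chk) {rep : ℕ → ℕ} (hrep : Reps Z S F D rep) {i j p : ℕ}
    (hi : i ∈ Z.todo S F) (hj : j ∈ Z.todo S F) (hn : Z.Near S.m j p) :
    ((∀ c ∈ D, p < c) → rep j ≤ rep i) ∧ ((∀ c ∈ D, c < p) → rep i ≤ rep j) := by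
  have hnR := hn.mono h.tame.m_le
  have hij := (hrep j hj).2.mono h.tame.r₁_le_R
  have hii := (hrep i hi).2.mono h.tame.r₁_le_R
  constructor
  · intro hp
    by_contra! hlt
    have := h.tame.unique (mem_todo.1 hi).1 (mem_todo.1 hj).1 hii
      (hnR.convex hij (hp _ (hrep i hi).1).le hlt.le)
    subst this
    exact lt_irrefl _ hlt
  · intro hp
    by_contra! hlt
    have := h.tame.unique (mem_todo.1 hi).1 (mem_todo.1 hj).1 hii
      (hij.convex hnR hlt.le (hp _ (hrep i hi).1).le)
    subst this
    exact lt_irrefl _ hlt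

/-- A covering point lies on one side of all of `D`, and the outstanding change point it covers is
the extreme one on that side. -/
theorem card_filter_cov_le (h : Z.Call S C₀ F D chk) {U : Finset ℕ} (hU : U ⊆ Z.todo S F)
    (hcov : ∀ j ∈ U, Z.Cov S.m F j) : U.card ≤ 2 := by
  classical
  have hrep : Reps Z S F D chk := fun j hj => ⟨h.chk_mem hj, h.chk_nearR (mem_todo.1 hj).1⟩
  have hinj := h.reps_injOn hrep
  have h1 : U ⊆ (U.filter fun j => ∃ p, Z.Near S.m j p ∧ ∀ c ∈ D, p < c) ∪
      (U.filter fun j => ∃ p, Z.Near S.m j p ∧ ∀ c ∈ D, c < p) := by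
    intro j hj
    obtain ⟨p, hp, hn⟩ := hcov j hj
    rcases h.sepD p hp with h | h
    · exact Finset.mem_union_left _ (Finset.mem_filter.2 ⟨hj, p, hn, h⟩)
    · exact Finset.mem_union_right _ (Finset.mem_filter.2 ⟨hj, p, hn, h⟩)
  have h2 : (U.filter fun j => ∃ p, Z.Near S.m j p ∧ ∀ c ∈ D, p < c).card ≤ 1 := by
    refine Finset.card_le_one.2 fun i hi j hj => ?_
    obtain ⟨hi, p, hp, hpD⟩ := Finset.mem_filter.1 hi
    obtain ⟨hj, p', hp', hpD'⟩ := Finset.mem_filter.1 hj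
    exact hinj (hU hi) (hU hj) (le_antisymm ((h.rep_extreme hrep (hU hj) (hU hi) hp).1 hpD)
      ((h.rep_extreme hrep (hU hi) (hU hj) hp').1 hpD'))
  have h3 : (U.filter fun j => ∃ p, Z.Near S.m j p ∧ ∀ c ∈ D, c < p).card ≤ 1 := by
    refine Finset.card_le_one.2 fun i hi j hj => ?_
    obtain ⟨hi, p, hp, hpD⟩ := Finset.mem_filter.1 hi
    obtain ⟨hj, p', hp', hpD'⟩ := Finset.mem_filter.1 hj
    exact hinj (hU hi) (hU hj) (le_antisymm ((h.rep_extreme hrep (hU hi) (hU hj) hp').2 hpD')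
      ((h.rep_extreme hrep (hU hj) (hU hi) hp).2 hpD))
  have := Finset.card_le_card h1
  have := Finset.card_union_le (U.filter fun j => ∃ p, Z.Near S.m j p ∧ ∀ c ∈ D, p < c)
    (U.filter fun j => ∃ p, Z.Near S.m j p ∧ ∀ c ∈ D, c < p)
  omega

/-- Omitting change points close to fixed points leads to feasible sets. -/
theorem feasible_of_reps (h : Z.Call S C₀ F D chk) {rep : ℕ → ℕ} (hrep : Reps Z S F D rep)
    {I : Finset ℕ} (hI : I ⊆ Z.todo S F) (hcov : ∀ j ∈ Z.todo S F, j ∉ I → Z.Cov S.m F j) :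
    Feasible (Z.crit S.ξ F b) D (I.image rep) := by
  classical
  have hF := h.inF_of_reps (b := b) hrep
  have hinj := h.reps_injOn hrep
  refine ⟨(Z.todo S F).image rep, hF, Nat.sInf_le ⟨_, hF, rfl⟩, ?_, ?_⟩
  -- A smallest member of `F` needs distinct points for all outstanding change points not covered at
  -- scale `m`. At most two are covered, so one representative each for all of them exceeds `m*` by
  -- at most two.
  · obtain ⟨A, hA, hcard⟩ : mStar (Z.crit S.ξ F b) D ∈
        {m | ∃ A, InF (Z.crit S.ξ F b) D A ∧ A.card = m} := Nat.sInf_mem ⟨_, _, hF, rfl⟩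
    rw [← hcard, Finset.card_image_of_injOn hinj]
    set U := (Z.todo S F).filter fun j => Z.Cov S.m F j with hUdef
    have hU := h.card_filter_cov_le (Finset.filter_subset _ _)
      (fun j hj => (Finset.mem_filter.1 hj).2 : ∀ j ∈ U, Z.Cov S.m F j)
    have hex : ∀ j ∈ (Z.todo S F).filter (fun j => ¬ Z.Cov S.m F j), ∃ c ∈ A, Z.Near S.m j c :=
      fun j hj => h.near_of_inF hA (Finset.mem_filter.1 hj).1 (Finset.mem_filter.1 hj).2
    choose! f hf using hex
    have hle := Finset.card_le_card_of_injOn f (fun j hj => (hf j hj).1) (fun i hi j hj hij => by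
      have h1 := (hf i hi).2.mono h.tame.m_le
      have h2 := (hf j hj).2.mono h.tame.m_le
      rw [← hij] at h2
      exact h.tame.unique (mem_todo.1 (Finset.mem_filter.1 hi).1).1
        (mem_todo.1 (Finset.mem_filter.1 hj).1).1 h1 h2)
    have := Finset.card_filter_add_card_filter_not (s := Z.todo S F) (fun j => Z.Cov S.m F j)
    omega
  -- The omitted change points are covered by points outside the range of `D`, so their
  -- representatives are the first or the last.
  · refine ⟨Finset.image_subset_image hI, fun c hc hc' => ?_⟩
    obtain ⟨j, hj, rfl⟩ := Finset.mem_image.1 hc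
    have hjI : j ∉ I := fun hjI => hc' (Finset.mem_image_of_mem _ hjI)
    obtain ⟨p, hp, hn⟩ := hcov j hj hjI
    rcases h.sepD p hp with hs | hs
    · left
      intro c hc
      obtain ⟨i, hi, rfl⟩ := Finset.mem_image.1 hc
      exact (h.rep_extreme hrep hi hj hn).1 hs
    · right
      intro c hc
      obtain ⟨i, hi, rfl⟩ := Finset.mem_image.1 hc
      exact (h.rep_extreme hrep hi hj hn).2 hs

end Call

end Sample

/-- An omitted point is a minimum or a maximum of `A'`, and each of these is unique. -/
theorem InnerSubset.card_sdiff_le {A A' : Finset ℕ} (h : InnerSubset A A') :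
    (A' \ A).card ≤ 2 := by
  classical
  have h1 : A' \ A ⊆ (A'.filter fun c => ∀ b ∈ A', c ≤ b) ∪ (A'.filter fun c => ∀ b ∈ A', b ≤ c) := by
    intro c hc
    obtain ⟨hc, hc'⟩ := Finset.mem_sdiff.1 hc
    rcases h.2 c hc hc' with h | h
    · exact Finset.mem_union_left _ (Finset.mem_filter.2 ⟨hc, h⟩)
    · exact Finset.mem_union_right _ (Finset.mem_filter.2 ⟨hc, h⟩)
  have h2 : (A'.filter fun c => ∀ b ∈ A', c ≤ b).card ≤ 1 := by
    refine Finset.card_le_one.2 fun i hi j hj => ?_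
    obtain ⟨hi, hi'⟩ := Finset.mem_filter.1 hi
    obtain ⟨hj, hj'⟩ := Finset.mem_filter.1 hj
    exact le_antisymm (hi' j hj) (hj' i hi)
  have h3 : (A'.filter fun c => ∀ b ∈ A', b ≤ c).card ≤ 1 := by
    refine Finset.card_le_one.2 fun i hi j hj => ?_
    obtain ⟨hi, hi'⟩ := Finset.mem_filter.1 hi
    obtain ⟨hj, hj'⟩ := Finset.mem_filter.1 hj
    exact le_antisymm (hj' i hi) (hi' j hj)
  have := Finset.card_le_card h1
  have := Finset.card_union_le (A'.filter fun c => ∀ b ∈ A', c ≤ b)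
    (A'.filter fun c => ∀ b ∈ A', b ≤ c)
  omega

namespace Sample

variable {Z : Sample} {S : Scales} {C₀ : Finset ℕ}

namespace Call

variable {F D : Finset ℕ} {chk : ℕ → ℕ} {b : ℝ}

/-- Replacing one approximation of each of the change points in `G` by a better one. -/
theorem rss_replace (h : Z.Call S C₀ F D chk) {G Y : Finset ℕ} {pt rep : ℕ → ℕ}
    (hG : G ⊆ Z.todo S F) (hGa : ∀ j ∈ G, ¬ Z.Cov S.a F j)
    (hpt : ∀ j ∈ G, pt j ∈ D ∧ Z.Near S.R j (pt j))
    (hrep : ∀ j ∈ G, (Z.Near S.r₁ j (pt j) ∧ rep j = pt j) ∨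
      (¬ Z.Near S.r₁ j (pt j) ∧ rep j = chk j))
    (hY : Y ⊆ D) (hYG : ∀ j ∈ G, ∀ c ∈ Y, ¬ Z.Near S.R j c)
    (hcov : ∀ i, Z.Idx i → i ∉ G → Z.Cov S.R (Y ∪ F) i) :
    rss Z.obs Z.n (Y ∪ G.image rep ∪ F) ≤ rss Z.obs Z.n (Y ∪ G.image pt ∪ F) ∧
      ((∃ j ∈ G, ¬ Z.Near S.r₁ j (pt j)) →
        rss Z.obs Z.n (Y ∪ G.image rep ∪ F) < rss Z.obs Z.n (Y ∪ G.image pt ∪ F)) := by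
  classical
  have hrepD : ∀ j ∈ G, rep j ∈ D ∧ Z.Near S.R j (rep j) := by
    intro j hj
    rcases hrep j hj with ⟨-, h1⟩ | ⟨-, h1⟩
    · rw [h1]; exact hpt j hj
    · rw [h1]
      exact ⟨h.chk_mem (hG hj), (h.chk_nearR (mem_todo.1 (hG hj)).1).mono h.tame.r₁_le_R⟩
  -- Replacements are made one at a time: `pick H` has already replaced the points with index in
  -- `H`.
  set pick : Finset ℕ → ℕ → ℕ := fun H i => if i ∈ H then rep i else pt i with hpick
  have hpickD : ∀ H, ∀ j ∈ G, pick H j ∈ D ∧ Z.Near S.R j (pick H j) := by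
    intro H j hj
    by_cases hjH : j ∈ H
    · simpa [hpick, hjH] using hrepD j hj
    · simpa [hpick, hjH] using hpt j hj
  have key : ∀ H : Finset ℕ, H ⊆ G →
      rss Z.obs Z.n (Y ∪ G.image (pick H) ∪ F) ≤ rss Z.obs Z.n (Y ∪ G.image pt ∪ F) ∧
      ((∃ j ∈ H, ¬ Z.Near S.r₁ j (pt j)) →
        rss Z.obs Z.n (Y ∪ G.image (pick H) ∪ F) < rss Z.obs Z.n (Y ∪ G.image pt ∪ F)) := by
    intro H
    induction H using Finset.induction_on with
    | empty => intro _; simp [hpick]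
    | insert j H hjH ih =>
      intro hHG
      have hjG := hHG (Finset.mem_insert_self j H)
      have hji := (mem_todo.1 (hG hjG)).1
      obtain ⟨ih1, ih2⟩ := ih ((Finset.subset_insert j H).trans hHG)
      set P := Y ∪ (G.erase j).image (pick H) ∪ F with hP
      have e1 : Y ∪ G.image (pick H) ∪ F = insert (pt j) P := by
        conv_lhs => rw [← Finset.insert_erase hjG, Finset.image_insert]
        simp [hP, hpick, hjH]
      have e2 : Y ∪ G.image (pick (insert j H)) ∪ F = insert (rep j) P := by
        conv_lhs => rw [← Finset.insert_erase hjG, Finset.image_insert]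
        have : (G.erase j).image (pick (insert j H)) = (G.erase j).image (pick H) := by
          refine Finset.image_congr fun i hi => ?_
          have := Finset.ne_of_mem_erase hi
          simp [hpick, this]
        rw [this]
        simp [hP, hpick]
      rw [e2]
      rw [e1] at ih1 ih2
      have hPsub : P ⊆ C₀ := by
        refine Finset.union_subset (Finset.union_subset (hY.trans h.cand_sub) ?_) h.fixed_sub
        intro c hc
        obtain ⟨i, hi, rfl⟩ := Finset.mem_image.1 hc
        exact h.cand_sub (hpickD H i (Finset.mem_of_mem_erase hi)).1
      have hPnear : ∀ p ∈ P, p ∈ F ∨ ¬ Z.Near S.R j p := by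
        intro p hp
        rcases Finset.mem_union.1 hp with hp | hp
        · right
          rcases Finset.mem_union.1 hp with hp | hp
          · exact hYG j hjG p hp
          · obtain ⟨i, hi, rfl⟩ := Finset.mem_image.1 hp
            intro hn
            obtain ⟨hij, hi⟩ := Finset.mem_erase.1 hi
            exact hij (h.tame.unique (mem_todo.1 (hG hi)).1 hji (hpickD H i hi).2 hn)
        · exact Or.inl hp
      have hstep : ¬ Z.Near S.r₁ j (pt j) →
          rss Z.obs Z.n (insert (rep j) P) < rss Z.obs Z.n (insert (pt j) P) := by
        intro hbad
        have hrj : rep j = chk j := by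
          rcases hrep j hjG with ⟨h1, -⟩ | ⟨-, h1⟩
          · exact absurd h1 hbad
          · exact h1
        have hpj := hpt j hjG
        have hrjD := hrepD j hjG
        rw [hrj] at hrjD ⊢
        refine h.tame.rss_insert_lt hPsub (h.cand_sub hpj.1) (h.cand_sub hrjD.1) hji hpj.2 hbad
          (h.chk_near j hji) ?_ ?_ ?_
        · rintro ⟨p, hp, hn⟩
          by_cases hpP : p ∈ P
          · rcases hPnear p hpP with hpF | hpn
            · exact hGa j hjG (Cov.of_mem hpF hn)
            · exact hpn (hn.mono h.tame.a_le_R)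
          · refine hGa j hjG ⟨p, ?_, hn⟩
            simp only [Finset.mem_insert] at hp ⊢
            tauto
        · intro i hi hij
          by_cases hiG : i ∈ G
          · refine Cov.of_mem ?_ (hpickD H i hiG).2
            exact Finset.mem_union_left _ (Finset.mem_union_right _
              (Finset.mem_image_of_mem _ (Finset.mem_erase.2 ⟨hij, hiG⟩)))
          · refine (hcov i hi hiG).mono le_rfl (Finset.union_subset_union_left ?_)
            exact Finset.subset_union_left
        -- No remaining point separates the old point from the new one: fixed points lie outside the
        -- range of `D`, and other points between them would be near `k_j` by convexity.
        · intro p hp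
          rcases hPnear p hp with hpF | hpn
          · rcases h.sepD p (by simp [hpF]) with hs | hs
            · exact Or.inl ⟨hs _ hpj.1, hs _ hrjD.1⟩
            · exact Or.inr ⟨hs _ hpj.1, hs _ hrjD.1⟩
          · rcases lt_or_ge p (pt j) with h1 | h1
            · rcases lt_or_ge p (chk j) with h2 | h2
              · exact Or.inl ⟨h1, h2⟩
              · exact absurd (hrjD.2.convex hpj.2 h2 h1.le) hpn
            · rcases lt_or_ge (chk j) p with h2 | h2
              · refine Or.inr ⟨lt_of_le_of_ne h1 fun heq => ?_, h2⟩
                exact hpn (heq ▸ hpj.2)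
              · exact absurd (hpj.2.convex hrjD.2 h1 h2) hpn
      rcases hrep j hjG with ⟨hn, hr⟩ | ⟨hn, -⟩
      · rw [hr]
        refine ⟨ih1, fun ⟨i, hi, hi'⟩ => ih2 ⟨i, ?_, hi'⟩⟩
        rcases Finset.mem_insert.1 hi with rfl | hi
        · exact absurd hn hi'
        · exact hi
      · exact ⟨((hstep hn).trans_le ih1).le, fun _ => (hstep hn).trans_le ih1⟩
  have e3 : G.image (pick G) = G.image rep := by
    refine Finset.image_congr fun i hi => ?_
    have : i ∈ G := hi
    simp [hpick, this]
  have := key G subset_rfl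
  rwa [e3] at this

/-- Superfluous points hardly improve the fit. -/
theorem fit_le_union (h : Z.Call S C₀ F D chk) {I X : Finset ℕ} {rep : ℕ → ℕ}
    (hrep : Reps Z S F D rep) (hI : I ⊆ Z.todo S F) (hX : X ⊆ D)
    (hcov : ∀ i ∈ Z.todo S F, i ∉ I → Z.Cov S.a F i ∨
      (Z.Cov S.m F i ∧ ∀ c ∈ X, ¬ Z.Near S.R i c)) :
    Z.fit (I.image rep ∪ F) ≤ Z.fit (X ∪ I.image rep ∪ F) + X.card * (S.ξ / 4) := by
  have hID : I.image rep ⊆ D := by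
    intro c hc
    obtain ⟨j, hj, rfl⟩ := Finset.mem_image.1 hc
    exact (hrep j (hI hj)).1
  have key : ∀ T : Finset ℕ, T ⊆ X →
      Z.fit (I.image rep ∪ F) ≤ Z.fit (T ∪ I.image rep ∪ F) + T.card * (S.ξ / 4) := by
    intro T
    induction T using Finset.induction_on with
    | empty => intro _; simp
    | insert c T hc ih =>
      intro hT
      have hT' : T ⊆ X := (Finset.subset_insert c T).trans hT
      have hcX : c ∈ X := hT (by simp)
      have h1 := h.tame.fit_le_insert (P := T ∪ I.image rep ∪ F)
        (h.union_sub (Finset.union_subset (hT'.trans hX) hID)) (h.cand_sub (hX hcX)) fun i hi => by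
        by_cases hi' : i ∈ Z.todo S F
        · by_cases hiI : i ∈ I
          · refine Or.inl (Cov.of_mem (p := rep i) ?_ ((hrep i hi').2.mono h.tame.r₁_le_a))
            exact Finset.mem_union_left _ (Finset.mem_union_right _
              (Finset.mem_image_of_mem _ hiI))
          · rcases hcov i hi' hiI with h1 | ⟨h1, h2⟩
            · exact Or.inl (h1.mono le_rfl Finset.subset_union_right)
            · exact Or.inr ⟨h1.mono le_rfl Finset.subset_union_right, h2 c hcX⟩
        · exact Or.inl ((h.cov_of_not_mem hi hi').mono le_rfl Finset.subset_union_right)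
      have h2 := ih hT'
      rw [Finset.card_insert_of_notMem hc, Finset.insert_union, Finset.insert_union]
      push_cast
      linarith
  exact key X subset_rfl

/-- Adding an approximation of a change point which is not covered improves the fit
substantially. -/
theorem fit_union_le (h : Z.Call S C₀ F D chk) {A B : Finset ℕ} {rep : ℕ → ℕ} {j : ℕ}
    (hA : A ⊆ D) (hrep : Reps Z S F D rep) (hB : B ⊆ Z.todo S F) (hj : j ∈ B)
    (hrj : rep j = chk j) (hjm : ¬ Z.Cov S.m F j) (hjA : ∀ c ∈ A, ¬ Z.Near S.R j c)
    (hcov : ∀ i ∈ Z.todo S F, i ∉ B → Z.Cov S.R (A ∪ F) i) :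
    Z.fit (A ∪ B.image rep ∪ F) + 4 * S.ξ ≤ Z.fit (A ∪ F) := by
  classical
  have hji := (mem_todo.1 (hB hj)).1
  have hBD : (B.erase j).image rep ⊆ D := by
    intro c hc
    obtain ⟨i, hi, rfl⟩ := Finset.mem_image.1 hc
    exact (hrep i (hB (Finset.mem_of_mem_erase hi))).1
  set P := A ∪ (B.erase j).image rep ∪ F with hP
  have e1 : A ∪ B.image rep ∪ F = insert (chk j) P := by
    conv_lhs => rw [← Finset.insert_erase hj, Finset.image_insert, hrj]
    simp [hP]
  have hPsub : P ⊆ C₀ := h.union_sub (Finset.union_subset hA hBD)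
  have h1 : Z.fit P ≤ Z.fit (A ∪ F) :=
    h.tame.fit_anti hPsub (Finset.union_subset_union_left Finset.subset_union_left)
  have h2 := h.tame.fit_insert_le (c := chk j) hPsub (h.cand_sub (h.chk_mem (hB hj))) hji
    (h.chk_near j hji) ?_ ?_
  · rw [e1]
    linarith
  · rintro ⟨p, hp, hn⟩
    have hnR := hn.mono h.tame.m_le
    by_cases hpP : p ∈ P
    · rcases Finset.mem_union.1 hpP with hp | hp
      · rcases Finset.mem_union.1 hp with hp | hp
        · exact hjA p hp hnR
        · obtain ⟨i, hi, rfl⟩ := Finset.mem_image.1 hp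
          obtain ⟨hij, hi⟩ := Finset.mem_erase.1 hi
          exact hij (h.tame.unique (mem_todo.1 (hB hi)).1 hji
            ((hrep i (hB hi)).2.mono h.tame.r₁_le_R) hnR)
      · exact hjm (Cov.of_mem hp hn)
    · refine hjm ⟨p, ?_, hn⟩
      simp only [Finset.mem_insert] at hp ⊢
      tauto
  · intro i hi hij
    by_cases hi' : i ∈ Z.todo S F
    · by_cases hiB : i ∈ B
      · refine Cov.of_mem (p := rep i) ?_ ((hrep i hi').2.mono h.tame.r₁_le_R)
        exact Finset.mem_union_left _ (Finset.mem_union_right _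
          (Finset.mem_image_of_mem _ (Finset.mem_erase.2 ⟨hij, hiB⟩)))
      · exact (hcov i hi' hiB).mono le_rfl
          (Finset.union_subset_union_left Finset.subset_union_left)
    · exact (h.cov_of_not_mem hi hi').mono h.tame.a_le_R Finset.subset_union_right

/-- The output of the inner algorithm consists of exactly one good approximation of each change
point, except possibly for change points close to fixed points. -/
theorem output (h : Z.Call S C₀ F D chk) {A : Finset ℕ}
    (hA : IsPrunOutput (Z.crit S.ξ F b) D A) :
    A ⊆ D ∧ (∀ c ∈ A, ∃ j ∈ Z.todo S F, Z.Near S.r₁ j c) ∧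
    (∀ j ∈ Z.todo S F, ∀ c ∈ A, ∀ c' ∈ A, Z.Near S.r₁ j c → Z.Near S.r₁ j c' → c = c') ∧
    (∀ j ∈ Z.todo S F, (∃ c ∈ A, Z.Near S.r₁ j c) ∨ Z.Cov S.m F j) := by
  classical
  obtain ⟨⟨A', hA'F, -, -, hin⟩, hmin⟩ := hA
  have hAD : A ⊆ D := hin.1.trans hA'F.1
  set N : ℕ → Finset ℕ := fun j => A.filter fun c => Z.Near S.R j c with hN
  have hmN : ∀ j c, c ∈ N j ↔ c ∈ A ∧ Z.Near S.R j c := fun j c => by simp [hN]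
  -- Indices represented in the reference set. Change points covered at scale `a` need no
  -- representative and those missed at scale `m` need one; in the grey zone between, the reference
  -- set follows the decision made by `A`.
  set I := (Z.todo S F).filter fun j =>
    ¬ Z.Cov S.a F j ∧ (¬ Z.Cov S.m F j ∨ (N j).Nonempty) with hI
  have hIsub : I ⊆ Z.todo S F := Finset.filter_subset _ _
  have hIidx : ∀ j ∈ I, Z.Idx j := fun j hj => (mem_todo.1 (hIsub hj)).1
  -- `A` has exactly one point near `k_j` for `j ∈ G`. The rest of `I`, called `B` below, has none
  -- or at least two.
  set G := I.filter fun j => (N j).card = 1 with hGdef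
  have hGI : G ⊆ I := Finset.filter_subset _ _
  have hex : ∀ j ∈ G, ∃ c, N j = {c} := fun j hj =>
    Finset.card_eq_one.1 (Finset.mem_filter.1 hj).2
  choose! pt hpt using hex
  have hptA : ∀ j ∈ G, pt j ∈ A ∧ Z.Near S.R j (pt j) := fun j hj =>
    (hmN j _).1 (by rw [hpt j hj]; exact Finset.mem_singleton_self _)
  have hptu : ∀ j ∈ G, ∀ c ∈ A, Z.Near S.R j c → c = pt j := fun j hj c hc hn => by
    have : c ∈ N j := (hmN j c).2 ⟨hc, hn⟩
    rwa [hpt j hj, Finset.mem_singleton] at this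
  -- The reference set keeps the points of `A` that are already good, so that it differs from `A`
  -- only where `A` is at fault.
  set rep : ℕ → ℕ := fun j => if j ∈ G ∧ Z.Near S.r₁ j (pt j) then pt j else chk j with hrepdef
  have hrep : Reps Z S F D rep := by
    intro j hj
    by_cases hc : j ∈ G ∧ Z.Near S.r₁ j (pt j)
    · simp only [hrepdef, if_pos hc]
      exact ⟨hAD (hptA j hc.1).1, hc.2⟩
    · simp only [hrepdef, if_neg hc]
      exact ⟨h.chk_mem hj, h.chk_nearR (mem_todo.1 hj).1⟩
  have hrepG : ∀ j ∈ G, (Z.Near S.r₁ j (pt j) ∧ rep j = pt j) ∨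
      (¬ Z.Near S.r₁ j (pt j) ∧ rep j = chk j) := by
    intro j hj
    by_cases hc : Z.Near S.r₁ j (pt j)
    · exact Or.inl ⟨hc, if_pos ⟨hj, hc⟩⟩
    · exact Or.inr ⟨hc, if_neg fun h => hc h.2⟩
  have hrepn : ∀ j, j ∉ G → rep j = chk j := fun j hj => if_neg fun h => hj h.1
  set X := A.filter fun c => ∀ j ∈ G, ¬ Z.Near S.R j c with hX
  have hXA : X ⊆ A := Finset.filter_subset _ _
  have hXG : ∀ j ∈ G, ∀ c ∈ X, ¬ Z.Near S.R j c := fun j hj c hc =>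
    (Finset.mem_filter.1 hc).2 j hj
  set B := I \ G with hB
  have hBI : B ⊆ I := Finset.sdiff_subset
  have hBG : ∀ j ∈ B, j ∉ G := fun j hj => (Finset.mem_sdiff.1 hj).2
  have hAeq : A = X ∪ G.image pt := by
    ext c
    constructor
    · intro hc
      by_cases hcX : c ∈ X
      · exact Finset.mem_union_left _ hcX
      · have : ∃ j ∈ G, Z.Near S.R j c := by
          by_contra! hcon
          exact hcX (Finset.mem_filter.2 ⟨hc, hcon⟩)
        obtain ⟨j, hj, hn⟩ := this
        exact Finset.mem_union_right _ (Finset.mem_image.2 ⟨j, hj, (hptu j hj c hc hn).symm⟩)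
    · intro hc
      rcases Finset.mem_union.1 hc with hc | hc
      · exact hXA hc
      · obtain ⟨j, hj, rfl⟩ := Finset.mem_image.1 hc
        exact (hptA j hj).1
  have hcardA : A.card = X.card + G.card := by
    have hdisj : Disjoint X (G.image pt) := by
      refine Finset.disjoint_left.2 fun c hc hc' => ?_
      obtain ⟨j, hj, rfl⟩ := Finset.mem_image.1 hc'
      exact hXG j hj _ hc (hptA j hj).2
    have hinj : Set.InjOn pt G := by
      intro i hi j hj hij
      have h2 := (hptA j hj).2
      rw [← hij] at h2
      exact h.tame.unique (hIidx i (hGI hi)) (hIidx j (hGI hj)) (hptA i hi).2 h2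
    conv_lhs => rw [hAeq]
    rw [Finset.card_union_of_disjoint hdisj, Finset.card_image_of_injOn hinj]
  have hcardI : I.card = G.card + B.card := by
    rw [hB, Finset.card_sdiff_of_subset hGI]
    have := Finset.card_le_card hGI
    omega
  -- change points without approximation in `A`
  set M := B.filter fun j => N j = ∅ with hM
  have hMcov : ∀ j ∈ M, ¬ Z.Cov S.m F j := by
    intro j hj
    obtain ⟨hjB, hj0⟩ := Finset.mem_filter.1 hj
    rcases (Finset.mem_filter.1 (hBI hjB)).2.2 with h1 | h1
    · exact h1
    · rw [hj0] at h1
      exact absurd h1 Finset.not_nonempty_empty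
  -- `A'` lies in `F` and hence has a point near each missed change point. None of these points is
  -- in `A`, and `A` omits at most two points of `A'`.
  have hMcard : M.card ≤ 2 := by
    have hex : ∀ j ∈ M, ∃ c ∈ A', Z.Near S.m j c := fun j hj =>
      h.near_of_inF hA'F (hIsub (hBI (Finset.mem_filter.1 hj).1)) (hMcov j hj)
    choose! f hf using hex
    refine (Finset.card_le_card_of_injOn f (t := A' \ A) (fun j hj => ?_)
      fun i hi j hj hij => ?_).trans hin.card_sdiff_le
    · refine Finset.mem_sdiff.2 ⟨(hf j hj).1, fun hfA => ?_⟩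
      have : f j ∈ N j := (hmN _ _).2 ⟨hfA, (hf j hj).2.mono h.tame.m_le⟩
      rw [(Finset.mem_filter.1 hj).2] at this
      exact absurd this (Finset.notMem_empty _)
    · have h1 := (hf i hi).2.mono h.tame.m_le
      have h2 := (hf j hj).2.mono h.tame.m_le
      rw [← hij] at h2
      exact h.tame.unique (hIidx i (hBI (Finset.mem_filter.1 hi).1))
        (hIidx j (hBI (Finset.mem_filter.1 hj).1)) h1 h2
  -- the other change points in `B` have at least two approximations
  have hBcard : 2 * B.card ≤ 2 * M.card + X.card := by
    have h1 : 2 * (B \ M).card ≤ X.card := by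
      have hsub : (B \ M).biUnion N ⊆ X := by
        intro c hc
        obtain ⟨j, hj, hc⟩ := Finset.mem_biUnion.1 hc
        obtain ⟨hcA, hn⟩ := (hmN j c).1 hc
        refine Finset.mem_filter.2 ⟨hcA, fun i hi hn' => ?_⟩
        have hjB := (Finset.mem_sdiff.1 hj).1
        have := h.tame.unique (hIidx i (hGI hi)) (hIidx j (hBI hjB)) hn' hn
        exact hBG j hjB (this ▸ hi)
      have hdisj : ∀ i ∈ B \ M, ∀ j ∈ B \ M, i ≠ j → Disjoint (N i) (N j) := by
        intro i hi j hj hij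
        refine Finset.disjoint_left.2 fun c hc hc' => hij ?_
        exact h.tame.unique (hIidx i (hBI (Finset.mem_sdiff.1 hi).1))
          (hIidx j (hBI (Finset.mem_sdiff.1 hj).1)) ((hmN i c).1 hc).2 ((hmN j c).1 hc').2
      have h2 := Finset.card_biUnion hdisj
      have h3 : ∑ _j ∈ B \ M, 2 ≤ ∑ j ∈ B \ M, (N j).card := by
        refine Finset.sum_le_sum fun j hj => ?_
        obtain ⟨hjB, hjM⟩ := Finset.mem_sdiff.1 hj
        have h0 : (N j).card ≠ 0 := fun h0 =>
          hjM (Finset.mem_filter.2 ⟨hjB, Finset.card_eq_zero.1 h0⟩)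
        have h1 : (N j).card ≠ 1 := fun h1 =>
          hBG j hjB (Finset.mem_filter.2 ⟨hBI hjB, h1⟩)
        omega
      rw [Finset.sum_const, smul_eq_mul] at h3
      have := Finset.card_le_card hsub
      omega
    have hMB : M ⊆ B := Finset.filter_subset _ _
    rw [Finset.card_sdiff_of_subset hMB] at h1
    have := Finset.card_le_card hMB
    omega
  have hBimg : B.image rep ⊆ D := by
    intro c hc
    obtain ⟨j, hj, rfl⟩ := Finset.mem_image.1 hc
    exact (hrep j (hIsub (hBI hj))).1
  have hnotI : ∀ i ∈ Z.todo S F, i ∉ I → Z.Cov S.a F i ∨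
      (Z.Cov S.m F i ∧ ∀ c ∈ X, ¬ Z.Near S.R i c) := by
    intro i hi hiI
    by_cases h1 : Z.Cov S.a F i
    · exact Or.inl h1
    · right
      by_contra hcon
      refine hiI (Finset.mem_filter.2 ⟨hi, h1, ?_⟩)
      by_contra! hcon'
      refine hcon ⟨hcon'.1, fun c hc hn => ?_⟩
      have : c ∈ N i := (hmN _ _).2 ⟨hXA hc, hn⟩
      rw [hcon'.2] at this
      exact absurd this (Finset.notMem_empty _)
  have hcovR : ∀ i, Z.Idx i → i ∉ I → Z.Cov S.R F i := by
    intro i hi hiI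
    by_cases hi' : i ∈ Z.todo S F
    · rcases hnotI i hi' hiI with h1 | ⟨h1, -⟩
      · exact h1.mono h.tame.a_le_R subset_rfl
      · exact h1.mono h.tame.m_le subset_rfl
    · exact (h.cov_of_not_mem hi hi').mono h.tame.a_le_R subset_rfl
  -- comparison of `A` with the reference set
  have hAstar := (hmin _ (h.feasible_of_reps (b := b) hrep hIsub fun j hj hjI => by
    rcases hnotI j hj hjI with h1 | ⟨h1, -⟩
    · exact h1.mono h.tame.a_le_m subset_rfl
    · exact h1)).1
  have hcardIm : (I.image rep).card = I.card :=
    Finset.card_image_of_injOn ((h.reps_injOn hrep).mono (by exact_mod_cast hIsub))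
  unfold crit at hAstar
  rw [hcardIm, hcardI, hcardA] at hAstar
  push_cast at hAstar
  have hξ := h.tame.ξ_pos
  have hX4 := h.fit_le_union hrep hIsub (hXA.trans hAD) hnotI
  have hswap := h.rss_replace (G := G) (Y := X ∪ B.image rep) (pt := pt) (rep := rep)
    (hGI.trans hIsub) (fun j hj => (Finset.mem_filter.1 (hGI hj)).2.1)
    (fun j hj => ⟨hAD (hptA j hj).1, (hptA j hj).2⟩) hrepG
    (Finset.union_subset (hXA.trans hAD) hBimg)
    (fun j hj c hc hn => by
      rcases Finset.mem_union.1 hc with hc | hc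
      · exact hXG j hj c hc hn
      · obtain ⟨i, hi, rfl⟩ := Finset.mem_image.1 hc
        have := h.tame.unique (hIidx i (hBI hi)) (hIidx j (hGI hj))
          ((hrep i (hIsub (hBI hi))).2.mono h.tame.r₁_le_R) hn
        exact hBG i hi (this ▸ hj))
    (fun i hi hiG => by
      by_cases hiI : i ∈ I
      · refine Cov.of_mem (p := rep i) ?_ ((hrep i (hIsub hiI)).2.mono h.tame.r₁_le_R)
        exact Finset.mem_union_left _ (Finset.mem_union_right _
          (Finset.mem_image_of_mem _ (Finset.mem_sdiff.2 ⟨hiI, hiG⟩)))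
      · exact (hcovR i hi hiI).mono le_rfl Finset.subset_union_right)
  have eW : X ∪ B.image rep ∪ G.image rep ∪ F = X ∪ I.image rep ∪ F := by
    rw [Finset.union_assoc X, ← Finset.image_union, hB, Finset.sdiff_union_of_subset hGI]
  have eQ : X ∪ B.image rep ∪ G.image pt ∪ F = A ∪ B.image rep ∪ F := by
    rw [Finset.union_right_comm X, ← hAeq]
  rw [eW, eQ] at hswap
  have hWsub : X ∪ I.image rep ∪ F ⊆ C₀ := by
    rw [← eW]
    refine h.union_sub (Finset.union_subset (Finset.union_subset (hXA.trans hAD) hBimg) ?_)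
    intro c hc
    obtain ⟨j, hj, rfl⟩ := Finset.mem_image.1 hc
    exact (hrep j (hIsub (hGI hj))).1
  have hQsub : A ∪ B.image rep ∪ F ⊆ C₀ := h.union_sub (Finset.union_subset hAD hBimg)
  have hQW := h.tame.fit_mono hWsub hswap.1
  have hAQ : Z.fit (A ∪ B.image rep ∪ F) ≤ Z.fit (A ∪ F) :=
    h.tame.fit_anti hQsub (Finset.union_subset_union_left Finset.subset_union_left)
  -- One missed change point gives a gain of `4 ξ`. Minimality of `A` then requires `4 + (3/4)|X| ≤
  -- |B|`, whereas `|B| ≤ |M| + |X| / 2 ≤ 2 + |X| / 2`.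
  have hM0 : M = ∅ := by
    by_contra hne
    obtain ⟨j, hj⟩ := Finset.nonempty_iff_ne_empty.2 hne
    obtain ⟨hjB, hj0⟩ := Finset.mem_filter.1 hj
    have hgain := h.fit_union_le hAD hrep (hBI.trans hIsub) hjB (hrepn j (hBG j hjB)) (hMcov j hj)
      (fun c hc hn => by
        have : c ∈ N j := (hmN _ _).2 ⟨hc, hn⟩
        rw [hj0] at this
        exact absurd this (Finset.notMem_empty _))
      (fun i hi hiB => by
        by_cases hiI : i ∈ I
        · have hiG : i ∈ G := by
            by_contra hiG
            exact hiB (Finset.mem_sdiff.2 ⟨hiI, hiG⟩)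
          exact Cov.of_mem (Finset.mem_union_left _ (hptA i hiG).1) (hptA i hiG).2
        · exact (hcovR i (mem_todo.1 hi).1 hiI).mono le_rfl Finset.subset_union_right)
    have c1 : (M.card : ℝ) ≤ 2 := by exact_mod_cast hMcard
    have c2 : 2 * (B.card : ℝ) ≤ 2 * M.card + X.card := by exact_mod_cast hBcard
    have c3 : (0 : ℝ) ≤ X.card := Nat.cast_nonneg _
    nlinarith
  have hMc : M.card = 0 := by rw [hM0, Finset.card_empty]
  -- Without missed change points the same comparison gives `(3/4)|X| ≤ |B| ≤ |X| / 2`, so nothing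
  -- superfluous or duplicated is left.
  have hX0 : X.card = 0 := by
    have c2 : 2 * (B.card : ℝ) ≤ X.card := by
      have : 2 * B.card ≤ X.card := by omega
      exact_mod_cast this
    have c3 : (X.card : ℝ) ≤ 0 := by nlinarith
    exact_mod_cast le_antisymm c3 (Nat.cast_nonneg _)
  have hB0 : B.card = 0 := by omega
  have hXe : X = ∅ := Finset.card_eq_zero.1 hX0
  have hBe : B = ∅ := Finset.card_eq_zero.1 hB0
  -- Now `A` and the reference set have equal cardinality, so a single badly located point would
  -- make the reference set strictly better.
  have hvalid : ∀ j ∈ G, Z.Near S.r₁ j (pt j) := by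
    by_contra! hcon
    have := h.tame.fit_strictMono hWsub (hswap.2 hcon)
    rw [hX0, Nat.cast_zero, zero_mul] at hX4
    rw [hX0, hB0, Nat.cast_zero] at hAstar
    linarith
  have hAG : ∀ c ∈ A, ∃ j ∈ G, c = pt j := by
    intro c hc
    rw [hAeq, hXe, Finset.empty_union] at hc
    obtain ⟨j, hj, rfl⟩ := Finset.mem_image.1 hc
    exact ⟨j, hj, rfl⟩
  refine ⟨hAD, fun c hc => ?_, fun j hj c hc c' hc' hn hn' => ?_, fun j hj => ?_⟩
  · obtain ⟨j, hj, rfl⟩ := hAG c hc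
    exact ⟨j, hIsub (hGI hj), hvalid j hj⟩
  · obtain ⟨i, hi, rfl⟩ := hAG c hc
    obtain ⟨i', hi', rfl⟩ := hAG c' hc'
    have hji := (mem_todo.1 hj).1
    have h1 := h.tame.unique (hIidx i (hGI hi)) hji (hptA i hi).2 (hn.mono h.tame.r₁_le_R)
    have h2 := h.tame.unique (hIidx i' (hGI hi')) hji (hptA i' hi').2 (hn'.mono h.tame.r₁_le_R)
    rw [h1, h2]
  · by_cases hcm : Z.Cov S.m F j
    · exact Or.inr hcm
    · left
      have hjI : j ∈ I := Finset.mem_filter.2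
        ⟨hj, fun hca => hcm (hca.mono h.tame.a_le_m subset_rfl), Or.inl hcm⟩
      have hjG : j ∈ G := by
        by_contra hjG
        have : j ∈ B := Finset.mem_sdiff.2 ⟨hjI, hjG⟩
        rw [hBe] at this
        exact absurd this (Finset.notMem_empty _)
      exact ⟨pt j, (hptA j hjG).1, hvalid j hjG⟩

end Call

end Sample

/-! ### Existence of runs of the algorithms -/

/-- `E` belongs to `F` because nothing can be added to it, so there are feasible sets. They are
finitely many and can be minimised first in the criterion, then in cardinality. -/
theorem exists_isPrunOutput (sc : Finset ℕ → ℝ) (E : Finset ℕ) : ∃ A, IsPrunOutput sc E A := by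
  classical
  have hE : InF sc E E := ⟨subset_rfl, fun B B' hB hBB' hB' => by
    have h1 := subset_antisymm (hBB'.trans hB') hB
    have h2 := subset_antisymm hB' (hB.trans hBB')
    rw [h1, h2]⟩
  obtain ⟨A₀, hA₀, hc⟩ : mStar sc E ∈ {m | ∃ A, InF sc E A ∧ A.card = m} :=
    Nat.sInf_mem ⟨_, E, hE, rfl⟩
  have hfeas : Feasible sc E A₀ :=
    ⟨A₀, hA₀, hc.ge, by omega, subset_rfl, fun c h h' => absurd h h'⟩
  have hsub : ∀ B, Feasible sc E B → B ∈ E.powerset.filter (Feasible sc E) := by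
    rintro B ⟨A', h1, h2, h3, h4⟩
    exact Finset.mem_filter.2 ⟨Finset.mem_powerset.2 (h4.1.trans h1.1), A', h1, h2, h3, h4⟩
  obtain ⟨A₁, hA₁, hmin⟩ := Finset.exists_min_image _ sc ⟨A₀, hsub A₀ hfeas⟩
  obtain ⟨A₂, hA₂, hmin'⟩ := Finset.exists_min_image
    ((E.powerset.filter (Feasible sc E)).filter fun A => sc A = sc A₁) Finset.card
    ⟨A₁, Finset.mem_filter.2 ⟨hA₁, rfl⟩⟩
  obtain ⟨h1, h2⟩ := Finset.mem_filter.1 hA₂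
  refine ⟨A₂, (Finset.mem_filter.1 h1).2, fun B hB => ⟨?_, fun hBA => ?_⟩⟩
  · rw [h2]
    exact hmin B (hsub B hB)
  · exact hmin' B (Finset.mem_filter.2 ⟨hsub B hB, hBA.trans h2⟩)

/-- The points `0` and `n` make both end points exist, and `c₀` is always decided. The active set
shrinks strictly, which gives termination. -/
theorem exists_locStep (X : ℕ → ℝ) {n : ℕ} (ξ : ℝ) (dL dR : ℕ → ℕ) (h : ℕ → ℝ) {C : Finset ℕ}
    (K : Finset ℕ) (hC : Inside n C) (hne : C.Nonempty) :
    ∃ C' K', LocStep X n ξ dL dR h C K C' K' ∧ C' ⊂ C := by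
  classical
  obtain ⟨c₀, hc₀, hmax⟩ := Finset.exists_max_image C h hne
  obtain ⟨cL, hcL⟩ : ∃ cL, IsLeftEnd dL dR C K c₀ cL := by
    refine ⟨_, Nat.sSup_mem ⟨0, (hC c₀ hc₀).1, Or.inl (by simp)⟩ ⟨c₀, fun c hc => hc.1.le⟩,
      fun c hc => le_csSup ⟨c₀, fun c hc => hc.1.le⟩ hc⟩
  obtain ⟨cR, hcR⟩ : ∃ cR, IsRightEnd n dL dR C K c₀ cR :=
    ⟨_, Nat.sInf_mem ⟨n, (hC c₀ hc₀).2, Or.inl (by simp)⟩, fun c hc => Nat.sInf_le hc⟩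
  obtain ⟨A, hA⟩ := exists_isPrunOutput (localSC X n ξ C K cL cR) (between C cL cR)
  refine ⟨C.filter fun c => ¬ IsDecided n K (between C cL cR) A c₀ cL cR c, K ∪ A,
    ⟨c₀, cL, cR, A, hc₀, hmax, hcL, hcR, hA, rfl, fun c => by simp⟩, ?_⟩
  refine (Finset.ssubset_iff_of_subset (Finset.filter_subset _ _)).2 ⟨c₀, hc₀, fun hc => ?_⟩
  exact (Finset.mem_filter.1 hc).2 (Or.inl rfl)

theorem exists_locRun (X : ℕ → ℝ) {n : ℕ} (ξ : ℝ) (dL dR : ℕ → ℕ) (h : ℕ → ℝ) (C : Finset ℕ) :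
    ∀ K : Finset ℕ, Inside n C → ∃ R, LocRun X n ξ dL dR h C K R := by
  induction C using Finset.strongInduction with
  | H C ih =>
    intro K hC
    rcases C.eq_empty_or_nonempty with rfl | hne
    · exact ⟨K, LocRun.done K⟩
    · obtain ⟨C', K', hstep, hsub⟩ := exists_locStep X ξ dL dR h K hC hne
      obtain ⟨R, hR⟩ := ih C' hsub K' (hC.subset hsub.subset)
      exact ⟨R, LocRun.step C K C' K' R hstep hR⟩

/-! ### The invariant of the outer algorithm. -/

namespace Sample

variable {Z : Sample} {S : Scales} {C₀ : Finset ℕ} {chk : ℕ → ℕ}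

/-- The invariant of the outer algorithm for the active set `C` and the accepted set `K`. -/
structure State (Z : Sample) (S : Scales) (C₀ : Finset ℕ) (chk : ℕ → ℕ) (C K : Finset ℕ) :
    Prop where
  active_sub : C ⊆ C₀
  accepted_sub : K ⊆ C₀
  disjoint : Disjoint C K
  valid : ∀ c ∈ K, ∃ j, Z.Idx j ∧ Z.Near S.r₁ j c
  unique : ∀ j, Z.Idx j → ∀ c ∈ K, ∀ c' ∈ K, Z.Near S.r₁ j c → Z.Near S.r₁ j c' → c = c'
  avail : ∀ j, Z.Idx j → (∃ c ∈ K, Z.Near S.r₁ j c) ∨ chk j ∈ C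

/-- For the inner call, the accepted points and the active points outside `(cL, cR)` are fixed and
contribute a constant to the penalty. -/
theorem localSC_eq_crit (Z : Sample) (ξ : ℝ) (C K : Finset ℕ) (cL cR : ℕ) :
    localSC Z.obs Z.n ξ C K cL cR = Z.crit ξ (K ∪ (C \ between C cL cR))
      ((K.card : ℝ) + (C \ between C cL cR).card) := by
  funext A
  unfold localSC crit fit
  rw [Finset.union_assoc, add_assoc (A.card : ℝ)]

/-- A change point is at least its spacing away from `0` and `n`. Although `Cov` admits these two
points, they never cover anything at scale `m`. -/
theorem Tame.not_near_ends (h : Z.Tame S C₀) {j : ℕ} (hj : Z.Idx j) :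
    ¬ Z.Near S.m j 0 ∧ ¬ Z.Near S.m j Z.n := by
  have h1 := h.reg.spacing_le_ends hj
  have h2 : (spacing Z.k j : ℝ) ≤ Z.k j := by exact_mod_cast h1.1
  have h3 : (Z.k j : ℝ) + spacing Z.k j ≤ Z.n := by exact_mod_cast h1.2
  have hk : (0 : ℝ) < Z.k j := by exact_mod_cast (h.reg.k_inside hj).1
  have hk' : (Z.k j : ℝ) < Z.n := by exact_mod_cast (h.reg.k_inside hj).2
  constructor
  · intro hn
    have := (hn.mono h.m_le).abs_le h.reg h.sep hj
    rw [Nat.cast_zero, zero_sub, abs_neg, abs_of_pos hk] at this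
    linarith
  · intro hn
    have := (hn.mono h.m_le).abs_le h.reg h.sep hj
    rw [abs_of_pos (by linarith)] at this
    linarith

/-- Validity and uniqueness come from `Call.output`. The issue is whether `chk j` can be discarded
while `k_j` has no estimate. In that case some fixed point covers `k_j` at scale `m`, and by
convexity so does `cL` or `cR`, say `cL`. This point is neither `0` nor accepted, so the rule for
discarding candidates to the left of the output does not apply, and the whole output lies to the
right of `chk j`. There remains `chk j = c₀`; then `cL` has a detection interval disjoint from that
of `c₀`, which bounds `d_j² dL` by `m + r₀`, against `hd`. -/
theorem State.step (hT : Z.Tame S C₀) (hchk : ∀ j, Z.Idx j → Z.Near S.r₀ j (chk j))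
    {dL dR : ℕ → ℕ} (hd : ∀ j, Z.Idx j → S.m + S.r₀ < Z.d j ^ 2 * (dL (chk j) : ℝ) ∧
      S.m + S.r₀ < Z.d j ^ 2 * (dR (chk j) : ℝ))
    {h : ℕ → ℝ} {C K C' K' : Finset ℕ} (hs : Z.State S C₀ chk C K)
    (hstep : LocStep Z.obs Z.n S.ξ dL dR h C K C' K') : Z.State S C₀ chk C' K' := by
  classical
  obtain ⟨c₀, cL, cR, A, hc₀, -, hcL, hcR, hA, rfl, hC'⟩ := hstep
  set D := between C cL cR with hD
  have hmD : ∀ c, c ∈ D ↔ c ∈ C ∧ cL < c ∧ c < cR := fun c => by simp [hD, between]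
  have hLc : cL < c₀ := hcL.1.1
  have hcR' : c₀ < cR := hcR.1.1
  have hc₀D : c₀ ∈ D := (hmD _).2 ⟨hc₀, hLc, hcR'⟩
  have hc₀n := hT.inside c₀ (hs.active_sub hc₀)
  have hRn : cR ≤ Z.n := hcR.2 ⟨hc₀n.2, Or.inl (by simp)⟩
  -- The choice of `cL` and `cR` leaves no fixed point strictly between them, which is the
  -- separation required by `Call`.
  have hFsep : ∀ p ∈ insert 0 (insert Z.n (K ∪ (C \ D))), p ≤ cL ∨ cR ≤ p := by
    intro p hp
    simp only [Finset.mem_insert, Finset.mem_union] at hp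
    rcases hp with rfl | rfl | hp | hp
    · exact Or.inl (Nat.zero_le _)
    · exact Or.inr hRn
    · rcases lt_trichotomy p c₀ with h1 | h1 | h1
      · exact Or.inl (hcL.2 ⟨h1, Or.inl (by simp [hp])⟩)
      · exact absurd hp (Finset.disjoint_left.1 hs.disjoint (h1 ▸ hc₀))
      · exact Or.inr (hcR.2 ⟨h1, Or.inl (by simp [hp])⟩)
    · obtain ⟨hpC, hpD⟩ := Finset.mem_sdiff.1 hp
      by_contra! hcon
      exact hpD ((hmD p).2 ⟨hpC, hcon⟩)
  have hcall : Z.Call S C₀ (K ∪ (C \ D)) D chk := by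
    refine ⟨hT, Finset.union_subset hs.accepted_sub (Finset.sdiff_subset.trans hs.active_sub),
      fun c hc => hs.active_sub ((hmD c).1 hc).1, fun p hp => ?_, hchk, fun j hj => ?_⟩
    · rcases hFsep p hp with h1 | h1
      · exact Or.inl fun c hc => lt_of_le_of_lt h1 ((hmD c).1 hc).2.1
      · exact Or.inr fun c hc => lt_of_lt_of_le ((hmD c).1 hc).2.2 h1
    · rcases hs.avail j hj with ⟨c, hc, hn⟩ | hc
      · exact Or.inl ⟨c, Finset.mem_union_left _ hc, hn⟩
      · by_cases hcD : chk j ∈ D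
        · exact Or.inr hcD
        · exact Or.inl ⟨chk j, Finset.mem_union_right _ (Finset.mem_sdiff.2 ⟨hc, hcD⟩),
            (hchk j hj).mono hT.r₀_le⟩
  rw [localSC_eq_crit] at hA
  obtain ⟨hAD, hAv, hAu, hAc⟩ := hcall.output hA
  have hAC : A ⊆ C := fun c hc => ((hmD c).1 (hAD hc)).1
  refine ⟨fun c hc => hs.active_sub ((hC' c).1 hc).1,
    Finset.union_subset hs.accepted_sub (hAC.trans hs.active_sub), ?_, ?_, ?_, ?_⟩
  · refine Finset.disjoint_left.2 fun c hc hcKA => ?_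
    obtain ⟨hcC, hcd⟩ := (hC' c).1 hc
    rcases Finset.mem_union.1 hcKA with h1 | h1
    · exact Finset.disjoint_left.1 hs.disjoint hcC h1
    · exact hcd (Or.inr ⟨hAD h1, ⟨c, h1⟩, Or.inl ⟨⟨c, h1, le_rfl⟩, c, h1, le_rfl⟩⟩)
  · intro c hc
    rcases Finset.mem_union.1 hc with h1 | h1
    · exact hs.valid c h1
    · obtain ⟨j, hj, hn⟩ := hAv c h1
      exact ⟨j, (mem_todo.1 hj).1, hn⟩
  · have hmix : ∀ j, Z.Idx j → ∀ c ∈ A, Z.Near S.r₁ j c → j ∈ Z.todo S (K ∪ (C \ D)) := by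
      intro j hj c hc hn
      obtain ⟨i, hi, hn'⟩ := hAv c hc
      rwa [hT.unique hj (mem_todo.1 hi).1 (hn.mono hT.r₁_le_R) (hn'.mono hT.r₁_le_R)]
    intro j hj c hc c' hc' hn hn'
    rcases Finset.mem_union.1 hc with h1 | h1 <;> rcases Finset.mem_union.1 hc' with h2 | h2
    · exact hs.unique j hj c h1 c' h2 hn hn'
    · exact absurd ⟨c, Finset.mem_union_left _ h1, hn⟩ (mem_todo.1 (hmix j hj c' h2 hn')).2
    · exact absurd ⟨c', Finset.mem_union_left _ h2, hn'⟩ (mem_todo.1 (hmix j hj c h1 hn)).2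
    · exact hAu j (hmix j hj c h1 hn) c h1 c' h2 hn hn'
  · intro j hj
    by_cases hK : ∃ c ∈ K, Z.Near S.r₁ j c
    · obtain ⟨c, hc, hn⟩ := hK
      exact Or.inl ⟨c, Finset.mem_union_left _ hc, hn⟩
    by_cases hAj : ∃ c ∈ A, Z.Near S.r₁ j c
    · obtain ⟨c, hc, hn⟩ := hAj
      exact Or.inl ⟨c, Finset.mem_union_right _ hc, hn⟩
    right
    have hjC := (hs.avail j hj).resolve_left hK
    refine (hC' _).2 ⟨hjC, fun hdec => ?_⟩
    have hr₀m : S.r₀ ≤ S.m := hT.r₀_le.trans (hT.r₁_le_a.trans hT.a_le_m)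
    have hcm := (hchk j hj).mono hr₀m
    have hjD : chk j ∈ D := by
      rcases hdec with h1 | h1
      · rw [h1]; exact hc₀D
      · exact h1.1
    have hjD' := (hmD _).1 hjD
    obtain ⟨p, hp, hnp⟩ : Z.Cov S.m (K ∪ (C \ D)) j := by
      by_cases hjt : j ∈ Z.todo S (K ∪ (C \ D))
      · exact (hAc j hjt).resolve_left hAj
      · exact (hcall.cov_of_not_mem hj hjt).mono hT.a_le_m subset_rfl
    have hAfar : ∀ c ∈ A, ¬ Z.Near S.m j c := by
      intro c hc hn
      obtain ⟨i, hi, hn'⟩ := hAv c hc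
      have := hT.unique hj (mem_todo.1 hi).1 (hn.mono hT.m_le) (hn'.mono hT.r₁_le_R)
      exact hAj ⟨c, hc, this ▸ hn'⟩
    -- Accepted points are within `r₁` of their own change point, and by uniqueness this would have
    -- to be `k_j`.
    have hKfar : ∀ c ∈ K, ¬ Z.Near S.m j c := by
      intro c hc hn
      obtain ⟨i, hi, hn'⟩ := hs.valid c hc
      have := hT.unique hj hi (hn.mono hT.m_le) (hn'.mono hT.r₁_le_R)
      exact hK ⟨c, hc, this ▸ hn'⟩
    have hdist : ∀ u v : ℕ, u ≤ v → (Z.Near S.m j u ∧ Z.Near S.r₀ j v) ∨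
        (Z.Near S.r₀ j u ∧ Z.Near S.m j v) → Z.d j ^ 2 * ((v : ℝ) - u) ≤ S.m + S.r₀ := by
      intro u v _ hor
      have h0 := sq_nonneg (Z.d j)
      have h1 : (v : ℝ) - u ≤ |(u : ℝ) - Z.k j| + |(v : ℝ) - Z.k j| := by
        have a1 := neg_abs_le ((u : ℝ) - Z.k j)
        have a2 := le_abs_self ((v : ℝ) - Z.k j)
        linarith
      have h2 := mul_le_mul_of_nonneg_left h1 h0
      unfold Near at hor
      rcases hor with ⟨h3, h4⟩ | ⟨h3, h4⟩ <;> linarith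
    rcases hFsep p hp with hpL | hpR
    · have hnL : Z.Near S.m j cL := hnp.convex hcm hpL hjD'.2.1.le
      have hcL0 : cL ∉ insert 0 K := by
        intro hmem
        rcases Finset.mem_insert.1 hmem with h1 | h1
        · exact (hT.not_near_ends hj).1 (h1 ▸ hnL)
        · exact hKfar cL h1 hnL
      have hAright : ∀ c ∈ A, ¬ c ≤ chk j := fun c hc hle =>
        hAfar c hc (hnL.convex hcm ((hmD c).1 (hAD hc)).2.1.le hle)
      rcases hdec with h1 | ⟨-, ⟨a, ha⟩, h1 | h1 | h1⟩
      · have h2 := (hcL.1.2.resolve_left hcL0).2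
        have h3 : (cL : ℤ) + dL c₀ ≤ c₀ := by linarith [Int.natCast_nonneg (dR cL)]
        have h4 : (cL : ℝ) + dL c₀ ≤ c₀ := by exact_mod_cast h3
        have h5 := (hd j hj).1
        have h6 := hdist cL (chk j) hjD'.2.1.le (Or.inl ⟨hnL, hchk j hj⟩)
        rw [h1] at h5 h6
        have h7 : Z.d j ^ 2 * (dL c₀ : ℝ) ≤ Z.d j ^ 2 * ((c₀ : ℝ) - cL) := by
          gcongr
          linarith
        linarith
      · obtain ⟨⟨a, ha, hle⟩, -⟩ := h1
        exact hAright a ha hle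
      · exact hcL0 h1.1
      · exact hAright a ha (h1.2 a ha).le
    · have hnR : Z.Near S.m j cR := hcm.convex hnp hjD'.2.2.le hpR
      have hcR0 : cR ∉ insert Z.n K := by
        intro hmem
        rcases Finset.mem_insert.1 hmem with h1 | h1
        · exact (hT.not_near_ends hj).2 (h1 ▸ hnR)
        · exact hKfar cR h1 hnR
      have hAleft : ∀ c ∈ A, ¬ chk j ≤ c := fun c hc hle =>
        hAfar c hc (hcm.convex hnR hle ((hmD c).1 (hAD hc)).2.2.le)
      rcases hdec with h1 | ⟨-, ⟨a, ha⟩, h1 | h1 | h1⟩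
      · have h2 := (hcR.1.2.resolve_left hcR0).2
        have h3 : (c₀ : ℤ) + dR c₀ ≤ cR := by linarith [Int.natCast_nonneg (dL cR)]
        have h4 : (c₀ : ℝ) + dR c₀ ≤ cR := by exact_mod_cast h3
        have h5 := (hd j hj).2
        have h6 := hdist (chk j) cR hjD'.2.2.le (Or.inr ⟨hchk j hj, hnR⟩)
        rw [h1] at h5 h6
        have h7 : Z.d j ^ 2 * (dR c₀ : ℝ) ≤ Z.d j ^ 2 * ((cR : ℝ) - c₀) := by
          gcongr
          linarith
        linarith
      · obtain ⟨-, b, hb, hle⟩ := h1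
        exact hAleft b hb hle
      · exact hAleft a ha (h1.2 a ha).le
      · exact hcR0 h1.1

theorem State.run (hT : Z.Tame S C₀) (hchk : ∀ j, Z.Idx j → Z.Near S.r₀ j (chk j))
    {dL dR : ℕ → ℕ} (hd : ∀ j, Z.Idx j → S.m + S.r₀ < Z.d j ^ 2 * (dL (chk j) : ℝ) ∧
      S.m + S.r₀ < Z.d j ^ 2 * (dR (chk j) : ℝ))
    {h : ℕ → ℝ} {C K R : Finset ℕ} (hrun : LocRun Z.obs Z.n S.ξ dL dR h C K R)
    (hs : Z.State S C₀ chk C K) : Z.State S C₀ chk ∅ R := by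
  induction hrun with
  | done K => exact hs
  | step C K C' K' R hstep _ ih => exact ih (hs.step hT hchk hd hstep)

/-- When no active candidates are left, the accepted ones estimate the change points. -/
theorem State.final (hT : Z.Tame S C₀) {R : Finset ℕ} (hs : Z.State S C₀ chk ∅ R) :
    R.card = Z.q ∧ ∀ j, Z.Idx j → Z.Near S.r₁ j (estimator R j) := by
  classical
  have hex : ∀ j, Z.Idx j → ∃ c ∈ R, Z.Near S.r₁ j c := fun j hj =>
    (hs.avail j hj).resolve_right (Finset.notMem_empty _)
  choose! κ hκ using hex
  have hmono : ∀ i j, Z.Idx i → Z.Idx j → i < j → κ i < κ j := fun i j hi hj hij =>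
    ((hκ i hi).2.mono hT.r₁_le_R).lt hT.reg hT.sep hi hj hij ((hκ j hj).2.mono hT.r₁_le_R)
  have himg : R = (Finset.Icc 1 Z.q).image κ := by
    ext c
    simp only [Finset.mem_image, Finset.mem_Icc]
    constructor
    · intro hc
      obtain ⟨j, hj, hn⟩ := hs.valid c hc
      exact ⟨j, hj, hs.unique j hj _ (hκ j hj).1 _ hc (hκ j hj).2 hn⟩
    · rintro ⟨j, hj, rfl⟩
      exact (hκ j hj).1
  have hcard : R.card = Z.q := by
    rw [himg, Finset.card_image_of_injOn, Nat.card_Icc, Nat.add_sub_cancel]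
    intro i hi j hj hij
    have hi : Z.Idx i := Finset.mem_Icc.1 hi
    have hj : Z.Idx j := Finset.mem_Icc.1 hj
    rcases lt_trichotomy i j with h1 | h1 | h1
    · exact absurd hij (hmono i j hi hj h1).ne
    · exact h1
    · exact absurd hij (hmono j i hj hi h1).ne'
  refine ⟨hcard, fun j hj => ?_⟩
  have hidx : ∀ x : Fin Z.q, Z.Idx (x + 1) := fun x => ⟨by omega, by have := x.2; omega⟩
  -- The estimates increase with the change points, so they are the increasing enumeration of `R`.
  -- Change points are numbered from `1` and list entries from `0`.
  have huniq := Finset.orderEmbOfFin_unique hcard (f := fun x => κ (x + 1))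
    (fun x => (hκ _ (hidx x)).1) fun x y hxy => hmono _ _ (hidx x) (hidx y) (by
      have : (x : ℕ) < y := hxy
      omega)
  have hj1 : j - 1 < Z.q := by have := hj.1; have := hj.2; omega
  have h1 := congrFun huniq ⟨j - 1, hj1⟩
  simp only [Nat.sub_add_cancel hj.1] at h1
  have h2 : estimator R j = κ j := by
    rw [h1, Finset.orderEmbOfFin_apply]
    unfold estimator
    rw [List.getD_eq_getElem _ _ (by rw [Finset.length_sort, hcard]; exact hj1)]
    rfl
  rw [h2]
  exact (hκ j hj).2

/-- The deterministic part of the consistency of the outer algorithm. -/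
theorem Tame.locAlg (hT : Z.Tame S C₀) (hchk : ∀ j, Z.Idx j → chk j ∈ C₀ ∧ Z.Near S.r₀ j (chk j))
    {dL dR : ℕ → ℕ} (hd : ∀ j, Z.Idx j → S.m + S.r₀ < Z.d j ^ 2 * (dL (chk j) : ℝ) ∧
      S.m + S.r₀ < Z.d j ^ 2 * (dR (chk j) : ℝ))
    {h : ℕ → ℝ} {R : Finset ℕ} (hrun : IsLocAlgOutput Z.obs Z.n S.ξ dL dR h C₀ R) :
    R.card = Z.q ∧ ∀ j, Z.Idx j → Z.Near S.r₁ j (estimator R j) :=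
  (State.run hT (fun j hj => (hchk j hj).2) hd hrun
    ⟨subset_rfl, Finset.empty_subset _, Finset.disjoint_empty_right _, by simp, by simp,
      fun j hj => Or.inr (hchk j hj).1⟩).final hT

end Sample

/-! ### Residual sums of squares of order `n`, and the choice of the scales. -/

namespace Sample

variable {Z : Sample}

/-- The set of change points. -/
def kset (Z : Sample) : Finset ℕ := (Finset.Icc 1 Z.q).image Z.k

theorem Regular.kset_inside (hZ : Z.Regular) : Inside Z.n Z.kset := by
  intro p hp
  obtain ⟨j, hj, rfl⟩ := Finset.mem_image.1 hp
  exact hZ.k_inside (Finset.mem_Icc.1 hj)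

theorem card_kset_le (Z : Sample) : Z.kset.card ≤ Z.q := by
  refine Finset.card_image_le.trans ?_
  simp

/-- Once all true change points are included, the signal is constant on every segment and only noise
is fitted. -/
theorem rss_union_kset (hZ : Z.Regular) {P : Finset ℕ} (hP : Inside Z.n P) :
    rss Z.obs Z.n (P ∪ Z.kset) = ∑ t ∈ Finset.Ioc 0 Z.n, Z.ε t ^ 2
      - segSum (fun a b => psum Z.ε a b ^ 2 / ((b : ℝ) - a)) Z.n (P ∪ Z.kset) := by
  refine rss_of_signal_const _ _ hZ.n_pos (hP.union hZ.kset_inside) fun s e hg =>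
    ⟨Z.f₀ + ∑ j ∈ Finset.Icc 1 Z.q, Z.d j * step (Z.k j) e, fun t ht => ?_⟩
  obtain ⟨h1, h2⟩ := Finset.mem_Ioc.1 ht
  rw [obs_eq]
  congr 2
  refine Finset.sum_congr rfl fun j hj => ?_
  congr 1
  rcases hg.2.2.2 (Z.k j) (Finset.mem_union_right _ (Finset.mem_image_of_mem _ hj)) with h | h
  · rw [step, step, if_pos (by omega), if_pos (by omega)]
  · rw [step, step, if_neg (by omega), if_neg (by omega)]

theorem segSum_noise_nonneg (ε : ℕ → ℝ) {n : ℕ} (hn : 0 < n) {P : Finset ℕ} (hP : Inside n P) :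
    0 ≤ segSum (fun a b => psum ε a b ^ 2 / ((b : ℝ) - a)) n P := by
  refine Finset.sum_nonneg fun a ha => ?_
  have han : a < n := by
    rcases Finset.mem_insert.1 ha with rfl | h
    · exact hn
    · exact (hP a h).2
  have : (a : ℝ) < nextPoint n P a := by exact_mod_cast (isGap_nextPoint ha han).2.2.1
  exact div_nonneg (sq_nonneg _) (by linarith)

/-- Each of the at most `|P| + 1` segments explains at most `ω²` of the noise energy. -/
theorem SumBound.segSum_le {ω : ℝ} (h : Z.SumBound ω) (hn : 0 < Z.n) {P : Finset ℕ}
    (hP : Inside Z.n P) :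
    segSum (fun a b => psum Z.ε a b ^ 2 / ((b : ℝ) - a)) Z.n P ≤ ((P.card : ℝ) + 1) * ω ^ 2 := by
  have h1 : ((insert 0 P).card : ℝ) ≤ P.card + 1 := by exact_mod_cast Finset.card_insert_le _ _
  refine (Finset.sum_le_card_nsmul _ _ (ω ^ 2) fun a ha => ?_).trans ?_
  · have han : a < Z.n := by
      rcases Finset.mem_insert.1 ha with rfl | h
      · exact hn
      · exact (hP a h).2
    have hg := isGap_nextPoint ha han
    have : (a : ℝ) < nextPoint Z.n P a := by exact_mod_cast hg.2.2.1
    rw [div_le_iff₀ (by linarith)]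
    exact h _ _ hg.2.2.1 (hg.le hP)
  · rw [nsmul_eq_mul]
    gcongr

/-- Adding the true change points can only lower the left-over; what remains is the noise energy
minus what the segments explain. -/
theorem le_rss (hZ : Z.Regular) {ω : ℝ} (h : Z.SumBound ω) {P : Finset ℕ} (hP : Inside Z.n P) :
    ∑ t ∈ Finset.Ioc 0 Z.n, Z.ε t ^ 2 - ((P.card : ℝ) + Z.q + 1) * ω ^ 2 ≤ rss Z.obs Z.n P := by
  have hi := hP.union hZ.kset_inside
  refine le_trans ?_ (rss_anti _ hi Finset.subset_union_left)
  rw [rss_union_kset hZ hP]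
  have h1 := h.segSum_le hZ.n_pos hi
  have h2 : ((P ∪ Z.kset).card : ℝ) ≤ P.card + Z.q := by
    exact_mod_cast (Finset.card_union_le _ _).trans (Nat.add_le_add_left Z.card_kset_le _)
  have h3 : ((P ∪ Z.kset).card + 1 : ℝ) * ω ^ 2 ≤ ((P.card : ℝ) + Z.q + 1) * ω ^ 2 := by
    gcongr
  linarith

/-- Insert the true change points one by one. All are covered at scale `R`, so each insertion saves
at most `9 R` by `rss_le_of_cov`, used with only its first alternative. -/
theorem rss_le (hZ : Z.Regular) {ω R : ℝ} (h : Z.SumBound ω) (hωR : 2 * ω ^ 2 ≤ R)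
    (hR : Z.Sep R) (hR0 : 0 < R) {P : Finset ℕ} (hP : Inside Z.n P)
    (hcov : ∀ i, Z.Idx i → Z.Cov R P i) :
    rss Z.obs Z.n P ≤ ∑ t ∈ Finset.Ioc 0 Z.n, Z.ε t ^ 2 + Z.q * (9 * R) := by
  have key : ∀ T : Finset ℕ, T ⊆ Z.kset →
      rss Z.obs Z.n P ≤ rss Z.obs Z.n (P ∪ T) + T.card * (9 * R) := by
    intro T
    induction T using Finset.induction_on with
    | empty => intro _; simp
    | insert c T hc ih =>
      intro hT
      have hT' : T ⊆ Z.kset := (Finset.subset_insert c T).trans hT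
      have hck := hZ.kset_inside c (hT (by simp))
      have h1 := rss_le_of_cov hZ h hωR le_rfl hR0.le hR hR0 (r' := 0)
        (by rw [zero_pow two_ne_zero]; exact mul_nonneg hR0.le hR0.le)
        (hP.union (hZ.kset_inside.subset hT')) hck.1 hck.2
        fun i hi => Or.inl ((hcov i hi).mono le_rfl Finset.subset_union_left)
      have h2 := ih hT'
      rw [Finset.card_insert_of_notMem hc, Finset.union_insert]
      push_cast
      linarith
  have h1 := key Z.kset subset_rfl
  rw [rss_union_kset hZ hP] at h1
  have h2 := segSum_noise_nonneg Z.ε hZ.n_pos (hP.union hZ.kset_inside)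
  have h3 : (Z.kset.card : ℝ) * (9 * R) ≤ Z.q * (9 * R) := by
    have : (Z.kset.card : ℝ) ≤ Z.q := by exact_mod_cast Z.card_kset_le
    gcongr
  linarith

/-- The spacing is at most `k_j - k_{j-1}`, and these differences telescope. -/
theorem Regular.sum_spacing_le (hZ : Z.Regular) :
    ∑ j ∈ Finset.Icc 1 Z.q, (spacing Z.k j : ℝ) ≤ Z.n := by
  have key : ∀ m, m ≤ Z.q → ∑ j ∈ Finset.Icc 1 m, spacing Z.k j ≤ Z.k m := by
    intro m
    induction m with
    | zero => intro _; simp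
    | succ m ih =>
      intro hm
      rw [Finset.sum_Icc_succ_top (by omega)]
      have h1 := ih (by omega)
      have h2 : spacing Z.k (m + 1) ≤ Z.k (m + 1) - Z.k m := min_le_left _ _
      have h3 := hZ.k_lt m (by omega)
      omega
  have h1 := key Z.q le_rfl
  have h2 := hZ.k_lt Z.q le_rfl
  rw [hZ.k_last] at h2
  exact_mod_cast h1.trans h2.le

/-- Bounds on the number of change points and on the penalty. -/
theorem Regular.q_mul_le (hZ : Z.Regular) {ξ κ Cd : ℝ} (hκ : 0 ≤ κ)
    (hd : ∀ j, Z.Idx j → |Z.d j| ≤ Cd)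
    (hξ : ∀ j, Z.Idx j → ξ ≤ κ * (Z.d j ^ 2 * (spacing Z.k j : ℝ))) :
    Z.q * ξ ≤ κ * Cd ^ 2 * Z.n := by
  have h1 : ∑ _j ∈ Finset.Icc 1 Z.q, ξ ≤
      ∑ j ∈ Finset.Icc 1 Z.q, κ * Cd ^ 2 * (spacing Z.k j : ℝ) := by
    refine Finset.sum_le_sum fun j hj => ?_
    have hj : Z.Idx j := Finset.mem_Icc.1 hj
    refine (hξ j hj).trans ?_
    rw [mul_assoc]
    gcongr κ * (?_ * _)
    exact sq_le_sq' (by linarith [neg_abs_le (Z.d j), hd j hj])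
      ((le_abs_self _).trans (hd j hj))
  rw [Finset.sum_const, nsmul_eq_mul, ← Finset.mul_sum, Nat.card_Icc, Nat.add_sub_cancel] at h1
  refine h1.trans ?_
  have := hZ.sum_spacing_le
  gcongr

/-- Uses `log t ≤ t - 1` at `t = x / y`; only the smaller sum `y` must be bounded below by a
multiple of `n`. -/
theorem fit_sub_le {n : ℕ} (hn : 0 < n) {x y c b : ℝ} (hc : 0 < c) (hy : c * n ≤ y) (hx : 0 < x)
    (hb : 0 ≤ b) (hxy : x ≤ y + b) :
    (n : ℝ) / 2 * Real.log (x / n) ≤ (n : ℝ) / 2 * Real.log (y / n) + b / (2 * c) := by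
  have hn' : (0 : ℝ) < n := by exact_mod_cast hn
  have hy0 : 0 < y := lt_of_lt_of_le (by positivity) hy
  have h1 : Real.log (x / n) - Real.log (y / n) ≤ b / (c * n) := by
    rw [Real.log_div hx.ne' hn'.ne', Real.log_div hy0.ne' hn'.ne', sub_sub_sub_cancel_right,
      ← Real.log_div hx.ne' hy0.ne']
    refine (Real.log_le_sub_one_of_pos (by positivity)).trans ?_
    have h2 : x / y - 1 ≤ b / y := by
      rw [div_sub_one hy0.ne']
      gcongr
      linarith
    refine h2.trans ?_
    gcongr
  have h3 : (n : ℝ) / 2 * (b / (c * n)) = b / (2 * c) := by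
    field_simp
  have h4 := mul_le_mul_of_nonneg_left h1 (by positivity : 0 ≤ (n : ℝ) / 2)
  rw [h3] at h4
  linarith

/-- Uses `log t ≥ 1 - 1 / t`, which increases in `x`; at `x = y + b` it equals `b / (y + b)` with a
denominator of at most `2 c n`. -/
theorem fit_sub_ge {n : ℕ} (hn : 0 < n) {x y c b : ℝ} (hc : 0 < c) (hy0 : 0 < y) (hy : y ≤ c * n)
    (hb : 0 ≤ b) (hbn : b ≤ c * n) (hxy : y + b ≤ x) :
    (n : ℝ) / 2 * Real.log (y / n) + b / (4 * c) ≤ (n : ℝ) / 2 * Real.log (x / n) := by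
  have hn' : (0 : ℝ) < n := by exact_mod_cast hn
  have hx : 0 < x := by linarith
  have h1 : b / (2 * c * n) ≤ Real.log (x / n) - Real.log (y / n) := by
    rw [Real.log_div hx.ne' hn'.ne', Real.log_div hy0.ne' hn'.ne', sub_sub_sub_cancel_right,
      ← Real.log_div hx.ne' hy0.ne']
    refine le_trans ?_ (Real.one_sub_inv_le_log_of_pos (by positivity))
    rw [inv_div, one_sub_div hx.ne', div_le_div_iff₀ (by positivity) hx]
    have h2 : b * (y + b) ≤ b * (2 * c * n) := by
      gcongr
      linarith
    have h3 : 0 ≤ 2 * c * n - b := by nlinarith [mul_pos hc hn']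
    nlinarith
  have h3 : (n : ℝ) / 2 * (b / (2 * c * n)) = b / (4 * c) := by
    field_simp
    ring
  have h4 := mul_le_mul_of_nonneg_left h1 (by positivity : 0 ≤ (n : ℝ) / 2)
  rw [h3] at h4
  linarith

theorem LocalBound.mono {r₀ r₁ θ θ' : ℝ} (h : Z.LocalBound r₀ r₁ θ) (hθ : θ ≤ θ') :
    Z.LocalBound r₀ r₁ θ' := by
  refine ⟨fun j hj s hs hs' hr => (h.left j hj s hs hs' hr).trans ?_,
    fun j hj e he he' hr => (h.right j hj e he he' hr).trans ?_, h.left_near, h.right_near⟩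
  · have : (s : ℝ) ≤ Z.k j := by exact_mod_cast hs
    have : 0 ≤ (Z.k j : ℝ) - s := by linarith
    gcongr
  · have : (Z.k j : ℝ) ≤ e := by exact_mod_cast he
    have : 0 ≤ (e : ℝ) - Z.k j := by linarith
    gcongr

set_option maxHeartbeats 1000000 in
/-- Realisations for which the noise level, the localisation rates, the penalty and the sizes of
the changes are of different orders of magnitude are tame. -/
theorem exists_tame {cv Cv Cd : ℝ} (hcv : 0 < cv) (hcC : cv ≤ Cv) (hCd : 0 < Cd) :
    ∃ κ : ℝ, 0 < κ ∧ ∀ (Z : Sample) (C₀ : Finset ℕ) (ω ξ r₀ r₁ : ℝ), Z.Regular → Z.SumBound ω →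
      Z.LocalBound r₀ r₁ κ → Inside Z.n C₀ → 0 < ξ → (∀ j, Z.Idx j → |Z.d j| ≤ Cd) →
      2 * cv * Z.n ≤ ∑ t ∈ Finset.Ioc 0 Z.n, Z.ε t ^ 2 →
      2 * ∑ t ∈ Finset.Ioc 0 Z.n, Z.ε t ^ 2 ≤ Cv * Z.n →
      ((C₀.card : ℝ) + Z.q + 1) * ω ^ 2 ≤ cv * Z.n →
      ω ^ 2 ≤ κ * ξ → (∀ j, Z.Idx j → ξ ≤ κ * (Z.d j ^ 2 * (spacing Z.k j : ℝ))) →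
      0 ≤ r₁ → r₁ ≤ κ * ξ → r₀ ≤ κ * r₁ →
      ∃ S : Scales, S.ξ = ξ ∧ S.r₀ = r₀ ∧ S.r₁ = r₁ ∧ S.m = 256 * Cv * ξ ∧ Z.Tame S C₀ := by
  have hCv : 0 < Cv := by linarith
  -- The scales are `a ξ`, `256 Cv ξ` and `ρ ξ`. The constants turn a gain of `9 a ξ` into `ξ / 4`
  -- in `fit_sub_le` and a gain of `256 Cv ξ / 16` into `4 ξ` in `fit_sub_ge`, and `ρ` makes `m² = a
  -- R` an equality.
  set a := cv / 18 with ha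
  set ρ := (256 * Cv) ^ 2 / a with hρ
  have ha0 : 0 < a := by positivity
  have hρ0 : 0 < ρ := by positivity
  set β := a / (a + ρ) with hβ
  have hβ0 : 0 < β := by positivity
  set θ := β / 48 with hθ
  have hθ0 : 0 < θ := by positivity
  -- All requirements on `κ` are upper bounds by positive constants, so they hold simultaneously for
  -- small positive `κ`.
  have hev : ∀ c : ℝ, 0 < c → ∀ᶠ κ in 𝓝[>] (0 : ℝ), κ ≤ c := fun c hc =>
    (eventually_le_nhds hc).filter_mono nhdsWithin_le_nhds
  have hpos : ∀ᶠ κ in 𝓝[>] (0 : ℝ), 0 < κ := eventually_mem_nhdsWithin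
  obtain ⟨κ, hκ0, h1, h2, h3, h4, h5, h6, h7, h8, h9, h10, h11⟩ :=
    (hpos.and <| (hev θ hθ0).and <| (hev (θ ^ 2 * a) (by positivity)).and <|
      (hev (a / 2) (by positivity)).and <| (hev (1 / (8 * ρ)) (by positivity)).and <|
      (hev (θ / (2 * ρ)) (by positivity)).and <| (hev (a / (2 * ρ ^ 2)) (by positivity)).and <|
      (hev (a / 4) (by positivity)).and <| (hev (β / 24) (by positivity)).and <|
      (hev 1 one_pos).and <| (hev (Cv / (18 * ρ * Cd ^ 2)) (by positivity)).and
        (hev (1 / (16 * Cd ^ 2)) (by positivity))).exists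
  rw [le_div_iff₀ (by positivity)] at h4 h5 h6 h10 h11
  refine ⟨κ, hκ0, fun Z C₀ ω ξ r₀ r₁ hZ hω hL hC₀ hξ hd hE1 hE2 hcount hωξ hξδ hr₁0 hr₁ hr₀ => ?_⟩
  have hn' : (0 : ℝ) < Z.n := by exact_mod_cast hZ.n_pos
  have hm0 : 256 * Cv ≤ ρ := by
    rw [hρ, le_div_iff₀ ha0]
    nlinarith
  have haR : a * ξ / (a * ξ + ρ * ξ) = β := by
    rw [hβ]
    field_simp
  have hδ0 : ∀ j, 0 ≤ Z.d j ^ 2 * (spacing Z.k j : ℝ) := fun j => by positivity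
  have hsep : Z.Sep (ρ * ξ) := by
    intro j hj
    have e1 : 8 * ρ * ξ ≤ 8 * ρ * (κ * (Z.d j ^ 2 * (spacing Z.k j : ℝ))) := by
      have := hξδ j hj
      gcongr
    have e2 := mul_le_mul_of_nonneg_right h4 (hδ0 j)
    linarith
  have hlow : ∀ P ⊆ C₀, cv * Z.n ≤ rss Z.obs Z.n P := by
    intro P hP
    have e1 := le_rss hZ hω (hC₀.subset hP)
    have e2 : (P.card : ℝ) ≤ C₀.card := by exact_mod_cast Finset.card_le_card hP
    have e3 : ((P.card : ℝ) + Z.q + 1) * ω ^ 2 ≤ ((C₀.card : ℝ) + Z.q + 1) * ω ^ 2 := by gcongr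
    linarith
  have hpos : ∀ P ⊆ C₀, 0 < rss Z.obs Z.n P := fun P hP =>
    lt_of_lt_of_le (by positivity) (hlow P hP)
  have hωa : 2 * ω ^ 2 ≤ a * ξ := by
    have := mul_le_mul_of_nonneg_right h3 hξ.le
    linarith
  -- Half of `Cv n` is for the noise energy, the other half for the `q` insertions at `9 ρ ξ` each;
  -- `q ξ` is a small multiple of `n`.
  have hup : ∀ P ⊆ C₀, (∀ i, Z.Idx i → Z.Cov (ρ * ξ) P i) → rss Z.obs Z.n P ≤ Cv * Z.n := by
    intro P hP hcov
    have haρ : a ≤ ρ := by nlinarith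
    have e1 := rss_le hZ hω (hωa.trans (by gcongr)) hsep (by positivity) (hC₀.subset hP) hcov
    have e2 := hZ.q_mul_le hκ0.le hd hξδ
    have e3 : 9 * ρ * (Z.q * ξ) ≤ 9 * ρ * (κ * Cd ^ 2 * Z.n) := by gcongr
    have e4 := mul_le_mul_of_nonneg_right h10 hn'.le
    linarith
  refine ⟨⟨ω, ξ, r₀, r₁, a * ξ, 256 * Cv * ξ, ρ * ξ, θ⟩, rfl, rfl, rfl, rfl, ?_⟩
  refine
    { reg := hZ
      sumBound := hω
      localBound := hL.mono h1
      sep := hsep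
      inside := hC₀
      ξ_pos := hξ
      θ_nonneg := hθ0.le
      a_pos := by positivity
      a_le := ?_
      m_le := by dsimp only; gcongr
      m_sq_le := ?_
      r₀_le := ?_
      r₁_le := ?_
      r₀_mul_le := ?_
      ω_le := hωa
      ω_le' := ?_
      θ_le := ?_
      R_le := ?_
      R_sq_le := ?_
      rss_pos := hpos
      fit_le := ?_
      le_fit := ?_ } <;> dsimp only
  · have : 144 * a ≤ 256 * Cv := by rw [ha]; linarith
    nlinarith
  · rw [hρ]
    apply le_of_eq
    field_simp
  · have := mul_le_mul_of_nonneg_right h9 hr₁0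
    linarith
  · have := mul_le_mul_of_nonneg_right h7 hξ.le
    linarith
  · rw [haR]
    have := mul_le_mul_of_nonneg_right h8 hr₁0
    linarith
  · have := mul_le_mul_of_nonneg_right h2 hξ.le
    linarith
  · rw [haR]
    linarith
  · intro i hi
    have e1 : 2 * ρ * ξ ≤ 2 * ρ * (κ * (Z.d i ^ 2 * (spacing Z.k i : ℝ))) := by
      have := hξδ i hi
      gcongr
    have e2 := mul_le_mul_of_nonneg_right h5 (hδ0 i)
    linarith
  · intro i hi
    have e1 : 2 * ρ ^ 2 * ξ * ξ ≤ 2 * ρ ^ 2 * ξ * (κ * (Z.d i ^ 2 * (spacing Z.k i : ℝ))) := by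
      have := hξδ i hi
      gcongr
    have e2 := mul_le_mul_of_nonneg_right h6 (mul_nonneg hξ.le (hδ0 i))
    linarith
  · intro P hP Q hQ hPQ
    have := fit_sub_le hZ.n_pos hcv (hlow Q hQ) (hpos P hP) (b := 9 * (a * ξ)) (by positivity) hPQ
    unfold fit
    have e : 9 * (a * ξ) / (2 * cv) = ξ / 4 := by
      rw [ha]
      field_simp
      ring
    rwa [e] at this
  · rintro P hP Q hQ ⟨j, hj⟩ hcov hPQ
    -- The existence of a change point gives `q ≥ 1`, so the bound on `q ξ` is one on `ξ` itself:
    -- `16 ξ ≤ n`.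
    have hbn : 256 * Cv * ξ / 16 ≤ Cv * Z.n := by
      have e0 := hZ.q_mul_le hκ0.le hd hξδ
      have e1 : (1 : ℝ) ≤ Z.q := by exact_mod_cast hj.1.trans hj.2
      have e2 := mul_le_mul_of_nonneg_right h11 hn'.le
      have e3 : 16 * ξ ≤ Z.n := by nlinarith
      have e4 := mul_le_mul_of_nonneg_left e3 hCv.le
      linarith
    have := fit_sub_ge hZ.n_pos hCv (hpos Q hQ) (hup Q hQ hcov) (by positivity) hbn hPQ
    unfold fit
    have e : 256 * Cv * ξ / 16 / (4 * Cv) = 4 * ξ := by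
      field_simp
      ring
    rwa [e] at this

end Sample

/-! ### The number of multiscale MOSUM candidates -/

theorem mosumCand_inside {X : ℕ → ℝ} {n : ℕ} {η θ : ℝ} {G : ℕ × ℕ} (h1 : 0 < G.1) (h2 : 0 < G.2) :
    Inside n (mosumCand X n η θ G) := by
  intro c hc
  have := Finset.mem_Icc.1 (Finset.mem_filter.1 hc).1
  omega

/-- Two closer candidates would lie in each other's windows: the left one has the larger or equal
detector value, while the leftmost rule makes the right one strictly larger. -/
theorem mosumCand_separated {X : ℕ → ℝ} {n : ℕ} {η θ : ℝ} {G : ℕ × ℕ} {c c' : ℕ}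
    (hc : c ∈ mosumCand X n η θ G) (hc' : c' ∈ mosumCand X n η θ G) (hlt : c < c') {L : ℕ}
    (h1 : L ≤ ⌊η * G.1⌋₊) (h2 : L ≤ ⌊η * G.2⌋₊) : c + L < c' := by
  by_contra! hcon
  obtain ⟨hm, -, hc⟩ := Finset.mem_filter.1 hc
  obtain ⟨hm', -, hc'⟩ := Finset.mem_filter.1 hc'
  have a1 := (hc c' hm' (by omega) (by omega)).1
  have a2 := (hc' c hm (by omega) (by omega)).2 hlt
  linarith

/-- Each block of length `⌊η g⌋ + 1` contains at most one candidate. The extra incomplete block is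
absorbed by the factor `2`, since `η g ≤ n` as soon as there is a candidate. -/
theorem card_mosumCand_le (X : ℕ → ℝ) (n : ℕ) {η : ℝ} (hη : 0 < η) (hη1 : η < 1) (θ : ℝ)
    {G : ℕ × ℕ} (h1 : 0 < G.1) (h2 : 0 < G.2) :
    ((mosumCand X n η θ G).card : ℝ) ≤ 2 * n / (η * (min G.1 G.2 : ℕ)) := by
  set g := min G.1 G.2 with hg
  have hg0 : 0 < g := lt_min h1 h2
  have hg0' : (0 : ℝ) < g := by exact_mod_cast hg0
  set L := ⌊η * g⌋₊ + 1 with hL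
  have hLg : η * g ≤ L := by
    rw [hL]
    push_cast
    exact (Nat.lt_floor_add_one _).le
  have hL1 : ⌊η * g⌋₊ ≤ ⌊η * G.1⌋₊ := by
    have : (g : ℝ) ≤ G.1 := by exact_mod_cast min_le_left _ _
    gcongr
  have hL2 : ⌊η * g⌋₊ ≤ ⌊η * G.2⌋₊ := by
    have : (g : ℝ) ≤ G.2 := by exact_mod_cast min_le_right _ _
    gcongr
  rcases (mosumCand X n η θ G).eq_empty_or_nonempty with h0 | ⟨c₁, hc₁⟩
  · rw [h0, Finset.card_empty, Nat.cast_zero]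
    positivity
  have hgn : (g : ℝ) ≤ n := by
    have hm := Finset.mem_Icc.1 (Finset.mem_filter.1 hc₁).1
    have : g ≤ G.1 := min_le_left _ _
    have : g ≤ n := by omega
    exact_mod_cast this
  have hstep : ∀ c ∈ mosumCand X n η θ G, ∀ c' ∈ mosumCand X n η θ G, c < c' →
      c / L < c' / L := by
    intro c hc c' hc' hlt
    have := mosumCand_separated hc hc' hlt hL1 hL2
    have h3 : c / L + 1 ≤ c' / L := by
      rw [← Nat.add_div_right c (by omega : 0 < L)]
      exact Nat.div_le_div_right (by omega)
    omega
  have hcard := Finset.card_le_card_of_injOn (s := mosumCand X n η θ G)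
    (t := Finset.range (n / L + 1)) (fun c => c / L) (fun c hc => by
      have hm := Finset.mem_Icc.1 (Finset.mem_filter.1 hc).1
      have : c / L ≤ n / L := Nat.div_le_div_right (by omega)
      simpa using Nat.lt_succ_of_le this) (fun c hc c' hc' heq => by
      rcases lt_trichotomy c c' with h | h | h
      · exact absurd heq (hstep c hc c' hc' h).ne
      · exact h
      · exact absurd heq (hstep c' hc' c hc h).ne')
  rw [Finset.card_range] at hcard
  have h3 : ((mosumCand X n η θ G).card : ℝ) ≤ (n / L : ℕ) + 1 := by exact_mod_cast hcard
  have h4 : ((n / L : ℕ) : ℝ) ≤ n / L := Nat.cast_div_le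
  have h5 : (n : ℝ) / L ≤ n / (η * g) := by gcongr
  have h6 : 1 ≤ (n : ℝ) / (η * g) := by
    rw [le_div_iff₀ (by positivity)]
    nlinarith
  rw [mul_div_assoc]
  linarith

/-- Fibonacci growth beats the ratio `3 / 2` because `(3/2)² ≤ 3/2 + 1`. -/
theorem pow_le_fib (m : ℕ) : (3 / 2 : ℝ) ^ m ≤ Nat.fib (m + 2) := by
  induction m using Nat.twoStepInduction with
  | zero => simp
  | one => norm_num [Nat.fib_add_two]
  | more m h1 h2 =>
    rw [Nat.fib_add_two (n := m + 2)]
    push_cast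
    have e1 : (3 / 2 : ℝ) ^ (m + 2) = 9 / 4 * (3 / 2) ^ m := by ring
    have e2 : (3 / 2 : ℝ) ^ (m + 1) = 3 / 2 * (3 / 2) ^ m := by ring
    have e3 : (0 : ℝ) < (3 / 2) ^ m := by positivity
    rw [e2] at h2
    rw [e1]
    have h2' : 3 / 2 * (3 / 2 : ℝ) ^ m ≤ Nat.fib (m + 2 + 1) := h2
    linarith

/-- The number of candidates is of the order `n / G₀`. -/
theorem exists_card_multiscaleCand_le {η Casym : ℝ} (hη : 0 < η) (hη1 : η < 1) :
    ∃ K : ℝ, 0 < K ∧ ∀ (X : ℕ → ℝ) (n G₀ : ℕ) (θ : ℕ × ℕ → ℝ) (H : Finset (ℕ × ℕ)), 0 < G₀ →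
      (∀ G ∈ H, G.1 ∈ bandwidths G₀ n ∧ G.2 ∈ bandwidths G₀ n) →
      (∀ G ∈ H, (max G.1 G.2 : ℝ) / (min G.1 G.2 : ℝ) ≤ Casym) →
      ((multiscaleCand X n η θ H).card : ℝ) ≤ K * (n / G₀) := by
  have hsum : Summable fun x : ℕ × ℕ => (9 / 10 : ℝ) ^ x.1 * (9 / 10 : ℝ) ^ x.2 :=
    (summable_geometric_of_lt_one (by norm_num) (by norm_num)).mul_of_nonneg
      (summable_geometric_of_lt_one (by norm_num) (by norm_num)) (fun _ => by positivity)
      (fun _ => by positivity)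
  set T := ∑' x : ℕ × ℕ, (9 / 10 : ℝ) ^ x.1 * (9 / 10 : ℝ) ^ x.2 with hT
  have hT0 : 0 ≤ T := tsum_nonneg fun _ => by positivity
  refine ⟨2 * |Casym| / η * T + 1, by positivity, fun X n G₀ θ H hG₀ hmem hbal => ?_⟩
  have hG₀' : (0 : ℝ) < G₀ := by exact_mod_cast hG₀
  have hex : ∀ G ∈ H, ∃ p : ℕ × ℕ, G.1 = Nat.fib (p.1 + 2) * G₀ ∧ G.2 = Nat.fib (p.2 + 2) * G₀ := by
    intro G hG
    obtain ⟨⟨m, hm, h1, -⟩, ⟨m', hm', h2, -⟩⟩ := hmem G hG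
    -- The index is shifted so that it starts at `0`: `m ≥ 1` and `fib (m + 1) = fib ((m - 1) + 2)`.
    exact ⟨(m - 1, m' - 1), by rw [h1]; congr 2; simp; omega, by rw [h2]; congr 2; simp; omega⟩
  choose! φ hφ using hex
  have hpos : ∀ G ∈ H, 0 < G.1 ∧ 0 < G.2 := by
    intro G hG
    obtain ⟨h1, h2⟩ := hφ G hG
    rw [h1, h2]
    have f1 : 0 < Nat.fib ((φ G).1 + 2) := Nat.fib_pos.2 (by omega)
    have f2 : 0 < Nat.fib ((φ G).2 + 2) := Nat.fib_pos.2 (by omega)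
    exact ⟨Nat.mul_pos f1 hG₀, Nat.mul_pos f2 hG₀⟩
  have hterm : ∀ G ∈ H, ((mosumCand X n η (θ G) G).card : ℝ) ≤
      2 * |Casym| / η * (n / G₀) * ((9 / 10 : ℝ) ^ (φ G).1 * (9 / 10 : ℝ) ^ (φ G).2) := by
    intro G hG
    obtain ⟨p1, p2⟩ := hpos G hG
    obtain ⟨e1, e2⟩ := hφ G hG
    have p1' : (0 : ℝ) < G.1 := by exact_mod_cast p1
    have p2' : (0 : ℝ) < G.2 := by exact_mod_cast p2
    refine (card_mosumCand_le X n hη hη1 (θ G) p1 p2).trans ?_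
    have hmin : (0 : ℝ) < min (G.1 : ℝ) G.2 := lt_min p1' p2'
    -- By balancedness the larger bandwidth may replace the smaller one in the candidate count; its
    -- exponential growth makes the sum over all pairs converge.
    have hb : max (G.1 : ℝ) G.2 ≤ |Casym| * min (G.1 : ℝ) G.2 := by
      have := (hbal G hG).trans (le_abs_self _)
      rwa [div_le_iff₀ hmin] at this
    have hpow : ∀ i j : ℕ, i ≤ j → (3 / 2 : ℝ) ^ j * G₀ ≤ max (G.1 : ℝ) G.2 →
        G₀ ≤ max (G.1 : ℝ) G.2 * ((9 / 10 : ℝ) ^ i * (9 / 10 : ℝ) ^ j) := by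
      intro i j hij hle
      have a1 : (9 / 10 : ℝ) ^ j ≤ (9 / 10 : ℝ) ^ i :=
        pow_le_pow_of_le_one (by norm_num) (by norm_num) hij
      -- As `(3/2) (9/10)² > 1`, growth in the larger index alone pays for the geometric decay in
      -- both.
      have a2 : (1 : ℝ) ≤ (3 / 2 : ℝ) ^ j * ((9 / 10 : ℝ) ^ j * (9 / 10 : ℝ) ^ j) := by
        rw [← mul_pow, ← mul_pow]
        exact one_le_pow₀ (by norm_num)
      calc (G₀ : ℝ) = 1 * G₀ := (one_mul _).symm
        _ ≤ (3 / 2 : ℝ) ^ j * ((9 / 10 : ℝ) ^ j * (9 / 10 : ℝ) ^ j) * G₀ := by gcongr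
        _ = (3 / 2 : ℝ) ^ j * G₀ * ((9 / 10 : ℝ) ^ j * (9 / 10 : ℝ) ^ j) := by ring
        _ ≤ max (G.1 : ℝ) G.2 * ((9 / 10 : ℝ) ^ i * (9 / 10 : ℝ) ^ j) := by gcongr
    have hq : (G₀ : ℝ) ≤ max (G.1 : ℝ) G.2 * ((9 / 10 : ℝ) ^ (φ G).1 * (9 / 10 : ℝ) ^ (φ G).2) := by
      have f1 : (3 / 2 : ℝ) ^ (φ G).1 * G₀ ≤ max (G.1 : ℝ) G.2 := by
        refine le_trans ?_ (le_max_left _ _)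
        rw [e1, Nat.cast_mul]
        have := pow_le_fib (φ G).1
        gcongr
      have f2 : (3 / 2 : ℝ) ^ (φ G).2 * G₀ ≤ max (G.1 : ℝ) G.2 := by
        refine le_trans ?_ (le_max_right _ _)
        rw [e2, Nat.cast_mul]
        have := pow_le_fib (φ G).2
        gcongr
      rcases le_total (φ G).1 (φ G).2 with h | h
      · exact hpow _ _ h f2
      · rw [mul_comm ((9 / 10 : ℝ) ^ (φ G).1)]
        exact hpow _ _ h f1
    rw [Nat.cast_min]
    set w := (9 / 10 : ℝ) ^ (φ G).1 * (9 / 10 : ℝ) ^ (φ G).2 with hw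
    have hw0 : 0 < w := by positivity
    have h5 : (G₀ : ℝ) ≤ |Casym| * min (G.1 : ℝ) G.2 * w :=
      hq.trans (by gcongr)
    have h6 : 2 * |Casym| / η * (n / G₀) * w = 2 * n * (|Casym| * w) / (η * G₀) := by
      field_simp
    rw [h6, div_le_div_iff₀ (by positivity) (by positivity)]
    have h7 := mul_le_mul_of_nonneg_left h5 (by positivity : 0 ≤ 2 * n * η)
    linarith
  have hinj : Set.InjOn φ H := by
    intro G hG G' hG' heq
    obtain ⟨e1, e2⟩ := hφ G hG
    obtain ⟨e1', e2'⟩ := hφ G' hG'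
    rw [heq] at e1 e2
    exact Prod.ext (e1.trans e1'.symm) (e2.trans e2'.symm)
  have hsumle : ∑ G ∈ H, ((9 / 10 : ℝ) ^ (φ G).1 * (9 / 10 : ℝ) ^ (φ G).2) ≤ T := by
    rw [← Finset.sum_image (f := fun x : ℕ × ℕ => (9 / 10 : ℝ) ^ x.1 * (9 / 10 : ℝ) ^ x.2) hinj]
    exact hsum.sum_le_tsum _ fun _ _ => by positivity
  have h1 : ((multiscaleCand X n η θ H).card : ℝ) ≤
      ∑ G ∈ H, ((mosumCand X n η (θ G) G).card : ℝ) := by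
    exact_mod_cast Finset.card_biUnion_le
  refine (h1.trans (Finset.sum_le_sum hterm)).trans ?_
  rw [← Finset.mul_sum]
  have h2 : 2 * |Casym| / η * (n / G₀) * ∑ G ∈ H, ((9 / 10 : ℝ) ^ (φ G).1 * (9 / 10 : ℝ) ^ (φ G).2)
      ≤ 2 * |Casym| / η * (n / G₀) * T := by gcongr
  refine h2.trans ?_
  have h3 : (0 : ℝ) ≤ n / G₀ := by positivity
  nlinarith

theorem multiscaleCand_inside {X : ℕ → ℝ} {n G₀ : ℕ} {η : ℝ} {θ : ℕ × ℕ → ℝ}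
    {H : Finset (ℕ × ℕ)} (hG₀ : 0 < G₀)
    (hmem : ∀ G ∈ H, G.1 ∈ bandwidths G₀ n ∧ G.2 ∈ bandwidths G₀ n) :
    Inside n (multiscaleCand X n η θ H) := by
  have hpos : ∀ g, g ∈ bandwidths G₀ n → 0 < g := by
    rintro g ⟨m, -, rfl, -⟩
    exact Nat.mul_pos (Nat.fib_pos.2 (by omega)) hG₀
  intro c hc
  obtain ⟨G, hG, hc⟩ := Finset.mem_biUnion.1 hc
  exact mosumCand_inside (hpos _ (hmem G hG).1) (hpos _ (hmem G hG).2) c hc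

/-! ### Events holding with probability tending to one -/

section WHP

variable {Ω : Type*} [MeasurableSpace Ω] {P : Measure Ω} {E F : ℕ → Set Ω}

theorem WHP.mono (hE : WHP P E) (h : ∀ᶠ n in atTop, E n ⊆ F n) : WHP P F := by
  refine tendsto_of_tendsto_of_tendsto_of_le_of_le' tendsto_const_nhds hE
    (Eventually.of_forall fun _ => zero_le) ?_
  filter_upwards [h] with n hn
  exact measure_mono (Set.compl_subset_compl.2 hn)

theorem WHP.inter (hE : WHP P E) (hF : WHP P F) : WHP P (fun n => E n ∩ F n) := by
  have h := Tendsto.add hE hF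
  rw [add_zero] at h
  refine tendsto_of_tendsto_of_tendsto_of_le_of_le tendsto_const_nhds h
    (fun _ => zero_le) fun n => ?_
  simp only [Set.compl_inter]
  exact measure_union_le _ _

theorem whp_abs_lt_of_tendstoInMeasure {f : ℕ → Ω → ℝ}
    (h : TendstoInMeasure P f atTop fun _ => 0) {δ : ℝ} (hδ : 0 < δ) :
    WHP P (fun n => {x | |f n x| < δ}) := by
  rw [tendstoInMeasure_iff_norm] at h
  refine (h δ hδ).congr fun n => ?_
  congr 1
  ext x
  simp

end WHP

/-- A sequence tending to zero still does so after multiplication with a sequence that diverges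
sufficiently slowly. -/
theorem exists_tendsto_mul_zero {u ν : ℕ → ℝ} (hu : Tendsto u atTop (𝓝 0))
    (hν : Tendsto ν atTop atTop) :
    ∃ ν' : ℕ → ℝ, Tendsto ν' atTop atTop ∧ (∀ n, ν' n ≤ ν n) ∧
      Tendsto (fun n => u n * ν' n) atTop (𝓝 0) := by
  -- The summand `1 / (n + 1)` keeps `v` positive where `u` vanishes. With `ν' = min ν v⁻¹` and `|u|
  -- ≤ v²`, the product is at most `v`.
  set v : ℕ → ℝ := fun n => √(|u n| + 1 / ((n : ℝ) + 1)) with hv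
  have hv0 : ∀ n, 0 < v n := fun n => by positivity
  have hvt : Tendsto v atTop (𝓝 0) := by
    have h := (hu.abs.add tendsto_one_div_add_atTop_nhds_zero_nat).sqrt
    simpa [hv] using h
  have hvi : Tendsto (fun n => (v n)⁻¹) atTop atTop :=
    tendsto_inv_nhdsGT_zero.comp
      (tendsto_nhdsWithin_iff.2 ⟨hvt, Eventually.of_forall hv0⟩)
  refine ⟨fun n => min (ν n) (v n)⁻¹, tendsto_atTop.2 fun b =>
    ((hν.eventually_ge_atTop b).and (hvi.eventually_ge_atTop b)).mono fun _ h => le_min h.1 h.2, fun n => min_le_left _ _, ?_⟩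
  refine squeeze_zero_norm' ?_ hvt
  filter_upwards [hν.eventually_ge_atTop 0] with n hn
  have h1 : 0 ≤ min (ν n) (v n)⁻¹ := le_min hn (inv_nonneg.2 (hv0 n).le)
  have h2 : |u n| ≤ v n ^ 2 := by
    rw [hv]
    dsimp only
    rw [Real.sq_sqrt (by positivity)]
    have : 0 ≤ 1 / ((n : ℝ) + 1) := by positivity
    linarith
  rw [Real.norm_eq_abs, abs_mul, abs_of_nonneg h1]
  calc |u n| * min (ν n) (v n)⁻¹ ≤ v n ^ 2 * (v n)⁻¹ := by
        gcongr
        exact min_le_right _ _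
    _ = v n := by
        have := (hv0 n).ne'
        field_simp

/-! ### Realisations of the change point model -/

namespace ChangePointModel

variable {Ω : Type*} (M : ChangePointModel) (ε : ℕ → ℕ → Ω → ℝ) {n : ℕ} {x : Ω}

/-- The realisation of the model at the sample size `n` and the outcome `x`. -/
def sample (n : ℕ) (x : Ω) : Sample := ⟨n, M.q n, M.k n, M.d n, M.f₀ n, fun t => ε n t x⟩

theorem sample_regular (hn : 1 ≤ n) : (M.sample ε n x).Regular :=
  ⟨hn, M.k_zero n hn, M.k_last n hn, M.k_lt n hn, fun j hj => M.d_ne_zero n j hj.1 hj.2⟩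

variable {M ε}

theorem sumBound_of_mem {w : ℕ → ℝ} (hx : x ∈ event11 ε w n) :
    (M.sample ε n x).SumBound (w n) := by
  intro s e hse hen
  have h := hx s e hse hen
  have hpos : (0 : ℝ) < (e : ℝ) - s := by
    have : (s : ℝ) < e := by exact_mod_cast hse
    linarith
  rw [one_div, inv_mul_le_iff₀ (Real.sqrt_pos.2 hpos)] at h
  have h2 := pow_le_pow_left₀ (abs_nonneg _) h 2
  rw [sq_abs, mul_pow, Real.sq_sqrt hpos.le, mul_comm] at h2
  exact h2

/-- The factor `√a` cancels: the averaged noise is at most `κ` times the jump size. -/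
theorem abs_le_of_weighted_le {a d ℓ S κ w : ℝ} (ha : 0 < a) (hd : d ≠ 0) (hℓ : 0 < ℓ)
    (hw : w ≤ κ * √a) (h : √(a / d ^ 2) / ℓ * |S| ≤ w) : |S| ≤ κ * |d| * ℓ := by
  have hd' : 0 < |d| := abs_pos.2 hd
  have ha' := Real.sqrt_pos.2 ha
  rw [Real.sqrt_div ha.le, Real.sqrt_sq_eq_abs] at h
  have h1 : √a * |S| / (|d| * ℓ) ≤ κ * √a := by
    refine le_trans (le_of_eq ?_) (h.trans hw)
    field_simp
  rw [div_le_iff₀ (by positivity)] at h1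
  refine le_of_mul_le_mul_left ?_ ha'
  linarith

theorem mul_abs_le_of_weighted_le {b d S w : ℝ} (hb : 0 < b) (hd : d ≠ 0)
    (hw : w ≤ √b) (h : 1 / √(b / d ^ 2) * |S| ≤ w) : |d| * |S| ≤ b := by
  have hd' : 0 < |d| := abs_pos.2 hd
  have hb' := Real.sqrt_pos.2 hb
  rw [Real.sqrt_div hb.le, Real.sqrt_sq_eq_abs] at h
  have h1 : |d| * |S| / √b ≤ √b := by
    refine le_trans (le_of_eq ?_) (h.trans hw)
    field_simp
  rwa [div_le_iff₀ hb', Real.mul_self_sqrt hb.le] at h1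

/-- The weighted event controls sums of scaled length at least `r₁ = a_n`, the maximal one those up
to `r₀ = b_n`. What matters is that `a_n` and `b_n` exceed the squared noise rates by the required
factors. -/
theorem localBound_of_mem (hn : 1 ≤ n) {a b w₁ w₂ : ℕ → ℝ} {κ : ℝ} (ha : 0 < a n) (hb : 0 < b n)
    (hw₁ : w₁ n ≤ κ * √(a n)) (hw₂ : w₂ n ≤ √(b n)) (h₁ : x ∈ event12 M ε M.k a w₁ n)
    (h₂ : x ∈ event13 M ε b w₂ n) : (M.sample ε n x).LocalBound (b n) (a n) κ := by
  have hd : ∀ j, (M.sample ε n x).Idx j → M.d n j ≠ 0 := fun j hj => M.d_ne_zero n j hj.1 hj.2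
  have hd2 : ∀ j, (M.sample ε n x).Idx j → 0 < M.d n j ^ 2 := fun j hj => by
    have := hd j hj
    positivity
  have hcast : ∀ {s e : ℕ}, s ≤ e → ((e - s : ℕ) : ℝ) = (e : ℝ) - s := fun h => Nat.cast_sub h
  refine ⟨fun j hj s hs hs' hr => ?_, fun j hj e he he' hr => ?_, fun j hj s hs hr => ?_,
    fun j hj e he hr => ?_⟩ <;>
    simp only [sample] at *
  · have hle : a n / M.d n j ^ 2 ≤ ((M.k n j - s : ℕ) : ℝ) := by
      rw [hcast hs, div_le_iff₀ (hd2 j hj)]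
      linarith
    have h := (h₁ j hj.1 hj.2 _ hle).1 (by omega) (by omega)
    rw [Nat.sub_sub_self hs] at h
    have hpos : (0 : ℝ) < ((M.k n j - s : ℕ) : ℝ) :=
      lt_of_lt_of_le (div_pos ha (hd2 j hj)) hle
    rw [← hcast hs]
    exact abs_le_of_weighted_le ha (hd j hj) hpos hw₁ h
  · have hle : a n / M.d n j ^ 2 ≤ ((e - M.k n j : ℕ) : ℝ) := by
      rw [hcast he, div_le_iff₀ (hd2 j hj)]
      linarith
    have hen : M.k n (j + 1) ≤ n :=
      ((M.sample_regular ε (x := x) hn).k_le_of_le (Nat.succ_le_succ hj.2) le_rfl).trans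
        (M.k_last n hn).le
    have h := (h₁ j hj.1 hj.2 _ hle).2 (by omega) (by omega)
    rw [Nat.add_sub_cancel' he] at h
    have hpos : (0 : ℝ) < ((e - M.k n j : ℕ) : ℝ) :=
      lt_of_lt_of_le (div_pos ha (hd2 j hj)) hle
    rw [← hcast he]
    exact abs_le_of_weighted_le ha (hd j hj) hpos hw₁ h
  · have hle : ((M.k n j - s : ℕ) : ℝ) ≤ b n / M.d n j ^ 2 := by
      rw [hcast hs.le, le_div_iff₀ (hd2 j hj)]
      linarith
    have h := (h₂ j hj.1 hj.2 _ (by omega) hle).1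
    rw [Nat.sub_sub_self hs.le] at h
    exact mul_abs_le_of_weighted_le hb (hd j hj) hw₂ h
  · have hle : ((e - M.k n j : ℕ) : ℝ) ≤ b n / M.d n j ^ 2 := by
      rw [hcast he.le, le_div_iff₀ (hd2 j hj)]
      linarith
    have h := (h₂ j hj.1 hj.2 _ (by omega) hle).2
    rw [Nat.add_sub_cancel' he.le] at h
    exact mul_abs_le_of_weighted_le hb (hd j hj) hw₂ h

theorem eventually_ofReal_le_D {ξ : ℕ → ℝ}
    (h : Tendsto (fun n => ENNReal.ofReal (ξ n) / M.D n) atTop (𝓝 0)) {κ : ℝ} (hκ : 0 < κ) :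
    ∀ᶠ n in atTop, ENNReal.ofReal (ξ n) ≤ ENNReal.ofReal κ * M.D n := by
  have hκ' : (0 : ENNReal) < ENNReal.ofReal κ := ENNReal.ofReal_pos.2 hκ
  filter_upwards [h.eventually_le_const hκ'] with n hn
  exact (ENNReal.div_le_iff_le_mul (Or.inr ENNReal.ofReal_ne_top) (Or.inr hκ'.ne')).1 hn

theorem le_of_ofReal_le_D {ξ κ : ℝ} (hκ : 0 ≤ κ)
    (h : ENNReal.ofReal ξ ≤ ENNReal.ofReal κ * M.D n) {j : ℕ} (hj : 1 ≤ j) (hj' : j ≤ M.q n) :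
    ξ ≤ κ * (M.d n j ^ 2 * (spacing (M.k n) j : ℝ)) := by
  have h1 : M.D n ≤ ENNReal.ofReal (M.d n j ^ 2 * (spacing (M.k n) j : ℝ)) :=
    iInf₂_le j (Finset.mem_Icc.2 ⟨hj, hj'⟩)
  have h2 := h.trans (mul_le_mul_right h1 _)
  rw [← ENNReal.ofReal_mul hκ] at h2
  exact (ENNReal.ofReal_le_ofReal_iff (by positivity)).1 h2

end ChangePointModel

/-- With probability tending to one, the average of the squared errors is bounded away from zero
and from infinity. -/
theorem whp_energy {Ω : Type*} [MeasurableSpace Ω] {P : Measure Ω} [IsProbabilityMeasure P]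
    {M : ChangePointModel} {ε : ℕ → ℕ → Ω → ℝ} {w w₁ w₂ : ℕ → ℝ}
    (h : ErrorAssumption P M ε w w₁ w₂) :
    ∃ cv Cv : ℝ, 0 < cv ∧ cv ≤ Cv ∧ WHP P (fun n => {x |
      2 * cv * n ≤ ∑ t ∈ Finset.Ioc 0 n, ε n t x ^ 2 ∧
      2 * ∑ t ∈ Finset.Ioc 0 n, ε n t x ^ 2 ≤ Cv * n}) := by
  obtain ⟨c, C, hc, hcC⟩ := h.variance_bounds
  have hcC1 : c ≤ C := (hcC 1 1 le_rfl le_rfl).1.trans (hcC 1 1 le_rfl le_rfl).2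
  -- The average of the squares is within `c / 2` of its mean, which lies in `[c, C]`; hence it lies
  -- in `[c / 2, C + c / 2]`.
  refine ⟨c / 4, 2 * (C + c), by positivity, by linarith,
    (whp_abs_lt_of_tendstoInMeasure h.ergodic.2 (half_pos hc)).mono ?_⟩
  filter_upwards [eventually_ge_atTop 1] with n hn x hx
  have hn' : (0 : ℝ) < n := by exact_mod_cast hn
  have hx' : |(∑ t ∈ Finset.Icc 1 n, (ε n t x ^ 2 - ∫ y, ε n t y ^ 2 ∂P)) / n| < c / 2 := hx
  have hint : ∀ t ∈ Finset.Icc 1 n, c ≤ ∫ y, ε n t y ^ 2 ∂P ∧ ∫ y, ε n t y ^ 2 ∂P ≤ C := by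
    intro t ht
    rw [Finset.mem_Icc] at ht
    have h1 := variance_eq_sub (h.memLp n t ht.1 ht.2)
    rw [h.mean_zero n t ht.1 ht.2] at h1
    have h2 := hcC n t ht.1 ht.2
    rw [h1] at h2
    simpa using h2
  have hlow : (n : ℝ) * c ≤ ∑ t ∈ Finset.Icc 1 n, ∫ y, ε n t y ^ 2 ∂P := by
    have := Finset.card_nsmul_le_sum _ _ c fun t ht => (hint t ht).1
    simpa using this
  have hup : ∑ t ∈ Finset.Icc 1 n, ∫ y, ε n t y ^ 2 ∂P ≤ (n : ℝ) * C := by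
    have := Finset.sum_le_card_nsmul _ _ C fun t ht => (hint t ht).2
    simpa using this
  rw [abs_div, abs_of_pos hn', div_lt_iff₀ hn', abs_lt, Finset.sum_sub_distrib] at hx'
  have hI : Finset.Ioc 0 n = Finset.Icc 1 n := by
    ext t
    simp [Nat.succ_le_iff]
  simp only [Set.mem_ofPred_eq, hI]
  constructor <;> linarith

end MosumPruning

end

/-! ### The choice of the rates and the proof of consistency. -/

open MosumPruning
theorem mainTheorem4 {Ω : Type*} [MeasurableSpace Ω] (P : Measure Ω) [IsProbabilityMeasure P]
    (M : ChangePointModel) (ε : ℕ → ℕ → Ω → ℝ)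
    (w w₁ w₂ ξ : ℕ → ℝ)
    (hError : ErrorAssumption P M ε w w₁ w₂)
    (hRate : RateAssumption w w₁ w₂)
    (hSize : SizeAssumption M w)
    (hPenalty : PenaltyAssumption M w ξ)
    -- the multiscale MOSUM procedure: bandwidths, `η`-criterion, thresholds `τ * D_n(G; α)`
    (G₀ : ℕ → ℕ) (Casym : ℝ) (H : ℕ → Finset (ℕ × ℕ))
    (hBandwidth : BandwidthAssumption w G₀ Casym H)
    (η α τ : ℝ) (hη : 0 < η ∧ η < 1) (hα : 0 < α ∧ α < 1) (hτ : 0 < τ)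
    (thr : ℕ → ℕ × ℕ → ℝ)
    (hLevel : HasAsymptoticLevel P ε α H (fun n G => τ * thr n G))
    -- a suitable bandwidth for each change point, and the error bounds around `k_j ± G(j)`
    (g : ℕ → ℕ → ℕ) (cM : ℝ) (hcM : 0 < cM)
    (hSuitable : SuitableBandwidths M H g cM)
    (hShift : ShiftedErrorAssumption P M ε g w₁)
    -- the candidate set, and detection intervals assigned to the candidates
    (C : ℕ → Ω → Finset ℕ)
    (hC : ∀ n x, C n x = multiscaleCand (M.obs ε n x) n η (fun G => τ * thr n G) (H n))
    (bw : ℕ → Ω → ℕ → ℕ × ℕ)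
    (hbw : ∀ n x, ∀ c ∈ C n x, bw n x c ∈ H n ∧
      c ∈ mosumCand (M.obs ε n x) n η (τ * thr n (bw n x c)) (bw n x c))
    (hInterval : DetectionIntervalAssumption P M (fun n => w₁ n ^ 2) ξ C
      (fun n x c => (bw n x c).1) (fun n x c => (bw n x c).2))
    -- an arbitrary sorting function
    (h : ℕ → Ω → ℕ → ℝ)
    (ν : ℕ → ℝ) (hν : Tendsto ν atTop atTop) :
    WHP P (fun n => {x |
      (∃ R, IsLocAlgOutput (M.obs ε n x) n (ξ n) (fun c => (bw n x c).1)
        (fun c => (bw n x c).2) (h n x) (C n x) R) ∧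
      ∀ R, IsLocAlgOutput (M.obs ε n x) n (ξ n) (fun c => (bw n x c).1)
          (fun c => (bw n x c).2) (h n x) (C n x) R →
        R.card = M.q n ∧
        ∀ j, 1 ≤ j → j ≤ M.q n →
          M.d n j ^ 2 * |(estimator R j : ℝ) - M.k n j| ≤ ν n * w₁ n ^ 2}) := by
  obtain ⟨cv, Cv, hcv, hcC, hE⟩ := whp_energy hError
  obtain ⟨Cd', hCd'⟩ := M.d_bounded
  set Cd := max Cd' 1 with hCd
  have hCd0 : 0 < Cd := lt_max_of_lt_right one_pos
  obtain ⟨κ, hκ0, hκ⟩ := Sample.exists_tame hcv hcC hCd0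
  obtain ⟨K, hK0, hK⟩ := exists_card_multiscaleCand_le (Casym := Casym) hη.1 hη.2
  have hCv : 0 < Cv := hcv.trans_le hcC
  obtain ⟨B₁, hB₁, hwB⟩ := hRate.first_le.exists_pos
  obtain ⟨B₂, hB₂, hw₂B⟩ := hRate.second_le_first.exists_pos
  obtain ⟨B₀, hB₀, hw1B⟩ := hRate.one_le.exists_pos
  have hu : Tendsto (fun n => w₁ n ^ 2 / ξ n) atTop (𝓝 0) := by
    have h1 : Tendsto (fun n => B₁ ^ 2 * (w n ^ 2 / ξ n)) atTop (𝓝 0) := by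
      simpa using hPenalty.noise_div.const_mul (B₁ ^ 2)
    refine squeeze_zero' ?_ ?_ h1
    · filter_upwards [hPenalty.pos] with n hn
      positivity
    · filter_upwards [hPenalty.pos, hwB.bound] with n hn hn'
      rw [Real.norm_eq_abs, Real.norm_eq_abs] at hn'
      have h2 := pow_le_pow_left₀ (abs_nonneg _) hn' 2
      rw [mul_pow, sq_abs, sq_abs] at h2
      rw [← mul_div_assoc]
      gcongr
  obtain ⟨ν₁, hν₁, hν₁ν, hu₁⟩ := exists_tendsto_mul_zero hu hν
  have hν₀ : Tendsto (fun n => √(ν₁ n)) atTop atTop := Real.tendsto_sqrt_atTop.comp hν₁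
  -- Both rates have the order `ω₁²` up to diverging factors, and `r₁ / r₀ = √ν₁ → ∞`. They also
  -- serve as the sequences `a_n` and `b_n` of the error assumption.
  set r₁ : ℕ → ℝ := fun n => w₁ n ^ 2 * ν₁ n with hr₁
  set r₀ : ℕ → ℝ := fun n => w₁ n ^ 2 * √(ν₁ n) with hr₀
  -- The cap at `1` also yields `r₀ ≤ r₁ ≤ ξ` and `ω² ≤ ξ`, needed for admissibility and for
  -- counting the change points.
  set κ' := min κ 1 with hκ'
  have hκ'0 : 0 < κ' := lt_min hκ0 one_pos
  have hw₁low : ∀ᶠ n in atTop, 1 ≤ B₀ ^ 2 * w₁ n ^ 2 := by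
    filter_upwards [hw1B.bound] with n hn
    rw [norm_one, Real.norm_eq_abs] at hn
    have := pow_le_pow_left₀ zero_le_one hn 2
    rwa [one_pow, mul_pow, sq_abs] at this
  have hr₁ξ : ∀ᶠ n in atTop, r₁ n ≤ κ' * ξ n := by
    filter_upwards [hu₁.eventually_le_const hκ'0, hPenalty.pos] with n hn hn'
    rwa [div_mul_eq_mul_div, div_le_iff₀ hn'] at hn
  have hr₀r₁ : ∀ᶠ n in atTop, r₀ n ≤ κ' * r₁ n := by
    filter_upwards [hν₀.eventually_ge_atTop (1 / κ'), hν₁.eventually_ge_atTop 0] with n hn hn'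
    rw [div_le_iff₀ hκ'0] at hn
    have h1 := mul_le_mul_of_nonneg_right hn (mul_nonneg (sq_nonneg (w₁ n)) (Real.sqrt_nonneg (ν₁ n)))
    have h2 := Real.mul_self_sqrt hn'
    calc r₀ n = 1 * (w₁ n ^ 2 * √(ν₁ n)) := by rw [one_mul]
      _ ≤ _ := h1
      _ = κ' * (w₁ n ^ 2 * (√(ν₁ n) * √(ν₁ n))) := by ring
      _ = κ' * r₁ n := by rw [h2]
  have hr₀1 : ∀ᶠ n in atTop, 1 ≤ r₀ n := by
    filter_upwards [hν₀.eventually_ge_atTop (B₀ ^ 2), hw₁low] with n hn hn'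
    calc (1 : ℝ) ≤ B₀ ^ 2 * w₁ n ^ 2 := hn'
      _ ≤ √(ν₁ n) * w₁ n ^ 2 := by gcongr
      _ = r₀ n := mul_comm _ _
  have hr₁1 : ∀ᶠ n in atTop, r₀ n ≤ r₁ n ∧ 1 ≤ r₁ n ∧ r₁ n ≤ ξ n := by
    filter_upwards [hr₀1, hr₀r₁, hr₁ξ, hPenalty.pos] with n h1 h2 h3 h4
    have h5 : κ' ≤ 1 := min_le_right _ _
    have h6 : 0 ≤ r₁ n := by
      by_contra hneg
      have := mul_neg_of_pos_of_neg hκ'0 (not_le.1 hneg)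
      linarith
    have h7 := mul_le_mul_of_nonneg_right h5 h6
    have h8 := mul_le_mul_of_nonneg_right h5 h4.le
    exact ⟨by linarith, by linarith, by linarith⟩
  have hξD := ChangePointModel.eventually_ofReal_le_D hPenalty.div_D one_pos
  have hadm₁ : M.Admissible r₁ := by
    filter_upwards [hr₁1, hξD] with n h1 h2
    rw [ENNReal.ofReal_one, one_mul] at h2
    exact ⟨h1.2.1, (ENNReal.ofReal_le_ofReal h1.2.2).trans h2⟩
  have hadm₀ : M.Admissible r₀ := by
    filter_upwards [hr₁1, hr₀1, hξD] with n h1 h0 h2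
    rw [ENNReal.ofReal_one, one_mul] at h2
    exact ⟨h0, (ENNReal.ofReal_le_ofReal (h1.1.trans h1.2.2)).trans h2⟩
  have hw₁r : ∀ᶠ n in atTop, w₁ n ≤ κ * √(r₁ n) := by
    filter_upwards [hν₀.eventually_ge_atTop (1 / κ)] with n hn
    rw [div_le_iff₀ hκ0] at hn
    rw [hr₁]
    dsimp only
    rw [Real.sqrt_mul (sq_nonneg _), Real.sqrt_sq_eq_abs]
    have h1 := mul_le_mul_of_nonneg_left hn (abs_nonneg (w₁ n))
    have h2 := le_abs_self (w₁ n)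
    linarith
  have hw₂r : ∀ᶠ n in atTop, w₂ n ≤ √(r₀ n) := by
    have hν₂ : Tendsto (fun n => √(√(ν₁ n))) atTop atTop := Real.tendsto_sqrt_atTop.comp hν₀
    filter_upwards [hν₂.eventually_ge_atTop B₂, hw₂B.bound] with n hn hn'
    rw [Real.norm_eq_abs, Real.norm_eq_abs] at hn'
    rw [hr₀]
    dsimp only
    rw [Real.sqrt_mul (sq_nonneg _), Real.sqrt_sq_eq_abs]
    have h1 := mul_le_mul_of_nonneg_left hn (abs_nonneg (w₁ n))
    have h2 := le_abs_self (w₂ n)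
    linarith
  -- Chosen so that `q ξ`, and with it `q ω²`, is at most `cv n / 4`.
  set κq := cv / (4 * Cd ^ 2) with hκq
  have hκq0 : 0 < κq := by positivity
  -- Then `A ξ = m + 2 ξ`, which exceeds `m + r₀` because `r₀ ≤ ξ`; the detection intervals are as
  -- long as `State.step` requires.
  set A := 256 * Cv + 2 with hA
  have hA0 : 0 < A := by positivity
  have hgood := ((hError.whp11.inter (hError.whp12_13 r₁ r₀ hadm₁ hadm₀)).inter hE).inter
    (hInterval _ hν₀ A⁻¹ (inv_pos.2 hA0))
  refine hgood.mono ?_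
  filter_upwards [eventually_ge_atTop 1, hCd', hPenalty.pos, hr₁ξ, hr₀r₁, hr₀1, hr₁1, hw₁r, hw₂r,
    ChangePointModel.eventually_ofReal_le_D hPenalty.div_D hκ0,
    ChangePointModel.eventually_ofReal_le_D hPenalty.div_D hκq0,
    hPenalty.noise_div.eventually_le_const hκ'0,
    hBandwidth.noise_div.eventually_le_const (show (0 : ℝ) < cv / (4 * K) by positivity),
    hBandwidth.pos] with n hn hdn hξ hr₁ξn hr₀r₁n hr₀1n hr₁1n hw₁n hw₂n hDκ hDq hnξ hnG hG
  rintro x ⟨⟨⟨hx11, hx12, hx13⟩, hxE⟩, hxI⟩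
  have hn' : (0 : ℝ) < n := by exact_mod_cast hn
  have hG' : (0 : ℝ) < G₀ n := by exact_mod_cast hG
  have hin : Inside n (C n x) := by
    rw [hC]
    exact multiscaleCand_inside hG (hBandwidth.mem n)
  refine ⟨exists_locRun _ _ _ _ _ _ ∅ hin, fun R hR => ?_⟩
  have hx : ∀ j, 1 ≤ j → j ≤ M.q n → ∃ c ∈ C n x,
      M.d n j ^ 2 * |(c : ℝ) - M.k n j| ≤ w₁ n ^ 2 * √(ν₁ n) ∧
      ξ n ≤ A⁻¹ * (M.d n j ^ 2 * (min (bw n x c).1 (bw n x c).2 : ℝ)) := hxI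
  -- Without candidates there is no change point and the output is empty. Otherwise the summand `1`
  -- in the count of segments is absorbed by the number of candidates.
  rcases (C n x).eq_empty_or_nonempty with hC0 | hne
  · have hq : M.q n = 0 := by
      by_contra hq
      obtain ⟨c, hc, -⟩ := hx 1 le_rfl (Nat.one_le_iff_ne_zero.2 hq)
      simp [hC0] at hc
    rw [hC0] at hR
    have hR0 : R = ∅ := by
      cases hR with
      | done => rfl
      | step C K C' K' R hs _ =>
        obtain ⟨c₀, _, _, _, hc₀, -⟩ := hs
        simp at hc₀
    exact ⟨by simp [hR0, hq], fun j h1 h2 => by omega⟩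
  set Z := M.sample ε n x with hZ
  have hreg : Z.Regular := M.sample_regular ε hn
  have hidx : ∀ j, Z.Idx j → 1 ≤ j ∧ j ≤ M.q n := fun j hj => hj
  have hcard : ((C n x).card : ℝ) ≤ K * (n / G₀ n) := by
    rw [hC]
    exact hK _ _ _ _ _ hG (hBandwidth.mem n) (hBandwidth.balanced n)
  have hdZ : ∀ j, Z.Idx j → |Z.d j| ≤ Cd := fun j hj =>
    (hdn j hj.1 hj.2).trans (le_max_left _ _)
  have hwξ : w n ^ 2 ≤ κ' * ξ n := by
    rwa [div_le_iff₀ hξ] at hnξ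
  have hbase : K * (n / G₀ n) * w n ^ 2 ≤ cv / 4 * n := by
    calc K * (n / G₀ n) * w n ^ 2 = K * n * (w n ^ 2 / G₀ n) := by ring
      _ ≤ K * n * (cv / (4 * K)) := by gcongr
      _ = cv / 4 * n := by
        field_simp
  have hcount : (((C n x).card : ℝ) + Z.q + 1) * w n ^ 2 ≤ cv * Z.n := by
    have h1 : ((C n x).card : ℝ) * w n ^ 2 ≤ cv / 4 * n :=
      (mul_le_mul_of_nonneg_right hcard (sq_nonneg _)).trans hbase
    have h2 : 1 * w n ^ 2 ≤ cv / 4 * n := by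
      have : (1 : ℝ) ≤ (C n x).card := by exact_mod_cast hne.card_pos
      exact (mul_le_mul_of_nonneg_right this (sq_nonneg _)).trans h1
    have h3 : (Z.q : ℝ) * w n ^ 2 ≤ cv / 4 * n := by
      have e1 := hreg.q_mul_le hκq0.le hdZ
        (fun j hj => ChangePointModel.le_of_ofReal_le_D hκq0.le hDq hj.1 hj.2)
      have e2 : w n ^ 2 ≤ ξ n :=
        hwξ.trans (mul_le_of_le_one_left hξ.le (min_le_right _ _))
      have e3 : κq * Cd ^ 2 = cv / 4 := by
        rw [hκq]
        field_simp
      rw [e3] at e1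
      exact (mul_le_mul_of_nonneg_left e2 (Nat.cast_nonneg _)).trans e1
    have h4 : 0 < cv * n := by positivity
    change _ ≤ cv * (n : ℝ)
    linarith
  have hκle : κ' ≤ κ := min_le_left _ _
  have hr₁0 : 0 ≤ r₁ n := zero_le_one.trans hr₁1n.2.1
  obtain ⟨S, hSξ, hS₀, hS₁, hSm, hT⟩ := hκ Z (C n x) (w n) (ξ n) (r₀ n) (r₁ n) hreg
    (ChangePointModel.sumBound_of_mem hx11)
    (ChangePointModel.localBound_of_mem hn (by linarith [hr₁1n.2.1]) (by linarith) hw₁n hw₂n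
      hx12 hx13) hin hξ hdZ hxE.1 hxE.2 hcount
    (hwξ.trans (mul_le_mul_of_nonneg_right hκle hξ.le))
    (fun j hj => ChangePointModel.le_of_ofReal_le_D hκ0.le hDκ hj.1 hj.2) hr₁0
    (hr₁ξn.trans (mul_le_mul_of_nonneg_right hκle hξ.le))
    (hr₀r₁n.trans (mul_le_mul_of_nonneg_right hκle hr₁0))
  choose! chk hchk using hx
  have hrun : IsLocAlgOutput Z.obs Z.n S.ξ (fun c => (bw n x c).1) (fun c => (bw n x c).2)
      (h n x) (C n x) R := by
    rw [hSξ]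
    exact hR
  have hmain := hT.locAlg (chk := chk) (fun j hj => ?_) (fun j hj => ?_) hrun
  · refine ⟨hmain.1, fun j h1 h2 => (hmain.2 j ⟨h1, h2⟩).trans ?_⟩
    rw [hS₁]
    exact (mul_comm _ _).trans_le (mul_le_mul_of_nonneg_right (hν₁ν n) (sq_nonneg _))
  · rw [hS₀]
    exact ⟨(hchk j hj.1 hj.2).1, (hchk j hj.1 hj.2).2.1⟩
  · have h1 := (hchk j hj.1 hj.2).2.2
    rw [inv_mul_eq_div, le_div_iff₀ hA0, hA] at h1
    have h2 : S.m + S.r₀ < M.d n j ^ 2 *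
        (min (bw n x (chk j)).1 (bw n x (chk j)).2 : ℝ) := by
      rw [hSm, hS₀]
      linarith [hr₁1n.1, hr₁1n.2.2]
    exact ⟨h2.trans_le (mul_le_mul_of_nonneg_left (min_le_left _ _) (sq_nonneg _)),
      h2.trans_le (mul_le_mul_of_nonneg_left (min_le_right _ _) (sq_nonneg _))⟩
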